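/- All manifolds, Lie groups and maps are smooth, real and finite-dimensional; manifolds are Hausdorff without boundary. **Conventions.** Let $G$ be a Lie group with Lie algebra $\mathfrak g$ and an $\mathrm{Ad}$-invariant symmetric tensor $s\in S^2\mathfrak g$; let $s^\sharp:\mathfrak g^*\to\mathfrak g$, $\beta(s^\sharp\alpha)=s(\alpha,\beta)$, and let $\phi\in\bigwedge^3\mathfrak g$ be $\phi(\alpha,\beta,\gamma)=\frac14\alpha([s^\sharp\beta,s^\sharp\gamma])$. For an action of $G$ on $M$ let $\rho:\mathfrak g\to\Gamma(TM)$, $\rho(\xi)_x=\frac{d}{dt}\big|_{0}\exp(-t\xi)\cdot x$, be the Lie algebra action, extended to $\bigwedge\mathfrak g\to\Gamma(\bigwedge TM)$. A *quasi-Poisson $G$-manifold* is $(M,\rho,\pi)$ with a $G$-invariant bivector field $\pi$ such that $\frac12[\pi,\pi]=\rho(\phi)$, where $\frac12[\pi,\pi](df,dg,dh)=\{f,\{g,h\}\}+\{g,\{h,f\}\}+\{h,\{f,g\}\}$ for $\{f,g\}=\pi(df,dg)$. For a product $G\times H$ one uses $s_G+s_H$. Let $\tau$ be an $s$-preserving automorphism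 of $G$. A *$\tau$-twisted moment map* is a map $\mu:M\to G$ with $\mu(g\cdot x)=\tau(g)\mu(x)g^{-1}$ and $(\mu_*\otimes\mathrm{id})\pi=-\frac12 s^{ij}\bigl(e_i^L+\tau(e_i)^R\bigr)\otimes\rho(e_j)$, where $e_i$ is a basis of $\mathfrak g$ and $\xi^L,\xi^R$ are the left- and right-invariant vector fields. A Lie subgroup $C\subseteq G$ with Lie algebra $\mathfrak c$ is *reducing* if $\phi(\alpha,\beta,\gamma)=0$ for all $\alpha,\beta,\gamma\in\operatorname{ann}(\mathfrak c)\subseteq\mathfrak g^*$. Submanifolds are images of injective immersions $A\to M$ with $A$ second countable such that every smooth map to $M$ with values in the image is smooth as a map to $A$ (for instance embedded submanifolds, and orbits of Lie group actions). Two submanifolds $S,T$ *intersect cleanly* if $S\cap T$ is a submanifold and $T(S\cap T)=TS\cap TT$. **Theorem.** Let $(M,\rho,\pi)$ be a quasi-Poisson $G\times H$-manifold, let $C\subseteq G$ be a reducing subgroup, and suppose that the $C$-orbits of $M$ form a regular foliation, i.e. $M/C$ is a manifold and $M\to M/C$ is a surjective submersion. 1. The bivector field $\pi$ descends to a bivector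 field on $M/C$, which makes $M/C$, with the induced action of $H$, a quasi-Poisson $H$-manifold. 2. Let $\tau_G,\tau_H$ be $s_G$- resp. $s_H$-preserving automorphisms of $G$ and $H$, and let $(\mu_G,\mu_H):M\to G\times H$ be a $(\tau_G,\tau_H)$-twisted moment map. Let $\hat C\subseteq G\times G$ be a Lie subgroup which contains $\{(c,c):c\in C\}$ and whose Lie algebra is $\hat{\mathfrak c}=\{(\xi+s_G^\sharp\alpha,\xi-s_G^\sharp\alpha):\xi\in\mathfrak c,\ \alpha\in\operatorname{ann}(\mathfrak c)\}$; it acts on $G$ by $(g_1,g_2)\cdot g=\tau_G(g_1)\,g\,g_2^{-1}$. Let $K\subseteq G$ be a $\hat C$-stable submanifold such that $\operatorname{gr}(\mu_G)=\{(\mu_G(x),x):x\in M\}$ and $K\times M$ intersect cleanly in $G\times M$. Then $\mu_G^{-1}(K)/C\subseteq M/C$ is a quasi-Poisson $H$-submanifold: it is an $H$-stable submanifold (embedded if $\mu_G^{-1}(K)\subseteq M$ is embedded), and it carries a bivector field that is mapped by the inclusion to the one of $M/C$ and makes it a quasi-Poisson $H$-manifold. Moreover $\mu_H$ descends to a map $\mu_G^{-1}(K)/C\to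 H$, which is a $\tau_H$-twisted moment map. -/

import Mathlib

open scoped Manifold ContDiff
open Set

universe uM

noncomputable section

/-! ### Lie algebras of Lie groups and their morphisms -/

section LieGroups

variable {E : Type*} [NormedAddCommGroup E] [NormedSpace ℝ E] {X : Type*} [TopologicalSpace X]
  (I : ModelWithCorners ℝ E X) {G : Type*} [TopologicalSpace G] [ChartedSpace X G] [Group G]
  {E' : Type*} [NormedAddCommGroup E'] [NormedSpace ℝ E'] {X' : Type*} [TopologicalSpace X']
  (I' : ModelWithCorners ℝ E' X') {G' : Type*} [TopologicalSpace G'] [ChartedSpace X' G']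
  [Group G']

/-- The dual of the Lie algebra of `G`. -/
abbrev LieDual (G : Type*) [TopologicalSpace G] [ChartedSpace X G] [Group G] : Type _ :=
  GroupLieAlgebra I G →L[ℝ] ℝ

/-- A two-tensor `s ∈ 𝔤 ⊗ 𝔤`, given by the map `s♯ : 𝔤* → 𝔤`, `β (s♯ α) = s (α, β)`. -/
abbrev TwoTensor (G : Type*) [TopologicalSpace G] [ChartedSpace X G] [Group G] : Type _ :=
  LieDual I G →ₗ[ℝ] GroupLieAlgebra I G

/-- The map of Lie algebras induced by a homomorphism: its derivative at the unit. -/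
def lieMap (f : G →* G') : GroupLieAlgebra I G →L[ℝ] GroupLieAlgebra I' G' :=
  (mfderiv I I' (⇑f) (1 : G) : TangentSpace I (1 : G) →L[ℝ] TangentSpace I' (f 1))

/-- The image `(f ⊗ f) s` of a two-tensor under a homomorphism. -/
def pushTensor (f : G →* G') (s : TwoTensor I G) : TwoTensor I' G' where
  toFun α := lieMap I I' f (s (α.comp (lieMap I I' f)))
  map_add' α β := by
    rw [ContinuousLinearMap.add_comp, map_add, map_add]
  map_smul' c α := by
    rw [ContinuousLinearMap.smul_comp, map_smul, map_smul, RingHom.id_apply]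

variable {I} in
/-- `s` is an `Ad`-invariant element of `S²𝔤`. -/
structure IsInvariantSymmetric (s : TwoTensor I G) : Prop where
  symm : ∀ α β : LieDual I G, β (s α) = α (s β)
  invariant : ∀ g : G, pushTensor I I (MulAut.conj g).toMonoidHom s = s

variable {I} in
/-- The three-tensor `φ (α, β, γ) = ¼ α ([s♯ β, s♯ γ])`. -/
def cartanTensor (s : TwoTensor I G) (α β γ : LieDual I G) : ℝ :=
  (1 / 4) * α ⁅s β, s γ⁆

variable {I I'} in
/-- The tensor `s + s'` on `𝔤 ⊕ 𝔤'`, the Lie algebra of `G × G'`. -/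
def sumTensor (s : TwoTensor I G) (s' : TwoTensor I' G') : TwoTensor (I.prod I') (G × G') :=
  pushTensor I (I.prod I') (MonoidHom.inl G G') s +
    pushTensor I' (I.prod I') (MonoidHom.inr G G') s'

/-- The homomorphism `ι` exhibits the Lie group `G` as a (possibly immersed) Lie subgroup
of `G'`. -/
structure IsLieSubgroup (ι : G →* G') : Prop where
  injective : Function.Injective ι
  immersion : Manifold.IsImmersion I I' ∞ ι

/-- The Lie algebra of the Lie subgroup `ι : G → G'`, as a subset of the Lie algebra of `G'`. -/
def subgroupLieAlgebra (ι : G →* G') : Set (GroupLieAlgebra I' G') :=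
  range (lieMap I I' ι)

variable {I} in
/-- The annihilator of a subset of the Lie algebra. -/
def lieAnnihilator (c : Set (GroupLieAlgebra I G)) : Set (LieDual I G) :=
  {α | ∀ ξ ∈ c, α ξ = 0}

variable {I'} in
/-- A Lie subgroup with Lie algebra `𝔠` is reducing if `φ` vanishes on the annihilator of `𝔠`. -/
def IsReducing (s : TwoTensor I' G') (ι : G →* G') : Prop :=
  ∀ α ∈ lieAnnihilator (subgroupLieAlgebra I I' ι),
    ∀ β ∈ lieAnnihilator (subgroupLieAlgebra I I' ι),
      ∀ γ ∈ lieAnnihilator (subgroupLieAlgebra I I' ι), cartanTensor s α β γ = 0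

variable {I} in
/-- The subset `ĉ = {(ξ + s♯ α, ξ - s♯ α) | ξ ∈ 𝔠, α ∈ ann 𝔠}` of `𝔤 ⊕ 𝔤`. -/
def doubledLieAlgebra (s : TwoTensor I G) (c : Set (GroupLieAlgebra I G)) :
    Set (GroupLieAlgebra (I.prod I) (G × G)) :=
  {v | ∃ ξ ∈ c, ∃ α ∈ lieAnnihilator c,
    v = lieMap I (I.prod I) (MonoidHom.inl G G) (ξ + s α) +
      lieMap I (I.prod I) (MonoidHom.inr G G) (ξ - s α)}

variable {I} in
/-- `τ` is an automorphism of the Lie group `G` preserving the tensor `s`. -/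
structure IsTensorAutomorphism (s : TwoTensor I G) (τ : G ≃* G) : Prop where
  contMDiff : ContMDiff I I ∞ τ
  contMDiff_symm : ContMDiff I I ∞ τ.symm
  preserves : pushTensor I I τ.toMonoidHom s = s

/-- The value at `g` of the right-invariant vector field `ξ^R` on `G`. The left-invariant one is
`mulInvariantVectorField`. -/
def rightInvariantVectorField (ξ : GroupLieAlgebra I G) (g : G) : TangentSpace I g :=
  (mfderiv I I (fun h : G => h * g) (1 : G) ξ : TangentSpace I (1 * g))

end LieGroups

/-! ### Bivector fields and quasi-Poisson manifolds -/

section QuasiPoisson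

variable {E : Type*} [NormedAddCommGroup E] [NormedSpace ℝ E] {X : Type*} [TopologicalSpace X]
  {I : ModelWithCorners ℝ E X} {M : Type*} [TopologicalSpace M] [ChartedSpace X M]
  {E' : Type*} [NormedAddCommGroup E'] [NormedSpace ℝ E'] {X' : Type*} [TopologicalSpace X']
  {I' : ModelWithCorners ℝ E' X'} {M' : Type*} [TopologicalSpace M'] [ChartedSpace X' M']
  {EG : Type*} [NormedAddCommGroup EG] [NormedSpace ℝ EG] {XG : Type*} [TopologicalSpace XG]
  {IG : ModelWithCorners ℝ EG XG} {G : Type*} [TopologicalSpace G] [ChartedSpace XG G] [Group G]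

variable (I) in
/-- The cotangent space of `M` at `x`. -/
abbrev CotangentSpace (x : M) : Type _ := TangentSpace I x →L[ℝ] ℝ

variable (I M) in
/-- A smooth bivector field on a (finite-dimensional, Hausdorff) manifold, as a family of
alternating bilinear forms on the cotangent spaces; the bivector `v ∧ w` is the form
`(α, β) ↦ α v * β w - α w * β v`. -/
structure BivectorField where
  toFun : ∀ x : M, CotangentSpace I x →ₗ[ℝ] CotangentSpace I x →ₗ[ℝ] ℝ
  alternating : ∀ (x : M) (α : CotangentSpace I x), toFun x α α = 0
  smooth : ∀ f g : M → ℝ, ContMDiff I 𝓘(ℝ, ℝ) ∞ f → ContMDiff I 𝓘(ℝ, ℝ) ∞ g →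
    ContMDiff I 𝓘(ℝ, ℝ) ∞ (fun x => toFun x (mvfderiv I f x) (mvfderiv I g x))

/-- The bracket `{f, g} = π (df, dg)`. -/
def BivectorField.bracket (π : BivectorField I M) (f g : M → ℝ) (x : M) : ℝ :=
  π.toFun x (mvfderiv I f x) (mvfderiv I g x)

/-- The Schouten bracket of two bivector fields, as a trivector field evaluated on `df, dg, dh`.
For `P = Q = π` it is twice `{f, {g, h}} + {g, {h, f}} + {h, {f, g}}`. -/
def schoutenBracket (P Q : BivectorField I M) (f g h : M → ℝ) (x : M) : ℝ :=
  (P.bracket f (Q.bracket g h) x + P.bracket g (Q.bracket h f) x + P.bracket h (Q.bracket f g) x) +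
    (Q.bracket f (P.bracket g h) x + Q.bracket g (P.bracket h f) x + Q.bracket h (P.bracket f g) x)

/-- `f_* π = π'`: the bivector fields `π` and `π'` are related by the map `f`. -/
def BivectorRelated (f : M → M') (π : BivectorField I M) (π' : BivectorField I' M') : Prop :=
  ∀ (x : M) (α β : CotangentSpace I' (f x)),
    π'.toFun (f x) α β =
      π.toFun x (α.comp (mfderiv I I' f x)) (β.comp (mfderiv I I' f x))

variable (I IG G) in
/-- The value at `x` of the infinitesimal action `ρ : 𝔤 → Γ(TM)`. It is the derivative at `t = 0`
of `exp (-t ξ) • x`; with this sign `ρ` is a morphism of Lie algebras. -/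
def infinitesimalAction [MulAction G M] (x : M) :
    GroupLieAlgebra IG G →L[ℝ] TangentSpace I x :=
  -(mfderiv IG I (fun g : G => g • x) (1 : G) :
    TangentSpace IG (1 : G) →L[ℝ] TangentSpace I ((1 : G) • x))

/-- `(M, ρ, π)` is a quasi-Poisson `G`-manifold, where `ρ` is the given action of `G`. -/
structure IsQuasiPoisson [MulAction G M] (s : TwoTensor IG G) (π : BivectorField I M) : Prop where
  smooth_action : ContMDiffSMul IG I ∞ G M
  invariant : ∀ g : G, BivectorRelated (fun x : M => g • x) π π
  schouten : ∀ f g h : M → ℝ, ContMDiff I 𝓘(ℝ, ℝ) ∞ f → ContMDiff I 𝓘(ℝ, ℝ) ∞ g →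
    ContMDiff I 𝓘(ℝ, ℝ) ∞ h → ∀ x : M,
      (1 / 2) * schoutenBracket π π f g h x =
        cartanTensor s ((mvfderiv I f x).comp (infinitesimalAction I IG G x))
          ((mvfderiv I g x).comp (infinitesimalAction I IG G x))
          ((mvfderiv I h x).comp (infinitesimalAction I IG G x))

/-- `μ : M → G` is a `τ`-twisted moment map. The last condition says that the image of `π` in
`TG ⊗ TM` is `-½ s^{ij} (e_i^L + τ(e_i)^R) ⊗ ρ(e_j)`, paired with `θ ⊗ η`. -/
structure IsTwistedMomentMap [MulAction G M] (s : TwoTensor IG G) (π : BivectorField I M)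
    (τ : G ≃* G) (μ : M → G) : Prop where
  contMDiff : ContMDiff I IG ∞ μ
  equivariant : ∀ (g : G) (x : M), μ (g • x) = τ g * μ x * g⁻¹
  bivector : ∀ (x : M) (θ : CotangentSpace IG (μ x)) (η : CotangentSpace I x),
    π.toFun x (θ.comp (mfderiv I IG μ x)) η =
      -(1 / 2) * θ (mulInvariantVectorField (s (η.comp (infinitesimalAction I IG G x))) (μ x) +
        rightInvariantVectorField IG
          (lieMap IG IG τ.toMonoidHom (s (η.comp (infinitesimalAction I IG G x)))) (μ x))

end QuasiPoisson

/-! ### Submanifolds and clean intersections -/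

section Submanifolds

variable {E : Type*} [NormedAddCommGroup E] [NormedSpace ℝ E] {X : Type*} [TopologicalSpace X]
  (I : ModelWithCorners ℝ E X)
  {E' : Type*} [NormedAddCommGroup E'] [NormedSpace ℝ E'] {X' : Type*} [TopologicalSpace X']
  (I' : ModelWithCorners ℝ E' X')

/-- An injective immersion `j : A → M` is a weak embedding if every smooth map to `M` with values
in the image of `j` is smooth as a map to `A`. It suffices to ask this for maps defined on open
subsets of `ℝⁿ`. Embeddings and orbits of Lie group actions are weak embeddings, and the image
of `j` determines the manifold `A`. -/
structure IsWeakEmbedding {A : Type*} [TopologicalSpace A] [ChartedSpace X' A]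
    {M : Type*} [TopologicalSpace M] [ChartedSpace X M] (j : A → M) : Prop where
  injective : Function.Injective j
  immersion : Manifold.IsImmersion I' I ∞ j
  lift : ∀ (n : ℕ) (U : Set (EuclideanSpace ℝ (Fin n))) (f : EuclideanSpace ℝ (Fin n) → A),
    IsOpen U → ContMDiffOn (𝓡 n) I ∞ (j ∘ f) U → ContMDiffOn (𝓡 n) I' ∞ f U

variable {M : Type uM} [TopologicalSpace M] [ChartedSpace X M]

/-- `S` is a submanifold of `M`: the image of a weak embedding. This includes embedded
submanifolds as well as the orbits of Lie group actions. -/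
def IsSubmanifold (S : Set M) : Prop :=
  ∃ (k : ℕ) (A : Type uM) (_ : TopologicalSpace A)
    (_ : ChartedSpace (EuclideanSpace ℝ (Fin k)) A) (j : A → M),
    IsManifold (𝓡 k) ∞ A ∧ T2Space A ∧ SecondCountableTopology A ∧
      IsWeakEmbedding I (𝓡 k) j ∧ range j = S

/-- `S` is an embedded submanifold of `M`. -/
def IsEmbeddedSubmanifold (S : Set M) : Prop :=
  ∃ (k : ℕ) (A : Type uM) (_ : TopologicalSpace A)
    (_ : ChartedSpace (EuclideanSpace ℝ (Fin k)) A) (j : A → M),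
    IsManifold (𝓡 k) ∞ A ∧ Manifold.IsSmoothEmbedding (𝓡 k) I ∞ j ∧ range j = S

/-- The tangent space at `x` of a submanifold `S`: the velocities of smooth curves in `S`. -/
def tangentSet (S : Set M) (x : M) : Set (TangentSpace I x) :=
  {v | ∃ γ : ℝ → M, ContMDiff 𝓘(ℝ, ℝ) I ∞ γ ∧ γ 0 = x ∧ (∀ t, γ t ∈ S) ∧
    (mfderiv 𝓘(ℝ, ℝ) I γ 0 (1 : ℝ) : TangentSpace I (γ 0)) = v}

/-- The submanifolds `S` and `T` of `M` intersect cleanly. -/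
structure IntersectCleanly (S T : Set M) : Prop where
  isSubmanifold : IsSubmanifold I (S ∩ T)
  tangent : ∀ x ∈ S ∩ T, tangentSet I (S ∩ T) x = tangentSet I S x ∩ tangentSet I T x

end Submanifolds

/-! ### The reduced space -/

section Reduction

variable {C G : Type*} [Group C] [Group G] (ι : C →* G) (H : Type*) [Group H]
  (M : Type*) [MulAction (G × H) M]

/-- The orbit space `M / C` of a `G × H`-space by a subgroup `ι : C → G`, where `C` acts
through `C → G → G × H`. -/
def ReducedSpace : Type _ :=
  MulAction.orbitRel.Quotient ((MonoidHom.inl G H).comp ι).range M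

/-- The projection `M → M / C`. -/
def ReducedSpace.mk {M : Type*} [MulAction (G × H) M] (x : M) : ReducedSpace ι H M :=
  Quotient.mk (MulAction.orbitRel ((MonoidHom.inl G H).comp ι).range M) x

/-- The orbit space carries the quotient topology. -/
instance [TopologicalSpace M] : TopologicalSpace (ReducedSpace ι H M) :=
  TopologicalSpace.coinduced (ReducedSpace.mk ι H) inferInstance

/-- The action of `H` on `M / C` induced by the action of `G × H` on `M`. -/
instance : MulAction H (ReducedSpace ι H M) where
  smul h := Quotient.map (fun x : M => ((1 : G), h) • x) (by
    rintro _ y ⟨⟨_, c, rfl⟩, rfl⟩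
    refine ⟨⟨_, c, rfl⟩, ?_⟩
    change (ι c, (1 : H)) • ((1 : G), h) • y = ((1 : G), h) • (ι c, (1 : H)) • y
    rw [smul_smul, smul_smul, Prod.mk_mul_mk, Prod.mk_mul_mk]
    simp only [mul_one, one_mul])
  one_smul := by
    rintro ⟨x⟩
    exact congrArg (ReducedSpace.mk ι H) (one_smul (G × H) x)
  mul_smul h h' := by
    rintro ⟨x⟩
    refine congrArg (ReducedSpace.mk ι H) ?_
    change ((1 : G), h * h') • x = ((1 : G), h) • ((1 : G), h') • x
    rw [smul_smul, Prod.mk_mul_mk, one_mul]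

end Reduction

end

/-! Write q for the projection M → M/C. A covector on M/C pulled back along q kills the directions
of the C-orbits, so contracting it with ρ gives a functional whose 𝔤-part lies in ann 𝔠. Invariance
of π makes π(q*α, q*β) constant along the fibres of q, hence π descends; smoothness is seen through
local sections of q. On functions pulled back from M/C the trivector ρ(φ) splits into a 𝔤-part and
an 𝔥-part, because brackets in 𝔤 ⊕ 𝔥 are componentwise (`cartanTensor_sumTensor`). The 𝔤-part is φ
evaluated on ann 𝔠 and vanishes since C is reducing; the 𝔥-part is the one that M/C must have. This
is `IsQuasiPoisson.exists_reduction`.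

Now let S be the preimage of K under μ_G. By clean intersection, S is a submanifold, and every v
with dμ_G(v) ∈ TK is tangent to it (`IntersectCleanly.exists_weakEmbedding`). Since Ĉ contains the
diagonal of C, S is a union of fibres of q. Local sections of q therefore lift to S and give
retractions of constant rank there; straightening these yields charts of S/C
(`exists_quotient_manifold`, `Manifold.IsSubmersion.exists_manifold_image`).

The heart of the matter is that the reduced bivector is tangent to S/C
(`IsTwistedMomentMap.bivector_eq_zero`). If α kills T(S/C), then q*α kills every v with dμ_G(v) ∈
TK, so q*α = μ_G*θ for some θ ∈ ann(TK). The moment map condition gives π(μ_G*θ, q*β) = -½ θ(v^L +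
τ_G(v)^R) with v = s♯γ, where γ ∈ ann 𝔠 is the 𝔤-part of q*β contracted with ρ. But v^L + τ_G(v)^R
is the velocity of (s♯γ, -s♯γ) ∈ ĉ acting on G, which is tangent to the Ĉ-stable K, so θ kills it.

A bivector that is tangent to a submanifold restricts to it, and the quasi-Poisson identity
restricts too, because functions on the submanifold extend locally. Finally μ_H is C-invariant, so
it descends, and its moment map condition passes first to M/C and then to S/C. -/

noncomputable section

/-! ### Inverse function theorem; normal forms of immersions and submersions -/

open Topology Filter in
/-- The inverse function theorem: a smooth map with invertible derivative at a point restricts to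
a diffeomorphism of open sets. -/
theorem exists_openPartialHomeomorph_of_fderiv_bijective
    {E : Type*} [NormedAddCommGroup E] [NormedSpace ℝ E] [FiniteDimensional ℝ E]
    {F : Type*} [NormedAddCommGroup F] [NormedSpace ℝ F]
    {f : E → F} {U : Set E} (hU : IsOpen U) (hf : ContDiffOn ℝ ∞ f U) {x : E} (hx : x ∈ U)
    (L : E ≃L[ℝ] F) (hL : fderiv ℝ f x = L) :
    ∃ e : OpenPartialHomeomorph E F, x ∈ e.source ∧ e.source ⊆ U ∧ (e : E → F) = f ∧
      ContDiffOn ℝ ∞ e.symm e.target := by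
  have : CompleteSpace E := FiniteDimensional.complete ℝ E
  have hfx : ContDiffAt ℝ ∞ f x := hf.contDiffAt (hU.mem_nhds hx)
  have hd : HasFDerivAt f (L : E →L[ℝ] F) x := hL ▸ (hfx.differentiableAt (by simp)).hasFDerivAt
  have h0 : (∞ : WithTop ℕ∞) ≠ 0 := by simp
  set e₀ := hfx.toOpenPartialHomeomorph f hd h0
  have hcont : ContinuousOn (fderiv ℝ f) U := hf.continuousOn_fderiv_of_isOpen hU (by simp)
  -- The local inverse is known to be smooth only where the derivative is invertible. Those points
  -- form an open set, since invertible maps are open among all linear maps.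
  obtain ⟨V, hV, hVU⟩ : ∃ V, IsOpen V ∧ V = U ∩ fderiv ℝ f ⁻¹'
      range ((↑) : (E ≃L[ℝ] F) → E →L[ℝ] F) :=
    ⟨_, hcont.isOpen_inter_preimage hU ContinuousLinearEquiv.isOpen, rfl⟩
  have hxV : x ∈ V := hVU ▸ ⟨hx, L, hL.symm⟩
  refine ⟨e₀.restr V, ?_, ?_, rfl, ?_⟩
  · rw [e₀.restr_source' V hV]
    exact ⟨hfx.mem_toOpenPartialHomeomorph_source hd h0, hxV⟩
  · rw [e₀.restr_source' V hV, hVU]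
    exact fun y hy => hy.2.1
  · intro y hy
    have hy' := (e₀.restr V).map_target hy
    rw [e₀.restr_source' V hV, hVU] at hy'
    obtain ⟨-, hyU, L', hL'⟩ := hy'
    refine ContDiffAt.contDiffWithinAt ?_
    have hfy : ContDiffAt ℝ ∞ f ((e₀.restr V).symm y) := hf.contDiffAt (hU.mem_nhds hyU)
    exact (e₀.restr V).contDiffAt_symm (f₀' := L') hy
      (hL' ▸ (hfy.differentiableAt (by simp)).hasFDerivAt) hfy

section Generic

variable {E : Type*} [NormedAddCommGroup E] [NormedSpace ℝ E] {X : Type*} [TopologicalSpace X]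
  {I : ModelWithCorners ℝ E X} {M : Type*} [TopologicalSpace M] [ChartedSpace X M]
  {E' : Type*} [NormedAddCommGroup E'] [NormedSpace ℝ E'] {X' : Type*} [TopologicalSpace X']
  {I' : ModelWithCorners ℝ E' X'} {N : Type*} [TopologicalSpace N] [ChartedSpace X' N]

open Topology Filter in
/-- An immersion has a smooth local left inverse. -/
theorem Manifold.IsImmersionAt.exists_leftInverse [I.Boundaryless] {f : M → N} {x : M}
    (h : Manifold.IsImmersionAt I I' ∞ f x) :
    ∃ (g : N → M) (U : Set N), IsOpen U ∧ f x ∈ U ∧ ContMDiffOn I' I ∞ g U ∧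
      ∀ᶠ y in 𝓝 x, g (f y) = y := by
  set φ := h.domChart
  set ψ := h.codChart
  have hφ := h.domChart_mem_maximalAtlas
  have hψ := h.codChart_mem_maximalAtlas
  let k : N → E := fun z => (h.equiv.symm (ψ.extend I' z)).1
  have hk : ContMDiffOn I' 𝓘(ℝ, E) ∞ k ψ.source :=
    (contMDiff_iff_contDiff.2 (contDiff_fst.comp h.equiv.symm.contDiff)).comp_contMDiffOn
      (OpenPartialHomeomorph.contMDiffOn_extend hψ)
  have hkf : ∀ y ∈ φ.source, k (f y) = φ.extend I y := by
    intro y hy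
    have hy' : φ.extend I y ∈ (φ.extend I).target :=
      (φ.extend I).map_source (by rwa [φ.extend_source])
    have := h.writtenInCharts hy'
    simp only [Function.comp_apply] at this
    rw [(φ.extend I).left_inv (by rwa [φ.extend_source])] at this
    change (h.equiv.symm (ψ.extend I' (f y))).1 = _
    rw [this]
    simp
  refine ⟨fun z => (φ.extend I).symm (k z), ψ.source ∩ k ⁻¹' (φ.extend I).target,
    hk.continuousOn.isOpen_inter_preimage ψ.open_source φ.isOpen_extend_target,
    ⟨h.mem_codChart_source, ?_⟩, ?_, ?_⟩
  · rw [mem_preimage, hkf x h.mem_domChart_source]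
    exact (φ.extend I).map_source (by rw [φ.extend_source]; exact h.mem_domChart_source)
  · refine ContMDiffOn.comp (t := (φ.extend I).target) ?_ (hk.mono inter_subset_left)
      fun z hz => hz.2
    have := contMDiffOn_extend_symm hφ
    rwa [← OpenPartialHomeomorph.extend_target'] at this
  · filter_upwards [φ.open_source.mem_nhds h.mem_domChart_source] with y hy
    rw [hkf y hy, (φ.extend I).left_inv (by rwa [φ.extend_source])]

open Topology Filter in
/-- A submersion has smooth local sections through every point. -/
theorem Manifold.IsSubmersionAt.exists_section [I.Boundaryless] {f : M → N} {x : M}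
    (h : Manifold.IsSubmersionAt I I' ∞ f x) :
    ∃ (g : N → M) (U : Set N), IsOpen U ∧ f x ∈ U ∧ ContMDiffOn I' I ∞ g U ∧ g (f x) = x ∧
      ∀ y ∈ U, f (g y) = y := by
  set φ := h.domChart
  set ψ := h.codChart
  have hφ := h.domChart_mem_maximalAtlas
  have hψ := h.codChart_mem_maximalAtlas
  have hxs : x ∈ (φ.extend I).source := by rw [φ.extend_source]; exact h.mem_domChart_source
  -- In the two charts f is the first component of `h.equiv`. Freezing the second component at its
  -- value at x gives a section, and one that passes through x.
  let k : N → E := fun z => h.equiv.symm (ψ.extend I' z, (h.equiv (φ.extend I x)).2)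
  have hk : ContMDiffOn I' 𝓘(ℝ, E) ∞ k ψ.source :=
    (contMDiff_iff_contDiff.2 (h.equiv.symm.contDiff.comp
      (contDiff_id.prodMk contDiff_const))).comp_contMDiffOn
      (OpenPartialHomeomorph.contMDiffOn_extend hψ)
  have hkx : k (f x) = φ.extend I x := by
    have := h.writtenInCharts ((φ.extend I).map_source hxs)
    simp only [Function.comp_apply] at this
    rw [(φ.extend I).left_inv hxs] at this
    change h.equiv.symm (ψ.extend I' (f x), _) = _
    rw [this]
    simp
  refine ⟨fun z => (φ.extend I).symm (k z), ψ.source ∩ k ⁻¹' (φ.extend I).target,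
    hk.continuousOn.isOpen_inter_preimage ψ.open_source φ.isOpen_extend_target,
    ⟨h.mem_codChart_source, ?_⟩, ?_, ?_, ?_⟩
  · rw [mem_preimage, hkx]
    exact (φ.extend I).map_source hxs
  · refine ContMDiffOn.comp (t := (φ.extend I).target) ?_ (hk.mono inter_subset_left)
      fun z hz => hz.2
    have := contMDiffOn_extend_symm hφ
    rwa [← OpenPartialHomeomorph.extend_target'] at this
  · change (φ.extend I).symm (k (f x)) = x
    rw [hkx, (φ.extend I).left_inv hxs]
  · rintro z ⟨hz, hz'⟩
    have h1 := h.writtenInCharts hz'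
    simp only [Function.comp_apply] at h1
    have h2 : (φ.extend I).symm (k z) ∈ φ.source := by
      have := (φ.extend I).map_target hz'
      rwa [φ.extend_source] at this
    have h3 : f ((φ.extend I).symm (k z)) ∈ ψ.source := h.source_subset_preimage_source h2
    refine (ψ.extend I').injOn (by rwa [ψ.extend_source]) (by rwa [ψ.extend_source]) ?_
    rw [h1]
    simp [k]

/-- Differentiating the smooth local left inverse gives a left inverse of the derivative. -/
theorem Manifold.IsImmersionAt.mfderiv_injective [I.Boundaryless] {f : M → N} {x : M}
    (h : Manifold.IsImmersionAt I I' ∞ f x) : Function.Injective (mfderiv I I' f x) := by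
  obtain ⟨g, U, hU, hx, hg, hgf⟩ := h.exists_leftInverse
  have hg' : MDifferentiableAt I' I g (f x) :=
    (hg.contMDiffAt (hU.mem_nhds hx)).mdifferentiableAt (by simp)
  have hf' : MDifferentiableAt I I' f x := h.contMDiffAt.mdifferentiableAt (by simp)
  have h1 := mfderiv_comp x hg' hf'
  have h2 : mfderiv I I (g ∘ f) x = mfderiv I I (id : M → M) x :=
    Filter.EventuallyEq.mfderiv_eq hgf
  intro v w hvw
  have h3 : ∀ u, (mfderiv I I (g ∘ f) x) u = (u : TangentSpace I x) := by
    intro u; rw [h2, mfderiv_id]; rfl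
  have h4 : ∀ u, (mfderiv I' I g (f x)) (mfderiv I I' f x u) = (u : E) := by
    intro u
    have := h3 u
    rw [h1] at this
    exact this
  rw [← h4 v, hvw, h4 w]

theorem Manifold.IsSubmersionAt.mfderiv_surjective [I.Boundaryless] {f : M → N} {x : M}
    (h : Manifold.IsSubmersionAt I I' ∞ f x) : Function.Surjective (mfderiv I I' f x) := by
  obtain ⟨g, U, hU, hx, hg, hgx, hgf⟩ := h.exists_section
  have hg' : MDifferentiableAt I' I g (f x) :=
    (hg.contMDiffAt (hU.mem_nhds hx)).mdifferentiableAt (by simp)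
  have hf' : MDifferentiableAt I I' f (g (f x)) := by
    rw [hgx]; exact h.contMDiffAt.mdifferentiableAt (by simp)
  have h1 := mfderiv_comp (f x) hf' hg'
  have h2 : mfderiv I' I' (f ∘ g) (f x) = mfderiv I' I' (id : N → N) (f x) :=
    Filter.EventuallyEq.mfderiv_eq (Filter.eventually_of_mem (hU.mem_nhds hx) hgf)
  intro u
  rw [h2, mfderiv_id] at h1
  rw [hgx] at h1
  exact ⟨mfderiv I' I g (f x) u, (DFunLike.congr_fun h1 u).symm⟩

end Generic

/-! ### Curves in charts, lifting through weak embeddings, local extension of functions -/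

section Generic2

variable {E : Type*} [NormedAddCommGroup E] [NormedSpace ℝ E] {X : Type*} [TopologicalSpace X]
  {I : ModelWithCorners ℝ E X} {M : Type*} [TopologicalSpace M] [ChartedSpace X M]
  {E' : Type*} [NormedAddCommGroup E'] [NormedSpace ℝ E'] {X' : Type*} [TopologicalSpace X']
  {I' : ModelWithCorners ℝ E' X'} {N : Type*} [TopologicalSpace N] [ChartedSpace X' N]

open Topology Filter in
/-- Every tangent vector is the velocity of a smooth curve that is a line segment in a given
chart. -/
theorem exists_contMDiff_curve_in_chart [I.Boundaryless] {φ : OpenPartialHomeomorph M X}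
    (hφ : φ ∈ IsManifold.maximalAtlas I ∞ M) {x : M} (hx : x ∈ φ.source) (v : TangentSpace I x) :
    ∃ γ : ℝ → M, ContMDiff 𝓘(ℝ, ℝ) I ∞ γ ∧ γ 0 = x ∧
      (mfderiv 𝓘(ℝ, ℝ) I γ 0 (1 : ℝ) : TangentSpace I (γ 0)) = v ∧
      ∀ t, γ t ∈ φ.source ∧ ∃ c : ℝ, φ.extend I (γ t) =
        φ.extend I x + c • mvfderiv I (φ.extend I) x v := by
  have hxs : x ∈ (φ.extend I).source := by rwa [φ.extend_source]
  set w : E := mvfderiv I (φ.extend I) x v with hw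
  obtain ⟨ε, hε, hεt⟩ : ∃ ε > 0, ∀ c : ℝ, |c| ≤ ε → φ.extend I x + c • w ∈ (φ.extend I).target := by
    have hc : Continuous fun c : ℝ => φ.extend I x + c • w := by fun_prop
    have h0 : (fun c : ℝ => φ.extend I x + c • w) ⁻¹' (φ.extend I).target ∈ 𝓝 (0 : ℝ) := by
      refine hc.continuousAt.preimage_mem_nhds ?_
      simp only [zero_smul, add_zero]
      exact φ.isOpen_extend_target.mem_nhds ((φ.extend I).map_source hxs)
    obtain ⟨δ, hδ, hb⟩ := Metric.nhds_basis_closedBall.mem_iff.1 h0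
    exact ⟨δ, hδ, fun c hc => hb (by simpa using hc)⟩
  -- A reparametrisation with β(0) = 0, β'(0) = 1 and |β| ≤ ε: the curve is defined on all of ℝ and
  -- never leaves the chart.
  let β : ℝ → ℝ := fun t => ε * Real.sin (t / ε)
  have hβ : ContDiff ℝ ∞ β := by
    exact contDiff_const.mul (Real.contDiff_sin.comp (contDiff_id.div_const ε))
  have hβ0 : β 0 = 0 := by simp [β]
  have hβ1 : HasDerivAt β 1 0 := by
    have h1 : HasDerivAt (fun t : ℝ => Real.sin (t / ε)) (Real.cos (0 / ε) * (1 / ε)) 0 :=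
      ((hasDerivAt_id (0 : ℝ)).div_const ε).sin
    have := h1.const_mul ε
    simpa [hε.ne'] using this
  have hβt : ∀ t, φ.extend I x + β t • w ∈ (φ.extend I).target := by
    intro t
    apply hεt
    simp only [β, abs_mul, abs_of_pos hε]
    exact mul_le_of_le_one_right hε.le (Real.abs_sin_le_one _)
  let ℓ : ℝ → E := fun t => φ.extend I x + β t • w
  let γ : ℝ → M := fun t => (φ.extend I).symm (ℓ t)
  have hℓ : ContMDiff 𝓘(ℝ, ℝ) 𝓘(ℝ, E) ∞ ℓ :=
    contMDiff_iff_contDiff.2 (contDiff_const.add (hβ.smul contDiff_const))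
  have hγ : ContMDiff 𝓘(ℝ, ℝ) I ∞ γ := by
    have := contMDiffOn_extend_symm hφ
    rw [← OpenPartialHomeomorph.extend_target'] at this
    exact this.comp_contMDiff hℓ hβt
  have hγ0 : γ 0 = x := by
    simp only [γ, ℓ, hβ0, zero_smul, add_zero]
    exact (φ.extend I).left_inv hxs
  have hφγ : ∀ t, φ.extend I (γ t) = ℓ t := fun t => (φ.extend I).right_inv (hβt t)
  refine ⟨γ, hγ, hγ0, ?_, fun t => ⟨?_, β t, hφγ t⟩⟩
  · have hφd : MDifferentiableAt I 𝓘(ℝ, E) (φ.extend I) x :=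
      (((OpenPartialHomeomorph.contMDiffOn_extend hφ).contMDiffAt
        (φ.open_source.mem_nhds hx))).mdifferentiableAt (by simp)
    have hsd : MDifferentiableAt 𝓘(ℝ, E) I (φ.extend I).symm (φ.extend I x) := by
      have := contMDiffOn_extend_symm hφ
      rw [← OpenPartialHomeomorph.extend_target'] at this
      exact (this.contMDiffAt (φ.isOpen_extend_target.mem_nhds
        ((φ.extend I).map_source hxs))).mdifferentiableAt (by simp)
    have hinv : ∀ u : TangentSpace I x,
        mfderiv 𝓘(ℝ, E) I (φ.extend I).symm (φ.extend I x)
          (mfderiv I 𝓘(ℝ, E) (φ.extend I) x u) = (u : E) := by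
      intro u
      rw [← mfderiv_comp_apply x hsd hφd]
      have : (φ.extend I).symm ∘ φ.extend I =ᶠ[𝓝 x] id := by
        filter_upwards [φ.open_source.mem_nhds hx] with y hy
        exact (φ.extend I).left_inv (by rwa [φ.extend_source])
      rw [this.mfderiv_eq, mfderiv_id]
      rfl
    have h1 := mfderiv_comp_apply_of_eq (I := 𝓘(ℝ, ℝ)) (I' := 𝓘(ℝ, E)) (I'' := I)
      (f := ℓ) (g := (φ.extend I).symm) (x := 0) (y := φ.extend I x) hsd
      (hℓ.mdifferentiableAt (by simp)) (by simp [ℓ, hβ0]) (1 : ℝ)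
    have h2 : (mfderiv 𝓘(ℝ, ℝ) 𝓘(ℝ, E) ℓ 0 (1 : ℝ) : E) = w := by
      have : HasDerivAt ℓ w 0 := by
        exact (one_smul ℝ w) ▸ (hβ1.smul_const w).const_add (φ.extend I x)
      rw [mfderiv_eq_fderiv]
      exact this.deriv
    refine h1.trans ?_
    rw [← hinv v]
    exact congrArg (mfderiv 𝓘(ℝ, E) I (φ.extend I).symm (φ.extend I x)) h2
  · have := (φ.extend I).map_target (hβt t)
    rwa [φ.extend_source] at this

theorem exists_contMDiff_curve [IsManifold I ∞ M] [I.Boundaryless] (x : M)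
    (v : TangentSpace I x) :
    ∃ γ : ℝ → M, ContMDiff 𝓘(ℝ, ℝ) I ∞ γ ∧ γ 0 = x ∧
      (mfderiv 𝓘(ℝ, ℝ) I γ 0 (1 : ℝ) : TangentSpace I (γ 0)) = v := by
  obtain ⟨γ, h1, h2, h3, -⟩ := exists_contMDiff_curve_in_chart
    (IsManifold.chart_mem_maximalAtlas (I := I) x) (mem_chart_source X x) v
  exact ⟨γ, h1, h2, h3⟩

open Topology Filter in
/-- A vector in the kernel of the derivative of a submersion is tangent to the fibre. -/
theorem Manifold.IsSubmersionAt.mem_tangentSet_fiber [I.Boundaryless] {f : M → N} {x : M}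
    (h : Manifold.IsSubmersionAt I I' ∞ f x) {v : TangentSpace I x}
    (hv : mfderiv I I' f x v = 0) : v ∈ tangentSet I {y | f y = f x} x := by
  obtain ⟨γ, hγ, hγ0, hγ1, hγt⟩ := exists_contMDiff_curve_in_chart h.domChart_mem_maximalAtlas
    h.mem_domChart_source v
  set φ := h.domChart
  set ψ := h.codChart
  refine ⟨γ, hγ, hγ0, fun t => ?_, hγ1⟩
  obtain ⟨hs, c, hc⟩ := hγt t
  have key : ∀ y ∈ φ.source, ψ.extend I' (f y) = (h.equiv (φ.extend I y)).1 := by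
    intro y hy
    have hy' : y ∈ (φ.extend I).source := by rwa [φ.extend_source]
    have := h.writtenInCharts ((φ.extend I).map_source hy')
    simp only [Function.comp_apply] at this
    rwa [(φ.extend I).left_inv hy'] at this
  have hψd : MDifferentiableAt I' 𝓘(ℝ, E') (ψ.extend I') (f x) :=
    ((OpenPartialHomeomorph.contMDiffOn_extend h.codChart_mem_maximalAtlas).contMDiffAt
      (ψ.open_source.mem_nhds h.mem_codChart_source)).mdifferentiableAt (by simp)
  have hφd : MDifferentiableAt I 𝓘(ℝ, E) (φ.extend I) x :=
    ((OpenPartialHomeomorph.contMDiffOn_extend h.domChart_mem_maximalAtlas).contMDiffAt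
      (φ.open_source.mem_nhds h.mem_domChart_source)).mdifferentiableAt (by simp)
  have hfd : MDifferentiableAt I I' f x := h.contMDiffAt.mdifferentiableAt (by simp)
  -- In these charts f is the linear map P. The coordinate vector of v lies in ker P, so f is
  -- constant along the segment on which γ runs.
  let P : E →L[ℝ] E' := (ContinuousLinearMap.fst ℝ E' h.complement).comp
    (h.equiv : E →L[ℝ] E' × h.complement)
  have hP : (ψ.extend I') ∘ f =ᶠ[𝓝 x] P ∘ (φ.extend I) := by
    filter_upwards [φ.open_source.mem_nhds h.mem_domChart_source] with y hy
    exact key y hy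
  have h1 := hP.mfderiv_eq (I := I) (I' := 𝓘(ℝ, E'))
  have h2 : (mfderiv I 𝓘(ℝ, E') (ψ.extend I' ∘ f) x v : E') = 0 := by
    rw [mfderiv_comp_apply x hψd hfd, hv]
    exact map_zero (mfderiv I' 𝓘(ℝ, E') (ψ.extend I') (f x))
  have h3 : P (mvfderiv I (φ.extend I) x v) = 0 := by
    have hPd : MDifferentiableAt 𝓘(ℝ, E) 𝓘(ℝ, E') P (φ.extend I x) :=
      P.differentiableAt.mdifferentiableAt
    have := mfderiv_comp_apply x hPd hφd v
    rw [mfderiv_eq_fderiv, P.fderiv] at this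
    rw [← h1] at this
    exact this.symm.trans h2
  refine (ψ.extend I').injOn ?_ ?_ ?_
  · rw [ψ.extend_source]; exact h.source_subset_preimage_source hs
  · rw [ψ.extend_source]; exact h.mem_codChart_source
  · rw [key _ hs, key _ h.mem_domChart_source, hc]
    change P (φ.extend I x + c • _) = P (φ.extend I x)
    rw [map_add, map_smul, h3, smul_zero, add_zero]

open Topology Filter in
/-- The lifting property of weak embeddings for maps defined on open subsets of `ℝⁿ` implies the
one for maps defined on open subsets of manifolds. -/
theorem contMDiffOn_lift_of_euclidean {A : Type*} [TopologicalSpace A] [ChartedSpace X' A]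
    {j : A → M}
    (lift : ∀ (n : ℕ) (U : Set (EuclideanSpace ℝ (Fin n))) (f : EuclideanSpace ℝ (Fin n) → A),
      IsOpen U → ContMDiffOn (𝓡 n) I ∞ (j ∘ f) U → ContMDiffOn (𝓡 n) I' ∞ f U)
    {F : Type*} [NormedAddCommGroup F] [NormedSpace ℝ F] [FiniteDimensional ℝ F]
    {Y : Type*} [TopologicalSpace Y] {J : ModelWithCorners ℝ F Y} [J.Boundaryless]
    {Q : Type*} [TopologicalSpace Q] [ChartedSpace Y Q] [IsManifold J ∞ Q]
    {U : Set Q} (hU : IsOpen U) {f : Q → A} (hf : ContMDiffOn J I ∞ (j ∘ f) U) :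
    ContMDiffOn J I' ∞ f U := by
  intro x hx
  let L : F ≃L[ℝ] EuclideanSpace ℝ (Fin (Module.finrank ℝ F)) := toEuclidean
  set c := extChartAt J x
  -- κ is an inverse chart read on the standard Euclidean space. The hypothesis applies to f ∘ κ,
  -- and near x the map f is f ∘ κ composed with the chart.
  let κ : EuclideanSpace ℝ (Fin (Module.finrank ℝ F)) → Q := fun y => c.symm (L.symm y)
  have hc : ContMDiffOn 𝓘(ℝ, F) J ∞ c.symm c.target := contMDiffOn_extChartAt_symm x
  have hκ : ContMDiffOn 𝓘(ℝ, EuclideanSpace ℝ (Fin (Module.finrank ℝ F))) J ∞ κ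
      (L.symm ⁻¹' c.target) :=
    hc.comp (contMDiff_iff_contDiff.2 L.symm.contDiff).contMDiffOn fun y hy => hy
  have hV : IsOpen (L.symm ⁻¹' c.target ∩ κ ⁻¹' U) :=
    hκ.continuousOn.isOpen_inter_preimage
      ((isOpen_extChartAt_target x).preimage L.symm.continuous) hU
  have h1 := lift _ _ (f ∘ κ) hV (hf.comp (hκ.mono inter_subset_left) fun y hy => hy.2)
  have hxV : L (c x) ∈ L.symm ⁻¹' c.target ∩ κ ⁻¹' U := by
    refine ⟨?_, ?_⟩
    · change L.symm (L (c x)) ∈ c.target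
      rw [L.symm_apply_apply]
      exact mem_extChartAt_target (I := J) x
    · simp only [κ, mem_preimage, L.symm_apply_apply, c, extChartAt_to_inv]
      exact hx
  have h2 : ContMDiffAt J I' ∞ ((f ∘ κ) ∘ (fun y => L (c y))) x := by
    refine ContMDiffAt.comp x (h1.contMDiffAt (hV.mem_nhds hxV)) ?_
    exact ContMDiffAt.comp x (contMDiff_iff_contDiff.2 L.contDiff).contMDiffAt contMDiffAt_extChartAt
  refine (h2.congr_of_eventuallyEq ?_).contMDiffWithinAt
  filter_upwards [extChartAt_source_mem_nhds (I := J) x] with y hy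
  simp only [Function.comp_apply, κ, L.symm_apply_apply]
  rw [c.left_inv hy]

open Topology Filter in
/-- A locally defined smooth function agrees near a point with a globally defined one. -/
theorem exists_contMDiff_eventuallyEq [FiniteDimensional ℝ E] [IsManifold I ∞ M] [T2Space M]
    {f : M → ℝ} {U : Set M} (hU : IsOpen U) {x : M} (hx : x ∈ U)
    (hf : ContMDiffOn I 𝓘(ℝ, ℝ) ∞ f U) :
    ∃ F : M → ℝ, ContMDiff I 𝓘(ℝ, ℝ) ∞ F ∧ F =ᶠ[𝓝 x] f := by
  obtain ⟨b, -, hb⟩ := (SmoothBumpFunction.nhds_basis_tsupport (I := I) x).mem_iff.1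
    (hU.mem_nhds hx)
  refine ⟨fun y => b y • f y, contMDiff_of_tsupport fun y hy => ?_, ?_⟩
  · have hyU : y ∈ U := hb (tsupport_smul_subset_left _ _ hy)
    exact b.contMDiffAt.smul (hf.contMDiffAt (hU.mem_nhds hyU))
  · filter_upwards [b.eventuallyEq_one] with y hy
    rw [hy]; simp

end Generic2

open Topology Filter in
/-- A smooth map between finite-dimensional manifolds with injective derivatives is an
immersion. -/
theorem Manifold.isImmersion_of_mfderiv_injective
    {E : Type*} [NormedAddCommGroup E] [NormedSpace ℝ E] [FiniteDimensional ℝ E]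
    {E' : Type*} [NormedAddCommGroup E'] [NormedSpace ℝ E'] [FiniteDimensional ℝ E']
    {M : Type*} [TopologicalSpace M] [ChartedSpace E M] [IsManifold 𝓘(ℝ, E) ∞ M]
    {N : Type*} [TopologicalSpace N] [ChartedSpace E' N] [IsManifold 𝓘(ℝ, E') ∞ N]
    {f : M → N} (hf : ContMDiff 𝓘(ℝ, E) 𝓘(ℝ, E') ∞ f)
    (hinj : ∀ x, Function.Injective (mfderiv 𝓘(ℝ, E) 𝓘(ℝ, E') f x)) :
    Manifold.IsImmersion 𝓘(ℝ, E) 𝓘(ℝ, E') ∞ f := by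
  -- `IsImmersion` asks for one complement that serves at all points, so only the dimension of W is
  -- prescribed here; at each point W is then identified with a complement of the image of the
  -- derivative.
  obtain ⟨W, hW⟩ : ∃ W : Submodule ℝ E',
      Module.finrank ℝ W = Module.finrank ℝ E' - Module.finrank ℝ E := by
    let b := Module.finBasis ℝ E'
    refine ⟨Submodule.span ℝ (range (b ∘ Fin.castLE (Nat.sub_le _ (Module.finrank ℝ E)))), ?_⟩
    rw [finrank_span_eq_card (b.linearIndependent.comp _ (Fin.castLE_injective _)),
      Fintype.card_fin]
  refine ⟨W, inferInstance, inferInstance, fun x => ?_⟩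
  set φ := chartAt E x with hφdef
  set ψ := chartAt E' (f x) with hψdef
  have hφ : φ ∈ IsManifold.maximalAtlas 𝓘(ℝ, E) ∞ M := IsManifold.chart_mem_maximalAtlas x
  have hψ : ψ ∈ IsManifold.maximalAtlas 𝓘(ℝ, E') ∞ N := IsManifold.chart_mem_maximalAtlas (f x)
  let fh : E → E' := ψ ∘ f ∘ φ.symm
  have hxφ : x ∈ φ.source := mem_chart_source E x
  have hxψ : f x ∈ ψ.source := mem_chart_source E' (f x)
  let U : Set E := φ.target ∩ φ.symm ⁻¹' (f ⁻¹' ψ.source)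
  have hU : IsOpen U :=
    φ.symm.isOpen_inter_preimage (ψ.open_source.preimage hf.continuous)
  have hfh : ContDiffOn ℝ ∞ fh U := by
    rw [← contMDiffOn_iff_contDiffOn]
    refine (contMDiffOn_of_mem_maximalAtlas hψ).comp ?_ fun y hy => hy.2
    exact hf.comp_contMDiffOn ((contMDiffOn_symm_of_mem_maximalAtlas hφ).mono inter_subset_left)
  have hxU : φ x ∈ U := ⟨φ.map_source hxφ, by simpa [φ.left_inv hxφ] using hxψ⟩
  have hL : Function.Injective (fderiv ℝ fh (φ x)) := by
    have h1 := (hf.mdifferentiableAt (x := x) (by simp)).mfderiv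
    have h2 : (mfderiv 𝓘(ℝ, E) 𝓘(ℝ, E') f x : E →L[ℝ] E') = fderiv ℝ fh (φ x) := by
      rw [h1]
      simp only [writtenInExtChartAt, mfld_simps, fderivWithin_univ]
      rfl
    have h3 := hinj x
    intro u w huw
    apply h3
    have h4 : ∀ u : E, (mfderiv 𝓘(ℝ, E) 𝓘(ℝ, E') f x : E →L[ℝ] E') u = fderiv ℝ fh (φ x) u :=
      fun u => by rw [h2]; rfl
    exact (h4 u).trans (huw.trans (h4 w).symm)
  set L := fderiv ℝ fh (φ x)
  obtain ⟨W', hW'⟩ := Submodule.exists_isCompl (LinearMap.range (L : E →ₗ[ℝ] E'))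
  have hfr : Module.finrank ℝ (LinearMap.range (L : E →ₗ[ℝ] E')) = Module.finrank ℝ E :=
    LinearMap.finrank_range_of_inj hL
  have hsum := Submodule.finrank_add_eq_of_isCompl hW'
  let κ : W ≃ₗ[ℝ] W' := LinearEquiv.ofFinrankEq _ _ (by omega)
  let k : W →L[ℝ] E' := LinearMap.toContinuousLinearMap (W'.subtype ∘ₗ κ.toLinearMap)
  let T : (E × W) →L[ℝ] E' := L.comp (ContinuousLinearMap.fst ℝ E W) +
    k.comp (ContinuousLinearMap.snd ℝ E W)
  have hT : Function.Injective (T : E × W →ₗ[ℝ] E') := by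
    rw [← LinearMap.ker_eq_bot, LinearMap.ker_eq_bot']
    rintro ⟨u, w⟩ huw
    have huw' : L u + (κ w : E') = 0 := huw
    have h1 : L u ∈ (LinearMap.range (L : E →ₗ[ℝ] E')) ⊓ W' := by
      refine ⟨⟨u, rfl⟩, ?_⟩
      rw [eq_neg_of_add_eq_zero_left huw']
      exact W'.neg_mem (κ w).2
    rw [hW'.inf_eq_bot, Submodule.mem_bot] at h1
    have hu : u = 0 := hL (by rw [h1, map_zero])
    rw [h1, zero_add] at huw'
    have hw : w = 0 := κ.injective (by rw [map_zero]; exact Subtype.ext huw')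
    rw [hu, hw]; rfl
  let Te : (E × W) ≃L[ℝ] E' := (LinearMap.linearEquivOfInjective (T : E × W →ₗ[ℝ] E') hT
    (by rw [Module.finrank_prod]; omega)).toContinuousLinearEquiv
  have hTe : (Te : E × W →L[ℝ] E') = T := ContinuousLinearMap.ext fun _ => rfl
  -- Thickening f in the complementary directions gives a map with derivative `Te` at (φ x, 0),
  -- hence a local diffeomorphism.
  let Φ : E × W → E' := fun p => fh p.1 + k p.2
  have hΦ : ContDiffOn ℝ ∞ Φ (Prod.fst ⁻¹' U) :=
    (hfh.comp contDiff_fst.contDiffOn fun p hp => hp).add (k.contDiff.comp contDiff_snd).contDiffOn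
  have hΦd : fderiv ℝ Φ (φ x, 0) = Te := by
    rw [hTe]
    have h1 : HasFDerivAt fh L (φ x) :=
      ((hfh.contDiffAt (hU.mem_nhds hxU)).differentiableAt (by simp)).hasFDerivAt
    have h2 : HasFDerivAt (fun p : E × W => fh p.1) (L.comp (ContinuousLinearMap.fst ℝ E W))
        (φ x, 0) :=
      HasFDerivAt.comp (f := Prod.fst) (φ x, (0 : W)) h1 hasFDerivAt_fst
    have h3 : HasFDerivAt (fun p : E × W => k p.2) (k.comp (ContinuousLinearMap.snd ℝ E W))
        (φ x, 0) := HasFDerivAt.comp (φ x, (0 : W)) k.hasFDerivAt hasFDerivAt_snd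
    exact (h2.add h3).fderiv
  obtain ⟨e, hxe, heU, hee, hes⟩ := exists_openPartialHomeomorph_of_fderiv_bijective
    (hU.preimage continuous_fst) hΦ (x := (φ x, 0)) hxU Te hΦd
  -- Straightening the codomain chart by the inverse of Φ turns f into u ↦ (u, 0), since f is Φ
  -- restricted to the slice with second coordinate zero.
  let cod : OpenPartialHomeomorph N E' :=
    (ψ.trans e.symm).trans Te.toHomeomorph.toOpenPartialHomeomorph
  have hcods : cod.source = ψ.source ∩ ψ ⁻¹' e.target := by
    simp [cod]
  have hcod : cod ∈ IsManifold.maximalAtlas 𝓘(ℝ, E') ∞ N := by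
    apply OpenPartialHomeomorph.mem_maximalAtlas_of_contMDiffOn
    · rw [hcods]
      refine (contMDiff_iff_contDiff.2 Te.contDiff).comp_contMDiffOn ?_
      refine ContMDiffOn.comp (t := e.target) (contMDiffOn_iff_contDiffOn.2 hes)
        ((contMDiffOn_of_mem_maximalAtlas hψ).mono inter_subset_left) fun y hy => hy.2
    · have hct : cod.target = Te.symm ⁻¹' (e.source ∩ e ⁻¹' ψ.target) := by
        ext z; simp [cod]
      rw [hct]
      refine ContMDiffOn.comp (t := e.source ∩ e ⁻¹' ψ.target) (g := ψ.symm ∘ e) ?_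
        (contMDiff_iff_contDiff.2 Te.symm.contDiff).contMDiffOn fun y hy => hy
      refine (contMDiffOn_symm_of_mem_maximalAtlas hψ).comp (t := ψ.target)
        (contMDiffOn_iff_contDiffOn.2 ?_) fun y hy => hy.2
      rw [hee]
      exact hΦ.mono (inter_subset_left.trans heU)
  let s : Set M := φ.source ∩ φ ⁻¹' ((fun u : E => (u, (0 : W))) ⁻¹' e.source)
  have hs : IsOpen s := φ.isOpen_inter_preimage (e.open_source.preimage (by fun_prop))
  have hfe : ∀ u ∈ φ.target, (u, (0 : W)) ∈ e.source → e.symm (fh u) = (u, 0) := by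
    intro u _ hu
    have : e (u, 0) = fh u := by rw [hee]; simp [Φ]
    rw [← this, e.left_inv hu]
  have hfhx : fh (φ x) = ψ (f x) := by simp [fh, φ.left_inv hxφ]
  refine IsImmersionAtOfComplement.mk_of_continuousAt hf.continuous.continuousAt Te (φ.restr s)
    cod ?_ ?_ (restr_mem_maximalAtlas (contDiffGroupoid ∞ 𝓘(ℝ, E)) hφ hs) hcod ?_
  · rw [φ.restr_source' s hs]
    exact ⟨hxφ, hxφ, hxe⟩
  · rw [hcods]
    refine ⟨hxψ, ?_⟩
    have : e (φ x, 0) = ψ (f x) := by rw [hee, ← hfhx]; simp [Φ]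
    rw [mem_preimage, ← this]
    exact e.map_source hxe
  · intro u hu
    have hu' : u ∈ (φ.restr s).target := by simpa using hu
    have hu1 := (φ.restr s).map_target hu'
    rw [φ.restr_source' s hs] at hu1
    have hut : u ∈ φ.target := by
      have := hu'
      simp only [OpenPartialHomeomorph.restr_target] at this
      exact this.1
    have hue : (u, (0 : W)) ∈ e.source := by
      have := hu1.2.2
      simpa [φ.right_inv hut] using this
    change Te (e.symm (fh u)) = Te (u, 0)
    rw [hfe u hut hue]

/-! ### Quotient manifolds from retractions -/

/-- An idempotent linear map factors through the coordinate space of its range. -/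
theorem exists_factor_of_idempotent {E : Type*} [NormedAddCommGroup E] [NormedSpace ℝ E]
    [FiniteDimensional ℝ E] (P : E →L[ℝ] E) (hP : ∀ v, P (P v) = P v) {m : ℕ}
    (hm : Module.finrank ℝ (LinearMap.ker (P : E →ₗ[ℝ] E)) + m = Module.finrank ℝ E) :
    ∃ (l : E →L[ℝ] EuclideanSpace ℝ (Fin m)) (l' : EuclideanSpace ℝ (Fin m) →L[ℝ] E),
      (∀ y, l (l' y) = y) ∧ ∀ v, l' (l v) = P v := by
  have hr := LinearMap.finrank_range_add_finrank_ker (P : E →ₗ[ℝ] E)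
  let e : LinearMap.range (P : E →ₗ[ℝ] E) ≃ₗ[ℝ] EuclideanSpace ℝ (Fin m) :=
    LinearEquiv.ofFinrankEq _ _ (by rw [finrank_euclideanSpace, Fintype.card_fin]; omega)
  refine ⟨LinearMap.toContinuousLinearMap (e.toLinearMap ∘ₗ (P : E →ₗ[ℝ] E).rangeRestrict),
    LinearMap.toContinuousLinearMap ((LinearMap.range (P : E →ₗ[ℝ] E)).subtype ∘ₗ
      e.symm.toLinearMap), fun y => ?_, fun v => ?_⟩
  · change e ((P : E →ₗ[ℝ] E).rangeRestrict (e.symm y : E)) = y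
    have : (P : E →ₗ[ℝ] E).rangeRestrict (e.symm y : E) = e.symm y := by
      obtain ⟨w, hw⟩ := (e.symm y).2
      apply Subtype.ext
      change P (e.symm y : E) = e.symm y
      rw [← hw]
      exact hP w
    rw [this, e.apply_symm_apply]
  · change ((e.symm (e ((P : E →ₗ[ℝ] E).rangeRestrict v)) : _) : E) = P v
    rw [e.symm_apply_apply]
    rfl

section Retraction

variable {E : Type*} [NormedAddCommGroup E] [NormedSpace ℝ E] [FiniteDimensional ℝ E]
  {Q : Type*} [TopologicalSpace Q] [ChartedSpace E Q] [IsManifold 𝓘(ℝ, E) ∞ Q]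

open Topology Filter in
/-- Near a fixed point, a smooth retraction is linear in a suitable chart. -/
theorem exists_chart_of_retraction {W : Set Q} (hW : IsOpen W) {r : Q → Q}
    (hr : ContMDiffOn 𝓘(ℝ, E) 𝓘(ℝ, E) ∞ r W) (hrr : ∀ x ∈ W, r (r x) = r x)
    {a : Q} (ha : a ∈ W) (hra : r a = a) {m : ℕ}
    (hm : Module.finrank ℝ (LinearMap.ker (mfderiv 𝓘(ℝ, E) 𝓘(ℝ, E) r a).toLinearMap) + m =
      Module.finrank ℝ E) :
    ∃ (ψ : OpenPartialHomeomorph Q E) (l : E →L[ℝ] EuclideanSpace ℝ (Fin m))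
      (l' : EuclideanSpace ℝ (Fin m) →L[ℝ] E), ψ ∈ IsManifold.maximalAtlas 𝓘(ℝ, E) ∞ Q ∧
      a ∈ ψ.source ∧ ψ.source ⊆ W ∧ (∀ y, l (l' y) = y) ∧
      ∀ x ∈ ψ.source, r x ∈ ψ.source → l' (l (ψ x)) = ψ (r x) := by
  set c := chartAt E a
  have hc : c ∈ IsManifold.maximalAtlas 𝓘(ℝ, E) ∞ Q := IsManifold.chart_mem_maximalAtlas a
  have hac : a ∈ c.source := mem_chart_source E a
  let rh : E → E := c ∘ r ∘ c.symm
  let W' : Set Q := W ∩ r ⁻¹' c.source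
  have hW' : IsOpen W' := hr.continuousOn.isOpen_inter_preimage hW c.open_source
  let U : Set E := c.target ∩ c.symm ⁻¹' W'
  have hU : IsOpen U := c.symm.isOpen_inter_preimage hW'
  have hrh : ContDiffOn ℝ ∞ rh U := by
    rw [← contMDiffOn_iff_contDiffOn]
    refine (contMDiffOn_of_mem_maximalAtlas hc).comp ?_ fun y hy => hy.2.2
    exact hr.comp ((contMDiffOn_symm_of_mem_maximalAtlas hc).mono inter_subset_left)
      fun y hy => hy.2.1
  have haU : c a ∈ U :=
    ⟨c.map_source hac, by simpa [W', c.left_inv hac, hra] using ⟨ha, hac⟩⟩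
  have hrha : rh (c a) = c a := by simp [rh, c.left_inv hac, hra]
  let P : E →L[ℝ] E := fderiv ℝ rh (c a)
  have hd : HasFDerivAt rh P (c a) :=
    ((hrh.contDiffAt (hU.mem_nhds haU)).differentiableAt (by simp)).hasFDerivAt
  have hmP : (mfderiv 𝓘(ℝ, E) 𝓘(ℝ, E) r a : E →L[ℝ] E) = P := by
    rw [((hr.contMDiffAt (hW.mem_nhds ha)).mdifferentiableAt (by simp)).mfderiv]
    simp only [writtenInExtChartAt, mfld_simps, fderivWithin_univ]
    rw [hra]
  have hrhx : ∀ x ∈ c.source, rh (c x) = c (r x) := by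
    intro x hx; simp [rh, c.left_inv hx]
  -- The chain rule at the fixed point applied to rh ∘ rh = rh.
  have hPP : ∀ v, P (P v) = P v := by
    have h1 : rh ∘ rh =ᶠ[𝓝 (c a)] rh := by
      have hV : U ∈ 𝓝 (c a) := hU.mem_nhds haU
      filter_upwards [hV] with u hu
      have h2 : r (c.symm u) ∈ c.source := hu.2.2
      change rh (c (r (c.symm u))) = c (r (c.symm u))
      rw [hrhx _ h2, hrr _ hu.2.1]
    have h2 : HasFDerivAt (rh ∘ rh) (P.comp P) (c a) :=
      HasFDerivAt.comp (c a) (hrha.symm ▸ hd) hd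
    have h3 : P.comp P = P := (h2.congr_of_eventuallyEq h1.symm).unique hd
    exact fun v => DFunLike.congr_fun h3 v
  obtain ⟨l, l', hll, hlP⟩ := exists_factor_of_idempotent P hPP (m := m) (by rw [← hmP]; exact hm)
  -- This is g = P(rh - c a) + (1 - P)(id - rh). Its derivative at c a is P² + (1 - P)² = 1, so it
  -- is a local coordinate change. It linearises the retraction: both P ∘ g and g ∘ rh are equal to
  -- P(rh - c a), because P is idempotent and rh ∘ rh = rh.
  let g : E → E := fun u => P (rh u - c a) + ((u - rh u) - P (u - rh u))
  have hg : ContDiffOn ℝ ∞ g U := by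
    have h1 : ContDiffOn ℝ ∞ (fun u => u - rh u) U := contDiffOn_id.sub hrh
    exact (P.contDiff.comp_contDiffOn (hrh.sub contDiffOn_const)).add
      (h1.sub (P.contDiff.comp_contDiffOn h1))
  have hgd : fderiv ℝ g (c a) = (ContinuousLinearEquiv.refl ℝ E : E →L[ℝ] E) := by
    have h1 : HasFDerivAt (fun u => u - rh u) (ContinuousLinearMap.id ℝ E - P) (c a) :=
      (hasFDerivAt_id _).sub hd
    have h2 : HasFDerivAt (fun u => P (rh u - c a)) (P.comp P) (c a) :=
      P.hasFDerivAt.comp (c a) (hd.sub_const (c a))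
    have h3 : HasFDerivAt (fun u => P (u - rh u)) (P.comp (ContinuousLinearMap.id ℝ E - P))
        (c a) := P.hasFDerivAt.comp (c a) h1
    refine (h2.add (h1.sub h3)).fderiv.trans ?_
    ext v
    simp [hPP]
  obtain ⟨e, hae, heU, hee, hes⟩ := exists_openPartialHomeomorph_of_fderiv_bijective hU hg haU
    (ContinuousLinearEquiv.refl ℝ E) hgd
  have hs : (c.trans e).source = c.source ∩ c ⁻¹' e.source := by simp
  refine ⟨c.trans e, l, l', ?_, ?_, ?_, hll, ?_⟩
  · apply OpenPartialHomeomorph.mem_maximalAtlas_of_contMDiffOn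
    · rw [hs]
      refine ContMDiffOn.comp (t := e.source) (g := e) ?_
        ((contMDiffOn_of_mem_maximalAtlas hc).mono inter_subset_left) fun y hy => hy.2
      rw [hee]
      exact contMDiffOn_iff_contDiffOn.2 (hg.mono heU)
    · have ht : (c.trans e).target = e.target ∩ e.symm ⁻¹' c.target := by simp
      rw [ht]
      refine ContMDiffOn.comp (t := c.target) (g := c.symm) (contMDiffOn_symm_of_mem_maximalAtlas hc)
        ((contMDiffOn_iff_contDiffOn.2 hes).mono inter_subset_left) fun y hy => hy.2
  · rw [hs]; exact ⟨hac, hae⟩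
  · rw [hs]
    rintro x ⟨hx, hx'⟩
    have := (heU hx').2.1
    rwa [c.left_inv hx] at this
  · rw [hs]
    rintro x ⟨hx, hx'⟩ ⟨hrx, hrx'⟩
    have hxW : x ∈ W := by
      have := (heU hx').2.1
      rwa [c.left_inv hx] at this
    change l' (l (e (c x))) = e (c (r x))
    rw [hlP, hee]
    change P (P (rh (c x) - c a) + ((c x - rh (c x)) - P (c x - rh (c x)))) =
      P (rh (c (r x)) - c a) + ((c (r x) - rh (c (r x))) - P (c (r x) - rh (c (r x))))
    rw [hrhx _ hx, hrhx _ hrx, hrr x hxW]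
    simp [hPP]

variable {A : Type*} [TopologicalSpace A] {p : Q → A} {m : ℕ}

open Topology Filter in
/-- A local section of a quotient map gives a chart of the quotient, together with coordinate
expressions of the quotient map and of the section. -/
theorem exists_quotient_chart (hp : IsQuotientMap p) {s : A → Q} {V : Set A}
    (hV : IsOpen (p ⁻¹' V)) (hps : ∀ b ∈ V, p (s b) = b)
    (hsp : ContMDiffOn 𝓘(ℝ, E) 𝓘(ℝ, E) ∞ (s ∘ p) (p ⁻¹' V)) {a : Q} (ha : p a ∈ V)
    (hsa : s (p a) = a)
    (hm : Module.finrank ℝ (LinearMap.ker (mfderiv 𝓘(ℝ, E) 𝓘(ℝ, E) (s ∘ p) a).toLinearMap) + m =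
      Module.finrank ℝ E) :
    ∃ (e : OpenPartialHomeomorph A (EuclideanSpace ℝ (Fin m)))
      (g : Q → EuclideanSpace ℝ (Fin m)) (h : EuclideanSpace ℝ (Fin m) → Q), p a ∈ e.source ∧
      (∀ x, p x ∈ e.source → e (p x) = g x) ∧
      ContMDiffOn 𝓘(ℝ, E) (𝓡 m) ∞ g (p ⁻¹' e.source) ∧
      (∀ y ∈ e.target, e.symm y = p (h y)) ∧
      ContMDiffOn (𝓡 m) 𝓘(ℝ, E) ∞ h e.target ∧ h (e (p a)) = a := by
  -- Since p ∘ s = id on V, the map s ∘ p is a retraction onto the image of s. Straightening it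
  -- turns this image into a linear slice, and the coordinates of the slice become those of the
  -- quotient.
  obtain ⟨ψ, l, l', hψ, haψ, hψV, hll, hψr⟩ := exists_chart_of_retraction hV hsp
    (fun x hx => by change s (p (s (p x))) = s (p x); rw [hps _ hx]) ha hsa hm
  have hsym : ContMDiffOn (𝓡 m) 𝓘(ℝ, E) ∞ (fun y => ψ.symm (l' y)) (l' ⁻¹' ψ.target) :=
    (contMDiffOn_symm_of_mem_maximalAtlas hψ).comp
      (contMDiff_iff_contDiff.2 l'.contDiff).contMDiffOn fun y hy => hy
  have hsrc : p ⁻¹' (V ∩ s ⁻¹' ψ.source) = p ⁻¹' V ∩ (s ∘ p) ⁻¹' ψ.source := rfl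
  have hg : ContMDiffOn 𝓘(ℝ, E) (𝓡 m) ∞ (fun x => l (ψ (s (p x))))
      (p ⁻¹' (V ∩ s ⁻¹' ψ.source)) :=
    (contMDiff_iff_contDiff.2 l.contDiff).comp_contMDiffOn
      ((contMDiffOn_of_mem_maximalAtlas hψ).comp (hsp.mono fun x hx => hx.1) fun x hx => hx.2)
  have hopen : IsOpen (V ∩ s ⁻¹' ψ.source) := by
    rw [← hp.isOpen_preimage, hsrc]
    exact hsp.continuousOn.isOpen_inter_preimage hV ψ.open_source
  have hkey : ∀ b ∈ V ∩ s ⁻¹' ψ.source, l' (l (ψ (s b))) = ψ (s b) := by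
    rintro b ⟨hb, hb'⟩
    have h1 : (s ∘ p) (s b) = s b := by change s (p (s b)) = s b; rw [hps b hb]
    rw [hψr (s b) hb' (by rw [h1]; exact hb'), h1]
  have hkey2 : ∀ y, l' y ∈ ψ.target → s (p (ψ.symm (l' y))) ∈ ψ.source →
      l (ψ (s (p (ψ.symm (l' y))))) = y := by
    intro y hy hy'
    have h1 := hψr (ψ.symm (l' y)) (ψ.map_target hy) hy'
    change _ = ψ (s (p _)) at h1
    rw [← h1, ψ.right_inv hy, hll, hll]
  let e : OpenPartialHomeomorph A (EuclideanSpace ℝ (Fin m)) :=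
    { toFun := fun b => l (ψ (s b))
      invFun := fun y => p (ψ.symm (l' y))
      source := V ∩ s ⁻¹' ψ.source
      target := (l' ⁻¹' ψ.target) ∩ (fun y => s (p (ψ.symm (l' y)))) ⁻¹' ψ.source
      map_source' := by
        rintro b hb
        have h1 := hkey b hb
        refine ⟨?_, ?_⟩
        · rw [mem_preimage, h1]; exact ψ.map_source hb.2
        · rw [mem_preimage, h1, ψ.left_inv hb.2, hps b hb.1]; exact hb.2
      map_target' := by
        rintro y ⟨hy, hy'⟩
        exact ⟨hψV (ψ.map_target hy), hy'⟩
      left_inv' := by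
        rintro b hb
        rw [hkey b hb, ψ.left_inv hb.2, hps b hb.1]
      right_inv' := by
        rintro y ⟨hy, hy'⟩
        exact hkey2 y hy hy'
      open_source := hopen
      open_target := by
        refine ContinuousOn.isOpen_inter_preimage ?_ (ψ.open_target.preimage l'.continuous)
          ψ.open_source
        exact hsp.continuousOn.comp hsym.continuousOn fun y hy => hψV (ψ.map_target hy)
      -- The section s is not known to be continuous, but s ∘ p is, and openness in a quotient is
      -- tested upstairs.
      continuousOn_toFun := by
        rw [continuousOn_open_iff hopen]
        intro t ht
        rw [← hp.isOpen_preimage]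
        exact hg.continuousOn.isOpen_inter_preimage (hopen.preimage hp.continuous) ht
      continuousOn_invFun :=
        hp.continuous.comp_continuousOn (hsym.continuousOn.mono inter_subset_left) }
  refine ⟨e, fun x => l (ψ (s (p x))), fun y => ψ.symm (l' y), ?_, fun _ _ => rfl, hg,
    fun _ _ => rfl, hsym.mono inter_subset_left, ?_⟩
  · exact ⟨ha, by rw [mem_preimage, hsa]; exact haψ⟩
  · change ψ.symm (l' (l (ψ (s (p a))))) = a
    rw [hkey (p a) ⟨ha, by rw [mem_preimage, hsa]; exact haψ⟩, hsa, ψ.left_inv haψ]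

open Topology Filter in
/-- A quotient of a manifold that has local sections with smooth composites of constant rank is
a manifold, and the quotient map is a smooth submersion. -/
theorem exists_quotient_manifold (hp : IsQuotientMap p)
    (hsec : ∀ a : Q, ∃ (s : A → Q) (V : Set A), IsOpen (p ⁻¹' V) ∧ (∀ b ∈ V, p (s b) = b) ∧
      ContMDiffOn 𝓘(ℝ, E) 𝓘(ℝ, E) ∞ (s ∘ p) (p ⁻¹' V) ∧ p a ∈ V ∧ s (p a) = a ∧
      Module.finrank ℝ (LinearMap.ker (mfderiv 𝓘(ℝ, E) 𝓘(ℝ, E) (s ∘ p) a).toLinearMap) + m =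
        Module.finrank ℝ E) :
    ∃ _ : ChartedSpace (EuclideanSpace ℝ (Fin m)) A, IsManifold (𝓡 m) ∞ A ∧
      ContMDiff 𝓘(ℝ, E) (𝓡 m) ∞ p ∧ ∀ a : Q, ∃ (s : A → Q) (V : Set A), IsOpen V ∧ p a ∈ V ∧
        s (p a) = a ∧ ContMDiffOn (𝓡 m) 𝓘(ℝ, E) ∞ s V ∧ ∀ b ∈ V, p (s b) = b := by
  have hch : ∀ a : Q, ∃ (e : OpenPartialHomeomorph A (EuclideanSpace ℝ (Fin m)))
      (g : Q → EuclideanSpace ℝ (Fin m)) (h : EuclideanSpace ℝ (Fin m) → Q), p a ∈ e.source ∧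
      (∀ x, p x ∈ e.source → e (p x) = g x) ∧
      ContMDiffOn 𝓘(ℝ, E) (𝓡 m) ∞ g (p ⁻¹' e.source) ∧
      (∀ y ∈ e.target, e.symm y = p (h y)) ∧
      ContMDiffOn (𝓡 m) 𝓘(ℝ, E) ∞ h e.target ∧ h (e (p a)) = a := by
    intro a
    obtain ⟨s, V, h1, h2, h3, h4, h5, h6⟩ := hsec a
    exact exists_quotient_chart hp h1 h2 h3 h4 h5 h6
  choose e g h hpa heg hg heh hh hha using hch
  let cs : ChartedSpace (EuclideanSpace ℝ (Fin m)) A :=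
    { atlas := range e
      chartAt := fun b => e (Function.surjInv hp.surjective b)
      mem_chart_source := fun b => by
        have := hpa (Function.surjInv hp.surjective b)
        rwa [Function.surjInv_eq hp.surjective] at this
      chart_mem_atlas := fun b => ⟨_, rfl⟩ }
  -- A transition map factors through Q as the coordinate expression h of one section followed by
  -- the coordinate expression g of the quotient map.
  have hman : IsManifold (𝓡 m) ∞ A := by
    apply isManifold_of_contDiffOn
    rintro _ _ ⟨a, rfl⟩ ⟨a', rfl⟩
    simp only [mfld_simps]
    rw [← contMDiffOn_iff_contDiffOn]
    refine ((hg a').comp ((hh a).mono inter_subset_left) fun y hy => ?_).congr fun y hy => ?_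
    · rw [mem_preimage, mem_preimage, ← heh a y hy.1]; exact hy.2
    · have h1 : p (h a y) ∈ (e a').source := by rw [← heh a y hy.1]; exact hy.2
      simp only [Function.comp_apply]
      rw [heh a y hy.1, heg a' _ h1]
  have hmem : ∀ a, e a ∈ IsManifold.maximalAtlas (𝓡 m) ∞ A := fun a =>
    IsManifold.subset_maximalAtlas ⟨a, rfl⟩
  refine ⟨cs, hman, fun a => ?_, fun a => ⟨fun b => h a (e a b), (e a).source,
    (e a).open_source, hpa a, hha a, ?_, fun b hb => ?_⟩⟩
  · have hopen : IsOpen (p ⁻¹' (e a).source) := (e a).open_source.preimage hp.continuous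
    have h1 : ContMDiffOn 𝓘(ℝ, E) (𝓡 m) ∞ (fun x => (e a).symm (g a x)) (p ⁻¹' (e a).source) :=
      (contMDiffOn_symm_of_mem_maximalAtlas (hmem a)).comp (hg a) fun x hx => by
        rw [mem_preimage, ← heg a x hx]; exact (e a).map_source hx
    refine (h1.contMDiffAt (hopen.mem_nhds (hpa a))).congr_of_eventuallyEq ?_
    filter_upwards [hopen.mem_nhds (hpa a)] with x hx
    rw [← heg a x hx, (e a).left_inv hx]
  · exact (hh a).comp (contMDiffOn_of_mem_maximalAtlas (hmem a)) fun b hb => (e a).map_source hb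
  · rw [← heh a _ ((e a).map_source hb), (e a).left_inv hb]

end Retraction

/-! ### Lie brackets of related vector fields -/

open Filter Topology in
-- Differentiate DF·V = V' ∘ F along W and DF·W = W' ∘ F along V and subtract: the terms with the
-- second derivative of F cancel by its symmetry.
theorem VectorField.fderiv_lieBracket_of_related
    {E : Type*} [NormedAddCommGroup E] [NormedSpace ℝ E]
    {E' : Type*} [NormedAddCommGroup E'] [NormedSpace ℝ E']
    {F : E → E'} {V W : E → E} {V' W' : E' → E'} {u : E} (hF : ContDiffAt ℝ 2 F u)
    (hV : DifferentiableAt ℝ V u) (hW : DifferentiableAt ℝ W u)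
    (hV' : DifferentiableAt ℝ V' (F u)) (hW' : DifferentiableAt ℝ W' (F u))
    (hFV : ∀ᶠ y in 𝓝 u, fderiv ℝ F y (V y) = V' (F y))
    (hFW : ∀ᶠ y in 𝓝 u, fderiv ℝ F y (W y) = W' (F y)) :
    fderiv ℝ F u (VectorField.lieBracket ℝ V W u) = VectorField.lieBracket ℝ V' W' (F u) := by
  have hF1 : HasFDerivAt F (fderiv ℝ F u) u := (hF.differentiableAt (by simp)).hasFDerivAt
  have hF2 : HasFDerivAt (fderiv ℝ F) (fderiv ℝ (fderiv ℝ F) u) u :=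
    ((hF.fderiv_right (m := 1) (by norm_num)).differentiableAt (by simp)).hasFDerivAt
  have key : ∀ {U : E → E} {U' : E' → E'}, DifferentiableAt ℝ U u → DifferentiableAt ℝ U' (F u) →
      (∀ᶠ y in 𝓝 u, fderiv ℝ F y (U y) = U' (F y)) → ∀ h,
      fderiv ℝ (fderiv ℝ F) u h (U u) + fderiv ℝ F u (fderiv ℝ U u h) =
        fderiv ℝ U' (F u) (fderiv ℝ F u h) := by
    intro U U' hU hU' hUU h
    have h1 := hF2.clm_apply hU.hasFDerivAt
    have h2 := hU'.hasFDerivAt.comp u hF1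
    have h3 := (h1.congr_of_eventuallyEq (f₁ := U' ∘ F)
      (hUU.mono fun y hy => hy.symm)).unique h2
    have := DFunLike.congr_fun h3 h
    simp only [add_apply, ContinuousLinearMap.comp_apply,
      ContinuousLinearMap.flip_apply] at this
    rw [← this, add_comm]
  have hsymm : IsSymmSndFDerivAt ℝ F u := hF.isSymmSndFDerivAt (by simp)
  have h1 := key hV hV' hFV (W u)
  have h2 := key hW hW' hFW (V u)
  rw [VectorField.lieBracket, VectorField.lieBracket, map_sub, ← hFV.self_of_nhds,
    ← hFW.self_of_nhds, ← h1, ← h2, hsymm (V u) (W u)]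
  abel

section Related

variable {E : Type*} [NormedAddCommGroup E] [NormedSpace ℝ E] {X : Type*} [TopologicalSpace X]
  {I : ModelWithCorners ℝ E X} {M : Type*} [TopologicalSpace M] [ChartedSpace X M]
  {E' : Type*} [NormedAddCommGroup E'] [NormedSpace ℝ E'] {X' : Type*} [TopologicalSpace X']
  {I' : ModelWithCorners ℝ E' X'} {N : Type*} [TopologicalSpace N] [ChartedSpace X' N]

open VectorField

/-- The coordinate expression of a vector field in the chart at `x`. -/
def chartVectorField (I : ModelWithCorners ℝ E X) (V : ∀ y : M, TangentSpace I y) (x : M) : E → E :=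
  mpullbackWithin 𝓘(ℝ, E) I (extChartAt I x).symm V (range I)

/-- The pullback in the definition inverts the derivative of the inverse chart, and that inverse is
the derivative of the chart. In this form the relation between two vector fields can be read in
charts by the chain rule. -/
theorem chartVectorField_extChartAt [I.Boundaryless] [IsManifold I 1 M]
    (V : ∀ y : M, TangentSpace I y) (x : M) {z : M} (hz : z ∈ (extChartAt I x).source) :
    chartVectorField I V x (extChartAt I x z) = mvfderiv I (extChartAt I x) z (V z) := by
  have key : ∀ u ∈ (extChartAt I x).target, chartVectorField I V x u =
      mvfderiv I (extChartAt I x) ((extChartAt I x).symm u) (V ((extChartAt I x).symm u)) := by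
    intro u hu
    rw [chartVectorField, mpullbackWithin_apply,
      ContinuousLinearMap.inverse_eq (mfderivWithin_extChartAt_symm_comp_mfderiv_extChartAt hu)
        (mfderiv_extChartAt_comp_mfderivWithin_extChartAt_symm hu)]
    rfl
  rw [key _ ((extChartAt I x).map_source hz)]
  exact congrArg (fun z => mvfderiv I (extChartAt I x) z (V z)) ((extChartAt I x).left_inv hz)

theorem differentiableAt_chartVectorField [I.Boundaryless] [CompleteSpace E] [IsManifold I 1 M]
    [IsManifold I ∞ M] {V : ∀ y : M, TangentSpace I y} {x : M}
    (hV : MDifferentiableAt I I.tangent (fun y => (V y : TangentBundle I M)) x) :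
    DifferentiableAt ℝ (chartVectorField I V x) (extChartAt I x x) := by
  have h1 := (mdifferentiableWithinAt_univ.2
    hV).differentiableWithinAt_mpullbackWithin_vectorField
  rw [preimage_univ, univ_inter] at h1
  have h2 : DifferentiableWithinAt ℝ (chartVectorField I V x) (range I) (extChartAt I x x) := h1
  rwa [I.range_eq_univ, differentiableWithinAt_univ] at h2

theorem mvfderiv_extChartAt_mlieBracket [I.Boundaryless] [IsManifold I 1 M]
    (V W : ∀ y : M, TangentSpace I y) (x : M) :
    mvfderiv I (extChartAt I x) x (mlieBracket I V W x) =
      lieBracket ℝ (chartVectorField I V x) (chartVectorField I W x) (extChartAt I x x) := by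
  rw [← lieBracketWithin_univ, ← I.range_eq_univ, ← mlieBracketWithin_univ,
    mlieBracketWithin_apply, preimage_univ, univ_inter]
  exact DFunLike.congr_fun (isInvertible_mfderiv_extChartAt (I := I)
    (mem_extChartAt_source x)).self_comp_inverse _

open Filter Topology in
/-- Lie brackets of related vector fields are related. -/
theorem VectorField.mfderiv_mlieBracket_of_related [I.Boundaryless] [I'.Boundaryless]
    [CompleteSpace E] [CompleteSpace E'] [IsManifold I ∞ M] [IsManifold I' ∞ N]
    {F : M → N} (hF : ContMDiff I I' ∞ F) {V W : ∀ y : M, TangentSpace I y}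
    {V' W' : ∀ y : N, TangentSpace I' y} {x : M}
    (hV : MDifferentiableAt I I.tangent (fun y => (V y : TangentBundle I M)) x)
    (hW : MDifferentiableAt I I.tangent (fun y => (W y : TangentBundle I M)) x)
    (hV' : MDifferentiableAt I' I'.tangent (fun y => (V' y : TangentBundle I' N)) (F x))
    (hW' : MDifferentiableAt I' I'.tangent (fun y => (W' y : TangentBundle I' N)) (F x))
    (hFV : ∀ y, mfderiv I I' F y (V y) = V' (F y)) (hFW : ∀ y, mfderiv I I' F y (W y) = W' (F y)) :
    mfderiv I I' F x (mlieBracket I V W x) = mlieBracket I' V' W' (F x) := by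
  have : IsManifold I 1 M := IsManifold.of_le (n := ∞) (by simp)
  have : IsManifold I' 1 N := IsManifold.of_le (n := ∞) (by simp)
  set φ := extChartAt I x with hφ
  set φ' := extChartAt I' (F x) with hφ'
  let Fh : E → E' := φ' ∘ F ∘ φ.symm
  have hx : x ∈ φ.source := mem_extChartAt_source x
  have hFx : F x ∈ φ'.source := mem_extChartAt_source (F x)
  have hu0 : φ.symm (φ x) = x := φ.left_inv hx
  have hFh : ∀ z ∈ φ.source, Fh (φ z) = φ' (F z) := fun z hz => by simp [Fh, φ.left_inv hz]
  have hFhd : ContDiffAt ℝ ∞ Fh (φ x) := by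
    have := (contMDiffAt_iff.1 (hF x)).2
    rwa [I.range_eq_univ, contDiffWithinAt_univ] at this
  have hFd : ∀ z ∈ φ.source, F z ∈ φ'.source → ∀ w : TangentSpace I z,
      fderiv ℝ Fh (φ z) (mvfderiv I φ z w) = mvfderiv I' φ' (F z) (mfderiv I I' F z w) := by
    intro z hz hFz w
    have hφd : MDifferentiableAt I 𝓘(ℝ, E) φ z :=
      mdifferentiableAt_extChartAt (by rwa [← extChartAt_source (I := I)])
    have hφd' : MDifferentiableAt I' 𝓘(ℝ, E') φ' (F z) :=
      mdifferentiableAt_extChartAt (by rwa [← extChartAt_source (I := I')])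
    have hFz' : MDifferentiableAt I I' F z := hF.mdifferentiableAt (by simp)
    have hsd : MDifferentiableAt 𝓘(ℝ, E) I φ.symm (φ z) :=
      ((contMDiffOn_extChartAt_symm (n := ∞) x).contMDiffAt
        ((isOpen_extChartAt_target x).mem_nhds (φ.map_source hz))).mdifferentiableAt (by simp)
    have hFhz : MDifferentiableAt 𝓘(ℝ, E) 𝓘(ℝ, E') Fh (φ z) := by
      have h1 : φ.symm (φ z) = z := φ.left_inv hz
      refine MDifferentiableAt.comp (I' := I') (φ z) ?_ ?_
      · change MDifferentiableAt I' _ φ' (F (φ.symm (φ z)))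
        rw [h1]; exact hφd'
      · refine MDifferentiableAt.comp (I' := I) (φ z) ?_ hsd
        rw [h1]; exact hFz'
    have h1 : Fh ∘ φ =ᶠ[𝓝 z] φ' ∘ F := by
      filter_upwards [(isOpen_extChartAt_source x).mem_nhds hz] with y hy
      exact hFh y hy
    have h2 := h1.mfderiv_eq (I := I) (I' := 𝓘(ℝ, E'))
    have h3 := mfderiv_comp_apply z hFhz hφd w
    have h4 := mfderiv_comp_apply z hφd' hFz' w
    rw [h2] at h3
    rw [mfderiv_eq_fderiv] at h3
    exact (h3.symm.trans h4 : _)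
  -- Relatedness of vector fields on manifolds becomes relatedness of their coordinate expressions
  -- under Fh, but only near φ x, where F maps into the chart at F x.
  have hrel : ∀ {U : ∀ y : M, TangentSpace I y} {U' : ∀ y : N, TangentSpace I' y},
      (∀ y, mfderiv I I' F y (U y) = U' (F y)) → ∀ᶠ u in 𝓝 (φ x),
      fderiv ℝ Fh u (chartVectorField I U x u) = chartVectorField I' U' (F x) (Fh u) := by
    intro U U' hUU
    have hmem : φ.target ∩ φ.symm ⁻¹' (F ⁻¹' φ'.source) ∈ 𝓝 (φ x) := by
      refine ((continuousOn_extChartAt_symm x).isOpen_inter_preimage (isOpen_extChartAt_target x)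
        ((isOpen_extChartAt_source (F x)).preimage hF.continuous)).mem_nhds ?_
      exact ⟨φ.map_source hx, by rw [mem_preimage, hu0]; exact hFx⟩
    filter_upwards [hmem] with u hu
    obtain ⟨z, hz, rfl⟩ : ∃ z ∈ φ.source, φ z = u :=
      ⟨φ.symm u, φ.map_target hu.1, φ.right_inv hu.1⟩
    have hFz : F z ∈ φ'.source := by
      have := hu.2
      rwa [mem_preimage, φ.left_inv hz] at this
    rw [hFh z hz, chartVectorField_extChartAt U x hz, chartVectorField_extChartAt U' (F x) hFz,
      hFd z hz hFz, hUU]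
  have hFx' : Fh (φ x) = φ' (F x) := hFh x hx
  have hmain := VectorField.fderiv_lieBracket_of_related (F := Fh) (u := φ x)
    (hFhd.of_le (by norm_cast)) (differentiableAt_chartVectorField hV)
    (differentiableAt_chartVectorField hW)
    (hFx' ▸ differentiableAt_chartVectorField hV') (hFx' ▸ differentiableAt_chartVectorField hW')
    (hrel hFV) (hrel hFW)
  apply (isInvertible_mfderiv_extChartAt (I := I') hFx).injective
  change mvfderiv I' φ' (F x) _ = mvfderiv I' φ' (F x) _
  rw [← hFd x hx hFx, mvfderiv_extChartAt_mlieBracket, mvfderiv_extChartAt_mlieBracket, ← hFx']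
  exact hmain

end Related

/-! ### Derivatives of homomorphisms and the Lie algebra of a product -/

section LieMap

variable {E : Type*} [NormedAddCommGroup E] [NormedSpace ℝ E] {X : Type*} [TopologicalSpace X]
  {I : ModelWithCorners ℝ E X} {G : Type*} [TopologicalSpace G] [ChartedSpace X G] [Group G]
  {E' : Type*} [NormedAddCommGroup E'] [NormedSpace ℝ E'] {X' : Type*} [TopologicalSpace X']
  {I' : ModelWithCorners ℝ E' X'} {G' : Type*} [TopologicalSpace G'] [ChartedSpace X' G']
  [Group G']
  {E'' : Type*} [NormedAddCommGroup E''] [NormedSpace ℝ E''] {X'' : Type*} [TopologicalSpace X'']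
  {I'' : ModelWithCorners ℝ E'' X''} {G'' : Type*} [TopologicalSpace G''] [ChartedSpace X'' G'']
  [Group G'']

theorem lieMap_comp {f : G' →* G''} {g : G →* G'} (hf : ContMDiff I' I'' ∞ f)
    (hg : ContMDiff I I' ∞ g) (v : GroupLieAlgebra I G) :
    lieMap I I'' (f.comp g) v = lieMap I' I'' f (lieMap I I' g v) :=
  mfderiv_comp_apply_of_eq (I := I) (I' := I') (I'' := I'') (x := (1 : G)) (y := (1 : G'))
    (hf.mdifferentiableAt (by simp)) (hg.mdifferentiableAt (by simp)) (map_one g) v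

theorem lieMap_id (v : GroupLieAlgebra I G) : lieMap I I (MonoidHom.id G) v = v := by
  change mfderiv I I (id : G → G) 1 v = v
  rw [mfderiv_id]
  rfl

theorem lieMap_fst_inl_add_inr (ξ : GroupLieAlgebra I G) (η : GroupLieAlgebra I' G') :
    lieMap (I.prod I') I (MonoidHom.fst G G') (lieMap I (I.prod I') (MonoidHom.inl G G') ξ +
      lieMap I' (I.prod I') (MonoidHom.inr G G') η) = ξ := by
  rw [map_add, ← lieMap_comp contMDiff_fst (contMDiff_id.prodMk contMDiff_const),
    ← lieMap_comp contMDiff_fst (contMDiff_const.prodMk contMDiff_id),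
    MonoidHom.fst_comp_inl, MonoidHom.fst_comp_inr, lieMap_id]
  have : lieMap I' I (1 : G' →* G) η = 0 := by
    change mfderiv I' I (fun _ : G' => (1 : G)) 1 η = 0
    rw [mfderiv_const]
    rfl
  rw [this, add_zero]

theorem lieMap_snd_inl_add_inr (ξ : GroupLieAlgebra I G) (η : GroupLieAlgebra I' G') :
    lieMap (I.prod I') I' (MonoidHom.snd G G') (lieMap I (I.prod I') (MonoidHom.inl G G') ξ +
      lieMap I' (I.prod I') (MonoidHom.inr G G') η) = η := by
  rw [map_add, ← lieMap_comp contMDiff_snd (contMDiff_id.prodMk contMDiff_const),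
    ← lieMap_comp contMDiff_snd (contMDiff_const.prodMk contMDiff_id),
    MonoidHom.snd_comp_inl, MonoidHom.snd_comp_inr, lieMap_id]
  have : lieMap I I' (1 : G →* G') ξ = 0 := by
    change mfderiv I I' (fun _ : G => (1 : G')) 1 ξ = 0
    rw [mfderiv_const]
    rfl
  rw [this, zero_add]

/-- Identities in the Lie algebra of a product can be checked after the two projections, which are
group homomorphisms and so respect brackets. -/
theorem lieAlgebra_prod_ext {v w : GroupLieAlgebra (I.prod I') (G × G')}
    (h1 : lieMap (I.prod I') I (MonoidHom.fst G G') v = lieMap (I.prod I') I (MonoidHom.fst G G') w)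
    (h2 : lieMap (I.prod I') I' (MonoidHom.snd G G') v =
      lieMap (I.prod I') I' (MonoidHom.snd G G') w) : v = w := by
  have k1 : ∀ u : E × E', (lieMap (I.prod I') I (MonoidHom.fst G G') u : E) = u.1 := by
    intro u
    change (mfderiv (I.prod I') I (Prod.fst : G × G' → G) 1 u : E) = u.1
    rw [mfderiv_fst]
    rfl
  have k2 : ∀ u : E × E', (lieMap (I.prod I') I' (MonoidHom.snd G G') u : E') = u.2 := by
    intro u
    change (mfderiv (I.prod I') I' (Prod.snd : G × G' → G') 1 u : E') = u.2
    rw [mfderiv_snd]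
    rfl
  have h1' := (k1 v).symm.trans (h1.trans (k1 w))
  have h2' := (k2 v).symm.trans (h2.trans (k2 w))
  exact Prod.ext h1' h2'

variable [LieGroup I ∞ G] [LieGroup I' ∞ G']

/-- Differentiate f(gh) = f(g)f(h) in h at the unit. Left-invariant fields of v and of its image are
thus f-related, which is what makes `lieMap` respect brackets. -/
theorem mfderiv_mulInvariantVectorField (f : G →* G') (hf : ContMDiff I I' ∞ f)
    (v : GroupLieAlgebra I G) (g : G) :
    mfderiv I I' f g (mulInvariantVectorField v g) =
      mulInvariantVectorField (lieMap I I' f v) (f g) := by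
  have h1 := mfderiv_comp_apply_of_eq (I := I) (I' := I) (I'' := I') (f := fun h : G => g * h)
    (g := f) (x := (1 : G)) (y := g) (hf.mdifferentiableAt (by simp))
    ((contMDiff_mul_left (n := ∞)).mdifferentiableAt (by simp)) (mul_one g) v
  have h2 := mfderiv_comp_apply_of_eq (I := I) (I' := I') (I'' := I') (f := f)
    (g := fun h : G' => f g * h) (x := (1 : G)) (y := (1 : G'))
    ((contMDiff_mul_left (n := ∞)).mdifferentiableAt (by simp)) (hf.mdifferentiableAt (by simp))
    (map_one f) v
  have h3 : (f ∘ fun h : G => g * h) = (fun h : G' => f g * h) ∘ f := by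
    ext h; simp
  rw [h3] at h1
  exact h1.symm.trans h2

/-- The derivative of a homomorphism of Lie groups is a homomorphism of Lie algebras. -/
theorem lieMap_bracket [I.Boundaryless] [I'.Boundaryless] [CompleteSpace E] [CompleteSpace E']
    (f : G →* G') (hf : ContMDiff I I' ∞ f) (v w : GroupLieAlgebra I G) :
    lieMap I I' f ⁅v, w⁆ = ⁅lieMap I I' f v, lieMap I I' f w⁆ := by
  have : LieGroup I (minSmoothness ℝ 3) G := LieGroup.of_le (n := ∞) (by simp; norm_cast)
  have : LieGroup I' (minSmoothness ℝ 3) G' := LieGroup.of_le (n := ∞) (by simp; norm_cast)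
  have h := VectorField.mfderiv_mlieBracket_of_related hf (x := (1 : G))
    (mdifferentiableAt_mulInvariantVectorField v) (mdifferentiableAt_mulInvariantVectorField w)
    (mdifferentiableAt_mulInvariantVectorField (lieMap I I' f v))
    (mdifferentiableAt_mulInvariantVectorField (lieMap I I' f w))
    (mfderiv_mulInvariantVectorField f hf v) (mfderiv_mulInvariantVectorField f hf w)
  have h1 : (VectorField.mlieBracket I' (mulInvariantVectorField (lieMap I I' f v))
      (mulInvariantVectorField (lieMap I I' f w)) (f 1) : E') =
      VectorField.mlieBracket I' (mulInvariantVectorField (lieMap I I' f v))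
      (mulInvariantVectorField (lieMap I I' f w)) 1 :=
    congrArg (fun g : G' => (VectorField.mlieBracket I' (mulInvariantVectorField (lieMap I I' f v))
      (mulInvariantVectorField (lieMap I I' f w)) g : E')) (map_one f)
  exact h.trans h1

theorem bracket_inl_add_inr [I.Boundaryless] [I'.Boundaryless] [CompleteSpace E] [CompleteSpace E']
    (ξ ξ' : GroupLieAlgebra I G) (η η' : GroupLieAlgebra I' G') :
    ⁅lieMap I (I.prod I') (MonoidHom.inl G G') ξ + lieMap I' (I.prod I') (MonoidHom.inr G G') η,
      lieMap I (I.prod I') (MonoidHom.inl G G') ξ' +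
        lieMap I' (I.prod I') (MonoidHom.inr G G') η'⁆ =
    lieMap I (I.prod I') (MonoidHom.inl G G') ⁅ξ, ξ'⁆ +
      lieMap I' (I.prod I') (MonoidHom.inr G G') ⁅η, η'⁆ := by
  apply lieAlgebra_prod_ext
  · rw [lieMap_bracket _ contMDiff_fst, lieMap_fst_inl_add_inr, lieMap_fst_inl_add_inr,
      lieMap_fst_inl_add_inr]
  · rw [lieMap_bracket _ contMDiff_snd, lieMap_snd_inl_add_inr, lieMap_snd_inl_add_inr,
      lieMap_snd_inl_add_inr]

/-- There are no mixed terms because the two factors of the product commute. This separates the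
condition on G from the one on H in the reduction. -/
theorem cartanTensor_sumTensor [I.Boundaryless] [I'.Boundaryless] [CompleteSpace E]
    [CompleteSpace E'] (s : TwoTensor I G) (s' : TwoTensor I' G')
    (α β γ : LieDual (I.prod I') (G × G')) :
    cartanTensor (sumTensor s s') α β γ =
      cartanTensor s (α.comp (lieMap I (I.prod I') (MonoidHom.inl G G')))
          (β.comp (lieMap I (I.prod I') (MonoidHom.inl G G')))
          (γ.comp (lieMap I (I.prod I') (MonoidHom.inl G G'))) +
        cartanTensor s' (α.comp (lieMap I' (I.prod I') (MonoidHom.inr G G')))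
          (β.comp (lieMap I' (I.prod I') (MonoidHom.inr G G')))
          (γ.comp (lieMap I' (I.prod I') (MonoidHom.inr G G'))) := by
  have h := bracket_inl_add_inr (I := I) (I' := I')
    (s (β.comp (lieMap I (I.prod I') (MonoidHom.inl G G'))))
    (s (γ.comp (lieMap I (I.prod I') (MonoidHom.inl G G'))))
    (s' (β.comp (lieMap I' (I.prod I') (MonoidHom.inr G G'))))
    (s' (γ.comp (lieMap I' (I.prod I') (MonoidHom.inr G G'))))
  have h2 := congrArg α h
  rw [map_add] at h2
  exact (congrArg (fun t : ℝ => (1 / 4) * t) h2).trans (mul_add _ _ _)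

end LieMap

/-! ### Bivector fields: brackets, related fields, descent -/

/-- Composition of functionals with a continuous linear map, as a linear map. -/
def precompLinear {E E' : Type*} [NormedAddCommGroup E] [NormedSpace ℝ E] [NormedAddCommGroup E']
    [NormedSpace ℝ E'] (D : E →L[ℝ] E') : (E' →L[ℝ] ℝ) →ₗ[ℝ] (E →L[ℝ] ℝ) where
  toFun α := α.comp D
  map_add' _ _ := ContinuousLinearMap.add_comp _ _ _
  map_smul' _ _ := ContinuousLinearMap.smul_comp _ _ _

/-- A bilinear form on covectors, composed with a linear map of covectors. -/
def transferForm {E E' : Type*} [NormedAddCommGroup E] [NormedSpace ℝ E] [NormedAddCommGroup E']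
    [NormedSpace ℝ E'] (B : (E →L[ℝ] ℝ) →ₗ[ℝ] (E →L[ℝ] ℝ) →ₗ[ℝ] ℝ)
    (L : (E' →L[ℝ] ℝ) →ₗ[ℝ] (E →L[ℝ] ℝ)) : (E' →L[ℝ] ℝ) →ₗ[ℝ] (E' →L[ℝ] ℝ) →ₗ[ℝ] ℝ :=
  B.compl₁₂ L L

section Bivector

variable {E : Type*} [NormedAddCommGroup E] [NormedSpace ℝ E] {X : Type*} [TopologicalSpace X]
  {I : ModelWithCorners ℝ E X} {M : Type*} [TopologicalSpace M] [ChartedSpace X M]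
  {E' : Type*} [NormedAddCommGroup E'] [NormedSpace ℝ E'] {X' : Type*} [TopologicalSpace X']
  {I' : ModelWithCorners ℝ E' X'} {M' : Type*} [TopologicalSpace M'] [ChartedSpace X' M']

open Filter Topology in
theorem mvfderiv_congr_of_eventuallyEq {f f' : M → ℝ} {x : M} (h : f =ᶠ[𝓝 x] f') :
    mvfderiv I f x = mvfderiv I f' x := by
  ext v
  exact DFunLike.congr_fun (h.mfderiv_eq (I := I) (I' := 𝓘(ℝ, ℝ))) v

theorem mvfderiv_comp_eq {φ : M → M'} {f : M' → ℝ} {x : M}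
    (hf : MDifferentiableAt I' 𝓘(ℝ, ℝ) f (φ x)) (hφ : MDifferentiableAt I I' φ x) :
    mvfderiv I (f ∘ φ) x = (mvfderiv I' f (φ x)).comp (mfderiv I I' φ x) :=
  mfderiv_comp x hf hφ

open Filter Topology in
theorem BivectorField.bracket_congr (π : BivectorField I M) {f f' g g' : M → ℝ} {x : M}
    (hf : f =ᶠ[𝓝 x] f') (hg : g =ᶠ[𝓝 x] g') : π.bracket f g x = π.bracket f' g' x := by
  rw [BivectorField.bracket, BivectorField.bracket, mvfderiv_congr_of_eventuallyEq hf,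
    mvfderiv_congr_of_eventuallyEq hg]

open Filter Topology in
theorem BivectorField.bracket_eventuallyEq (π : BivectorField I M) {f f' g g' : M → ℝ} {x : M}
    (hf : f =ᶠ[𝓝 x] f') (hg : g =ᶠ[𝓝 x] g') : π.bracket f g =ᶠ[𝓝 x] π.bracket f' g' := by
  filter_upwards [hf.eventuallyEq_nhds, hg.eventuallyEq_nhds] with y h1 h2
  exact π.bracket_congr h1 h2

open Filter Topology in
theorem schoutenBracket_congr (P : BivectorField I M) {f f' g g' h h' : M → ℝ} {x : M}
    (hf : f =ᶠ[𝓝 x] f') (hg : g =ᶠ[𝓝 x] g') (hh : h =ᶠ[𝓝 x] h') :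
    schoutenBracket P P f g h x = schoutenBracket P P f' g' h' x := by
  simp only [schoutenBracket]
  rw [P.bracket_congr hf (P.bracket_eventuallyEq hg hh),
    P.bracket_congr hg (P.bracket_eventuallyEq hh hf),
    P.bracket_congr hh (P.bracket_eventuallyEq hf hg)]

theorem BivectorField.contMDiff_bracket (π : BivectorField I M) {f g : M → ℝ}
    (hf : ContMDiff I 𝓘(ℝ, ℝ) ∞ f) (hg : ContMDiff I 𝓘(ℝ, ℝ) ∞ g) :
    ContMDiff I 𝓘(ℝ, ℝ) ∞ (π.bracket f g) :=
  π.smooth f g hf hg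

theorem BivectorRelated.bracket_comp {φ : M → M'} {π : BivectorField I M}
    {π' : BivectorField I' M'} (h : BivectorRelated φ π π') (hφ : ContMDiff I I' ∞ φ)
    {f g : M' → ℝ} (hf : ContMDiff I' 𝓘(ℝ, ℝ) ∞ f) (hg : ContMDiff I' 𝓘(ℝ, ℝ) ∞ g) :
    π.bracket (f ∘ φ) (g ∘ φ) = π'.bracket f g ∘ φ := by
  funext x
  rw [BivectorField.bracket, mvfderiv_comp_eq (hf.mdifferentiableAt (by simp))
    (hφ.mdifferentiableAt (by simp)), mvfderiv_comp_eq (hg.mdifferentiableAt (by simp))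
    (hφ.mdifferentiableAt (by simp))]
  exact (h x _ _).symm

/-- The inner bracket of pulled back functions is itself the pullback of a smooth function, so
`bracket_comp` applies a second time. -/
theorem BivectorRelated.schoutenBracket_comp {φ : M → M'} {π : BivectorField I M}
    {π' : BivectorField I' M'} (h : BivectorRelated φ π π') (hφ : ContMDiff I I' ∞ φ)
    {f g k : M' → ℝ} (hf : ContMDiff I' 𝓘(ℝ, ℝ) ∞ f) (hg : ContMDiff I' 𝓘(ℝ, ℝ) ∞ g)
    (hk : ContMDiff I' 𝓘(ℝ, ℝ) ∞ k) (x : M) :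
    schoutenBracket π π (f ∘ φ) (g ∘ φ) (k ∘ φ) x = schoutenBracket π' π' f g k (φ x) := by
  simp only [schoutenBracket]
  rw [h.bracket_comp hφ hf hg, h.bracket_comp hφ hg hk, h.bracket_comp hφ hk hf,
    h.bracket_comp hφ hf (π'.contMDiff_bracket hg hk),
    h.bracket_comp hφ hg (π'.contMDiff_bracket hk hf),
    h.bracket_comp hφ hk (π'.contMDiff_bracket hf hg)]
  rfl

open Filter Topology in
/-- A bivector field descends along a surjective submersion if it is constant along the fibres. -/
theorem BivectorField.exists_descent [I.Boundaryless] {q : M → M'} (hq : ContMDiff I I' ∞ q)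
    (hsec : ∀ x, ∃ (σ : M' → M) (U : Set M'), IsOpen U ∧ q x ∈ U ∧ ContMDiffOn I' I ∞ σ U ∧
      ∀ y ∈ U, q (σ y) = y) (hsurj : Function.Surjective q) (π : BivectorField I M)
    (hπ : ∀ x x', q x = q x' → ∀ α β : E' →L[ℝ] ℝ,
      π.toFun x (α.comp (mfderiv I I' q x : E →L[ℝ] E')) (β.comp (mfderiv I I' q x : E →L[ℝ] E')) =
      π.toFun x' (α.comp (mfderiv I I' q x' : E →L[ℝ] E'))
        (β.comp (mfderiv I I' q x' : E →L[ℝ] E'))) :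
    ∃ π' : BivectorField I' M', BivectorRelated q π π' := by
  let D : ∀ x, E →L[ℝ] E' := fun x => mfderiv I I' q x
  -- Any set-theoretic section will do, as `hπ` makes the value independent of the point in the
  -- fibre. Smoothness is checked afterwards with smooth local sections.
  let s : M' → M := Function.surjInv hsurj
  have hs : ∀ b, q (s b) = b := Function.surjInv_eq hsurj
  let T : ∀ b : M', CotangentSpace I' b →ₗ[ℝ] CotangentSpace I' b →ₗ[ℝ] ℝ := fun b =>
    transferForm (E := E) (E' := E') (π.toFun (s b))
      (precompLinear (E := E) (E' := E') (D (s b)))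
  have hT : ∀ (x : M) (α β : CotangentSpace I' (q x)), T (q x) α β =
      π.toFun x (α.comp (mfderiv I I' q x)) (β.comp (mfderiv I I' q x)) := fun x α β =>
    hπ (s (q x)) x (hs (q x)) α β
  refine ⟨⟨T, fun b α => π.alternating (s b) _, fun f g hf hg => ?_⟩, hT⟩
  have hcomp : ∀ x, T (q x) (mvfderiv I' f (q x)) (mvfderiv I' g (q x)) =
      π.bracket (f ∘ q) (g ∘ q) x := by
    intro x
    rw [hT, BivectorField.bracket, mvfderiv_comp_eq (hf.mdifferentiableAt (by simp))
      (hq.mdifferentiableAt (by simp)), mvfderiv_comp_eq (hg.mdifferentiableAt (by simp))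
      (hq.mdifferentiableAt (by simp))]
  intro b
  obtain ⟨x, rfl⟩ := hsurj b
  obtain ⟨σ, U, hU, hxU, hσ, hqσ⟩ := hsec x
  have h1 : ContMDiffOn I' 𝓘(ℝ, ℝ) ∞ (π.bracket (f ∘ q) (g ∘ q) ∘ σ) U :=
    (π.contMDiff_bracket (hf.comp hq) (hg.comp hq)).comp_contMDiffOn hσ
  refine (h1.contMDiffAt (hU.mem_nhds hxU)).congr_of_eventuallyEq ?_
  filter_upwards [hU.mem_nhds hxU] with y hy
  simp only [Function.comp_apply]
  rw [← hcomp, hqσ y hy]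

end Bivector

/-! ### Infinitesimal actions and equivariant maps -/

section Action

variable {E : Type*} [NormedAddCommGroup E] [NormedSpace ℝ E] {X : Type*} [TopologicalSpace X]
  {I : ModelWithCorners ℝ E X} {M : Type*} [TopologicalSpace M] [ChartedSpace X M]
  {E' : Type*} [NormedAddCommGroup E'] [NormedSpace ℝ E'] {X' : Type*} [TopologicalSpace X']
  {I' : ModelWithCorners ℝ E' X'} {M' : Type*} [TopologicalSpace M'] [ChartedSpace X' M']
  {EG : Type*} [NormedAddCommGroup EG] [NormedSpace ℝ EG] {XG : Type*} [TopologicalSpace XG]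
  {IG : ModelWithCorners ℝ EG XG} {G : Type*} [TopologicalSpace G] [ChartedSpace XG G] [Group G]
  {EH : Type*} [NormedAddCommGroup EH] [NormedSpace ℝ EH] {XH : Type*} [TopologicalSpace XH]
  {IH : ModelWithCorners ℝ EH XH} {H : Type*} [TopologicalSpace H] [ChartedSpace XH H] [Group H]

theorem contMDiff_smul_left [MulAction G M] [ContMDiffSMul IG I ∞ G M] (x : M) :
    ContMDiff IG I ∞ fun g : G => g • x :=
  (contMDiff_smul (I := IG) (I' := I) (n := ∞)).comp (contMDiff_id.prodMk contMDiff_const)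

theorem contMDiff_smul_right [MulAction G M] [ContMDiffSMul IG I ∞ G M] (g : G) :
    ContMDiff I I ∞ fun x : M => g • x :=
  (contMDiff_smul (I := IG) (I' := I) (n := ∞)).comp (contMDiff_const.prodMk contMDiff_id)

/-- An equivariant map intertwines the infinitesimal actions. -/
theorem mfderiv_infinitesimalAction [MulAction G M] [MulAction H M'] [ContMDiffSMul IG I ∞ G M]
    (f : H →* G) (hf : ContMDiff IH IG ∞ f) {φ : M → M'} (hφ : ContMDiff I I' ∞ φ)
    (hequiv : ∀ (h : H) (x : M), φ (f h • x) = h • φ x) (x : M) (η : GroupLieAlgebra IH H) :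
    mfderiv I I' φ x (infinitesimalAction I IG G x (lieMap IH IG f η)) =
      infinitesimalAction I' IH H (φ x) η := by
  have h1 := mfderiv_comp_apply_of_eq (I := IH) (I' := IG) (I'' := I) (f := f)
    (g := fun g : G => g • x) (x := (1 : H)) (y := (1 : G))
    ((contMDiff_smul_left x).mdifferentiableAt (by simp)) (hf.mdifferentiableAt (by simp))
    (map_one f) η
  have h2 := mfderiv_comp_apply_of_eq (I := IH) (I' := I) (I'' := I')
    (f := (fun g : G => g • x) ∘ f) (g := φ) (x := (1 : H)) (y := x)
    (hφ.mdifferentiableAt (by simp)) (((contMDiff_smul_left x).comp hf).mdifferentiableAt (by simp))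
    (by simp) η
  have h3 : φ ∘ ((fun g : G => g • x) ∘ f) = fun h : H => h • φ x := by
    funext h; exact hequiv h x
  rw [h3] at h2
  have h4 : (mfderiv IH I' (fun h : H => h • φ x) 1 η : E') =
      mfderiv I I' φ x (mfderiv IG I (fun g : G => g • x) 1 (lieMap IH IG f η) : E) :=
    h2.trans (congrArg (mfderiv I I' φ x) h1)
  refine (map_neg (mfderiv I I' φ x) _).trans ?_
  exact congrArg (fun v : E' => -v) h4.symm

/-- The infinitesimal action is tangent to the fibres of an invariant map. -/
theorem mfderiv_infinitesimalAction_eq_zero [MulAction G M] [ContMDiffSMul IG I ∞ G M]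
    (f : H →* G) (hf : ContMDiff IH IG ∞ f) {φ : M → M'} (hφ : ContMDiff I I' ∞ φ)
    (hinv : ∀ (h : H) (x : M), φ (f h • x) = φ x) (x : M) (η : GroupLieAlgebra IH H) :
    mfderiv I I' φ x (infinitesimalAction I IG G x (lieMap IH IG f η)) = 0 := by
  have h1 := mfderiv_comp_apply_of_eq (I := IH) (I' := IG) (I'' := I) (f := f)
    (g := fun g : G => g • x) (x := (1 : H)) (y := (1 : G))
    ((contMDiff_smul_left x).mdifferentiableAt (by simp)) (hf.mdifferentiableAt (by simp))
    (map_one f) η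
  have h2 := mfderiv_comp_apply_of_eq (I := IH) (I' := I) (I'' := I')
    (f := (fun g : G => g • x) ∘ f) (g := φ) (x := (1 : H)) (y := x)
    (hφ.mdifferentiableAt (by simp)) (((contMDiff_smul_left x).comp hf).mdifferentiableAt (by simp))
    (by simp) η
  have h3 : φ ∘ ((fun g : G => g • x) ∘ f) = fun _ : H => φ x := by
    funext h; exact hinv h x
  rw [h3, mfderiv_const] at h2
  have h4 : (0 : E') =
      mfderiv I I' φ x (mfderiv IG I (fun g : G => g • x) 1 (lieMap IH IG f η) : E) :=
    h2.trans (congrArg (mfderiv I I' φ x) h1)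
  refine (map_neg (mfderiv I I' φ x) _).trans ?_
  exact (congrArg (fun v : E' => -v) h4.symm).trans neg_zero

end Action

section Related

variable {E : Type*} [NormedAddCommGroup E] [NormedSpace ℝ E] {X : Type*} [TopologicalSpace X]
  {I : ModelWithCorners ℝ E X} {M : Type*} [TopologicalSpace M] [ChartedSpace X M]
  {E' : Type*} [NormedAddCommGroup E'] [NormedSpace ℝ E'] {X' : Type*} [TopologicalSpace X']
  {I' : ModelWithCorners ℝ E' X'} {M' : Type*} [TopologicalSpace M'] [ChartedSpace X' M']

theorem BivectorField.toFun_congr (π : BivectorField I M) {x y : M} (h : x = y)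
    (α β : E →L[ℝ] ℝ) : π.toFun x α β = π.toFun y α β := by
  subst h; rfl

/-- The chain rule for the two sides of q ∘ ψ = ψ' ∘ q. Covectors are taken on the model space, so
that nothing has to be transported along q (ψ x) = ψ' (q x). -/
theorem comp_mfderiv_comp_eq {ψ : M → M} {ψ' : M' → M'} {q : M → M'}
    (hψ : ContMDiff I I ∞ ψ) (hψ' : ContMDiff I' I' ∞ ψ') (hq : ContMDiff I I' ∞ q)
    (h : ∀ x, q (ψ x) = ψ' (q x)) (x : M) (α : E' →L[ℝ] ℝ) :
    (α.comp (mfderiv I I' q (ψ x) : E →L[ℝ] E')).comp (mfderiv I I ψ x : E →L[ℝ] E) =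
      (α.comp (mfderiv I' I' ψ' (q x) : E' →L[ℝ] E')).comp (mfderiv I I' q x : E →L[ℝ] E') := by
  have h1 : (mfderiv I I' (q ∘ ψ) x : E →L[ℝ] E') = _ := mfderiv_comp x
    (hq.mdifferentiableAt (by simp)) (hψ.mdifferentiableAt (by simp))
  have h2 : (mfderiv I I' (ψ' ∘ q) x : E →L[ℝ] E') = _ := mfderiv_comp x
    (hψ'.mdifferentiableAt (by simp)) (hq.mdifferentiableAt (by simp))
  have h3 : q ∘ ψ = ψ' ∘ q := funext h
  rw [h3] at h1
  exact congrArg (fun D : E →L[ℝ] E' => α.comp D) (h1.symm.trans h2)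

theorem BivectorRelated.of_semiconj {ψ : M → M} {ψ' : M' → M'} {q : M → M'}
    {π : BivectorField I M} {π' : BivectorField I' M'} (hπ : BivectorRelated ψ π π)
    (hqπ : BivectorRelated q π π') (hψ : ContMDiff I I ∞ ψ) (hψ' : ContMDiff I' I' ∞ ψ')
    (hq : ContMDiff I I' ∞ q) (h : ∀ x, q (ψ x) = ψ' (q x)) (hsurj : Function.Surjective q) :
    BivectorRelated ψ' π' π' := by
  intro b
  obtain ⟨x, rfl⟩ := hsurj b
  intro α β
  refine (π'.toFun_congr (h x) α β).symm.trans ((hqπ (ψ x) α β).trans ?_)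
  refine (hπ x _ _).trans (Eq.trans ?_ (hqπ x _ _).symm)
  exact congrArg₂ (fun a b : E →L[ℝ] ℝ => π.toFun x a b)
    (comp_mfderiv_comp_eq hψ hψ' hq h x α) (comp_mfderiv_comp_eq hψ hψ' hq h x β)

/-- Applied to elements of C, this makes π constant along the fibres of the quotient map on pulled
back covectors, as descent requires. -/
theorem BivectorField.toFun_comp_eq_of_invariant {ψ : M → M} {q : M → M'}
    {π : BivectorField I M} (hπ : BivectorRelated ψ π π) (hψ : ContMDiff I I ∞ ψ)
    (hq : ContMDiff I I' ∞ q) (h : ∀ x, q (ψ x) = q x) (x : M) (α β : E' →L[ℝ] ℝ) :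
    π.toFun (ψ x) (α.comp (mfderiv I I' q (ψ x) : E →L[ℝ] E'))
        (β.comp (mfderiv I I' q (ψ x) : E →L[ℝ] E')) =
      π.toFun x (α.comp (mfderiv I I' q x : E →L[ℝ] E'))
        (β.comp (mfderiv I I' q x : E →L[ℝ] E')) := by
  have key : ∀ α : E' →L[ℝ] ℝ, (α.comp (mfderiv I I' q (ψ x) : E →L[ℝ] E')).comp
      (mfderiv I I ψ x : E →L[ℝ] E) = α.comp (mfderiv I I' q x : E →L[ℝ] E') := by
    intro α
    refine (comp_mfderiv_comp_eq hψ contMDiff_id hq h x α).trans ?_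
    exact congrArg (fun D : E' →L[ℝ] E' => (α.comp D).comp (mfderiv I I' q x : E →L[ℝ] E'))
      (mfderiv_id (I := I') (x := q x))
  refine (hπ x _ _).trans ?_
  exact congrArg₂ (fun a b : E →L[ℝ] ℝ => π.toFun x a b) (key α) (key β)

variable {EG : Type*} [NormedAddCommGroup EG] [NormedSpace ℝ EG] {XG : Type*} [TopologicalSpace XG]
  {IG : ModelWithCorners ℝ EG XG} {G : Type*} [TopologicalSpace G] [ChartedSpace XG G] [Group G]
  {EH : Type*} [NormedAddCommGroup EH] [NormedSpace ℝ EH] {XH : Type*} [TopologicalSpace XH]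
  {IH : ModelWithCorners ℝ EH XH} {H : Type*} [TopologicalSpace H] [ChartedSpace XH H] [Group H]

open Filter Topology in
/-- A group action which descends along a surjective submersion is smooth. -/
theorem ContMDiffSMul.of_surjective [MulAction G M] [MulAction H M'] [ContMDiffSMul IG I ∞ G M]
    (f : H →* G) (hf : ContMDiff IH IG ∞ f) {q : M → M'} (hq : ContMDiff I I' ∞ q)
    (hsec : ∀ x, ∃ (σ : M' → M) (U : Set M'), IsOpen U ∧ q x ∈ U ∧ ContMDiffOn I' I ∞ σ U ∧
      ∀ y ∈ U, q (σ y) = y) (hsurj : Function.Surjective q)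
    (hequiv : ∀ (h : H) (x : M), q (f h • x) = h • q x) : ContMDiffSMul IH I' ∞ H M' where
  contMDiff_smul := by
    rintro ⟨h, b⟩
    obtain ⟨x, rfl⟩ := hsurj b
    obtain ⟨σ, U, hU, hxU, hσ, hqσ⟩ := hsec x
    have hU' : IsOpen ((Prod.snd : H × M' → M') ⁻¹' U) := hU.preimage continuous_snd
    have h1 : ContMDiffOn (IH.prod I') I' ∞ (fun p : H × M' => q (f p.1 • σ p.2))
        (Prod.snd ⁻¹' U) := by
      refine hq.comp_contMDiffOn ?_
      refine (contMDiff_smul (I := IG) (I' := I) (n := ∞)).comp_contMDiffOn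
        (f := fun p : H × M' => (f p.1, σ p.2)) ?_
      exact (hf.comp contMDiff_fst).contMDiffOn.prodMk
        (hσ.comp contMDiff_snd.contMDiffOn fun p hp => hp)
    refine (h1.contMDiffAt (hU'.mem_nhds hxU)).congr_of_eventuallyEq ?_
    filter_upwards [hU'.mem_nhds hxU] with p hp
    rw [hequiv, hqσ p.2 hp]

end Related

section Groups

variable {E : Type*} [NormedAddCommGroup E] [NormedSpace ℝ E] {X : Type*} [TopologicalSpace X]
  {I : ModelWithCorners ℝ E X} {G : Type*} [TopologicalSpace G] [ChartedSpace X G] [Group G]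
  {E' : Type*} [NormedAddCommGroup E'] [NormedSpace ℝ E'] {X' : Type*} [TopologicalSpace X']
  {I' : ModelWithCorners ℝ E' X'} {G' : Type*} [TopologicalSpace G'] [ChartedSpace X' G']
  [Group G']

theorem contMDiff_inl : ContMDiff I (I.prod I') ∞ (MonoidHom.inl G G') :=
  contMDiff_id.prodMk contMDiff_const

theorem contMDiff_inr : ContMDiff I' (I.prod I') ∞ (MonoidHom.inr G G') :=
  contMDiff_const.prodMk contMDiff_id

theorem cartanTensor_congr (s : TwoTensor I G) {α α' β β' γ γ' : LieDual I G} (hα : α = α')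
    (hβ : β = β') (hγ : γ = γ') : cartanTensor s α β γ = cartanTensor s α' β' γ' := by
  rw [hα, hβ, hγ]

end Groups

/-! ### Reduction by a reducing subgroup -/

section Reduction

variable {EG : Type*} [NormedAddCommGroup EG] [NormedSpace ℝ EG]
    {G : Type*} [TopologicalSpace G] [ChartedSpace EG G] [Group G]
    {EH : Type*} [NormedAddCommGroup EH] [NormedSpace ℝ EH]
    {H : Type*} [TopologicalSpace H] [ChartedSpace EH H] [Group H]
    {EC : Type*} [NormedAddCommGroup EC] [NormedSpace ℝ EC]
    {C : Type*} [TopologicalSpace C] [ChartedSpace EC C] [Group C]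
    {EM : Type*} [NormedAddCommGroup EM] [NormedSpace ℝ EM]
    {M : Type uM} [TopologicalSpace M] [ChartedSpace EM M]
    [MulAction (G × H) M]
    {sG : TwoTensor 𝓘(ℝ, EG) G} {sH : TwoTensor 𝓘(ℝ, EH) H}
    {π : BivectorField 𝓘(ℝ, EM) M}
    {ι : C →* G}
    {EB : Type*} [NormedAddCommGroup EB] [NormedSpace ℝ EB]
    {B : Type*} [TopologicalSpace B] [ChartedSpace EB B] {q : M → B}

/-- As q is constant on C-orbits, dq kills ρ(𝔠). This is where ann 𝔠, and with it the reducing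
condition and ĉ, enters. -/
theorem mfderiv_comp_infinitesimalAction_mem_lieAnnihilator
    [ContMDiffSMul (𝓘(ℝ, EG).prod 𝓘(ℝ, EH)) 𝓘(ℝ, EM) ∞ (G × H) M]
    (hι : ContMDiff 𝓘(ℝ, EC) 𝓘(ℝ, EG) ∞ ι) (hq : ContMDiff 𝓘(ℝ, EM) 𝓘(ℝ, EB) ∞ q)
    (hinv : ∀ (c : C) (x : M), q ((ι c, (1 : H)) • x) = q x) (x : M) (α : EB →L[ℝ] ℝ) :
    (((α.comp (mfderiv 𝓘(ℝ, EM) 𝓘(ℝ, EB) q x : EM →L[ℝ] EB)).comp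
      (infinitesimalAction 𝓘(ℝ, EM) (𝓘(ℝ, EG).prod 𝓘(ℝ, EH)) (G × H) x)).comp
      (lieMap 𝓘(ℝ, EG) (𝓘(ℝ, EG).prod 𝓘(ℝ, EH)) (MonoidHom.inl G H)) : LieDual 𝓘(ℝ, EG) G) ∈
      lieAnnihilator (subgroupLieAlgebra 𝓘(ℝ, EC) 𝓘(ℝ, EG) ι) := by
  rintro _ ⟨ξ, rfl⟩
  have h := mfderiv_infinitesimalAction_eq_zero (IG := 𝓘(ℝ, EG).prod 𝓘(ℝ, EH))
    ((MonoidHom.inl G H).comp ι) (contMDiff_inl.comp hι) hq hinv x ξ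
  rw [lieMap_comp contMDiff_inl hι] at h
  exact (congrArg α h).trans (map_zero α)

variable [MulAction H B]

theorem mfderiv_comp_infinitesimalAction_inr
    [ContMDiffSMul (𝓘(ℝ, EG).prod 𝓘(ℝ, EH)) 𝓘(ℝ, EM) ∞ (G × H) M]
    (hq : ContMDiff 𝓘(ℝ, EM) 𝓘(ℝ, EB) ∞ q)
    (hequiv : ∀ (h : H) (x : M), q (((1 : G), h) • x) = h • q x) (x : M) (α : EB →L[ℝ] ℝ) :
    ((α.comp (mfderiv 𝓘(ℝ, EM) 𝓘(ℝ, EB) q x : EM →L[ℝ] EB)).comp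
      (infinitesimalAction 𝓘(ℝ, EM) (𝓘(ℝ, EG).prod 𝓘(ℝ, EH)) (G × H) x)).comp
      (lieMap 𝓘(ℝ, EH) (𝓘(ℝ, EG).prod 𝓘(ℝ, EH)) (MonoidHom.inr G H)) =
      (α.comp (infinitesimalAction 𝓘(ℝ, EB) 𝓘(ℝ, EH) H (q x)) : LieDual 𝓘(ℝ, EH) H) := by
  ext η
  exact congrArg α (mfderiv_infinitesimalAction (IG := 𝓘(ℝ, EG).prod 𝓘(ℝ, EH))
    (MonoidHom.inr G H) contMDiff_inr hq hequiv x η)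

variable [FiniteDimensional ℝ EG] [LieGroup 𝓘(ℝ, EG) ∞ G] [FiniteDimensional ℝ EH]
  [LieGroup 𝓘(ℝ, EH) ∞ H]

/-- Reduction of a quasi-Poisson manifold by a reducing subgroup. -/
theorem IsQuasiPoisson.exists_reduction (hπ : IsQuasiPoisson (sumTensor sG sH) π)
    (hι : ContMDiff 𝓘(ℝ, EC) 𝓘(ℝ, EG) ∞ ι) (hC : IsReducing 𝓘(ℝ, EC) sG ι)
    (hq : ContMDiff 𝓘(ℝ, EM) 𝓘(ℝ, EB) ∞ q)
    (hsec : ∀ x, ∃ (σ : B → M) (U : Set B), IsOpen U ∧ q x ∈ U ∧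
      ContMDiffOn 𝓘(ℝ, EB) 𝓘(ℝ, EM) ∞ σ U ∧ ∀ y ∈ U, q (σ y) = y)
    (hsurj : Function.Surjective q)
    (hinv : ∀ (c : C) (x : M), q ((ι c, (1 : H)) • x) = q x)
    (horb : ∀ x x' : M, q x = q x' → ∃ c : C, x' = (ι c, (1 : H)) • x)
    (hequiv : ∀ (h : H) (x : M), q (((1 : G), h) • x) = h • q x) :
    ∃ πB : BivectorField 𝓘(ℝ, EB) B, BivectorRelated q π πB ∧ IsQuasiPoisson sH πB := by
  have := hπ.smooth_action
  have hsm : ContMDiffSMul 𝓘(ℝ, EH) 𝓘(ℝ, EB) ∞ H B :=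
    ContMDiffSMul.of_surjective (IG := 𝓘(ℝ, EG).prod 𝓘(ℝ, EH)) (MonoidHom.inr G H) contMDiff_inr
      hq hsec hsurj hequiv
  obtain ⟨πB, hrel⟩ := BivectorField.exists_descent hq hsec hsurj π (by
    intro x x' h α β
    obtain ⟨c, rfl⟩ := horb x x' h
    exact (BivectorField.toFun_comp_eq_of_invariant (hπ.invariant (ι c, 1))
      (contMDiff_smul_right (IG := 𝓘(ℝ, EG).prod 𝓘(ℝ, EH)) _) hq (hinv c) x α β).symm)
  refine ⟨πB, hrel, hsm, fun h => ?_, fun f g k hf hg hk b => ?_⟩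
  · exact (hπ.invariant (1, h)).of_semiconj hrel
      (contMDiff_smul_right (IG := 𝓘(ℝ, EG).prod 𝓘(ℝ, EH)) _)
      (contMDiff_smul_right (IG := 𝓘(ℝ, EH)) _) hq (hequiv h) hsurj
  · obtain ⟨x, rfl⟩ := hsurj b
    rw [← hrel.schoutenBracket_comp hq hf hg hk, hπ.schouten _ _ _ (hf.comp hq) (hg.comp hq)
      (hk.comp hq), cartanTensor_sumTensor]
    have hd : ∀ {f : B → ℝ}, ContMDiff 𝓘(ℝ, EB) 𝓘(ℝ, ℝ) ∞ f →
        mvfderiv 𝓘(ℝ, EM) (f ∘ q) x = (mvfderiv 𝓘(ℝ, EB) f (q x)).comp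
          (mfderiv 𝓘(ℝ, EM) 𝓘(ℝ, EB) q x) := fun hf =>
      mvfderiv_comp_eq (hf.mdifferentiableAt (by simp)) (hq.mdifferentiableAt (by simp))
    rw [hd hf, hd hg, hd hk]
    -- The 𝔤-summand vanishes because C is reducing and all three functionals lie in ann 𝔠; the
    -- 𝔥-summand is the trivector of the quotient, by equivariance of q.
    refine (congrArg₂ (fun a b : ℝ => a + b) (hC _ ?_ _ ?_ _ ?_) ?_).trans (zero_add _)
    · exact mfderiv_comp_infinitesimalAction_mem_lieAnnihilator hι hq hinv x _
    · exact mfderiv_comp_infinitesimalAction_mem_lieAnnihilator hι hq hinv x _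
    · exact mfderiv_comp_infinitesimalAction_mem_lieAnnihilator hι hq hinv x _
    · have key := fun f : B → ℝ =>
        mfderiv_comp_infinitesimalAction_inr (EG := EG) (EH := EH) hq hequiv x (mvfderiv 𝓘(ℝ, EB) f (q x))
      exact cartanTensor_congr sH (key f) (key g) (key k)

end Reduction

section ReducedSpace

variable {C G : Type*} [Group C] [Group G] {ι : C →* G} {H : Type*} [Group H]
  {M : Type*} [MulAction (G × H) M]

theorem ReducedSpace.mk_surjective : Function.Surjective (ReducedSpace.mk ι H : M → _) :=
  Quotient.mk_surjective

theorem ReducedSpace.mk_eq_iff {x x' : M} :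
    ReducedSpace.mk ι H x = ReducedSpace.mk ι H x' ↔ ∃ c : C, x' = (ι c, (1 : H)) • x := by
  refine Quotient.eq.trans ?_
  constructor
  · rintro ⟨⟨_, c, rfl⟩, h⟩
    refine ⟨c⁻¹, ?_⟩
    change (ι c, (1 : H)) • x' = x at h
    rw [← h, smul_smul, Prod.mk_mul_mk, ← map_mul, inv_mul_cancel, map_one, mul_one]
    exact (one_smul (G × H) x').symm
  · rintro ⟨c, rfl⟩
    refine ⟨⟨_, c⁻¹, rfl⟩, ?_⟩
    change (ι c⁻¹, (1 : H)) • (ι c, (1 : H)) • x = x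
    rw [smul_smul, Prod.mk_mul_mk, ← map_mul, inv_mul_cancel, map_one, mul_one]
    exact one_smul (G × H) x

theorem ReducedSpace.mk_smul_subgroup (c : C) (x : M) :
    ReducedSpace.mk ι H ((ι c, (1 : H)) • x) = ReducedSpace.mk ι H x :=
  (ReducedSpace.mk_eq_iff.2 ⟨c, rfl⟩).symm

theorem ReducedSpace.mk_smul (h : H) (x : M) :
    ReducedSpace.mk ι H (((1 : G), h) • x) = h • ReducedSpace.mk ι H x :=
  rfl

end ReducedSpace

/-! ### Tangent spaces of submanifolds and clean intersections -/

section Tangent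

variable {E : Type*} [NormedAddCommGroup E] [NormedSpace ℝ E] {X : Type*} [TopologicalSpace X]
  {I : ModelWithCorners ℝ E X} {M : Type*} [TopologicalSpace M] [ChartedSpace X M]
  {E' : Type*} [NormedAddCommGroup E'] [NormedSpace ℝ E'] {X' : Type*} [TopologicalSpace X']
  {I' : ModelWithCorners ℝ E' X'} {N : Type*} [TopologicalSpace N] [ChartedSpace X' N]

/-- The velocity of the image of a curve. -/
theorem mfderiv_comp_curve {φ : M → N} (hφ : ContMDiff I I' ∞ φ) {γ : ℝ → M}
    (hγ : ContMDiff 𝓘(ℝ, ℝ) I ∞ γ) {x : M} (hx : γ 0 = x) :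
    (mfderiv 𝓘(ℝ, ℝ) I' (φ ∘ γ) 0 (1 : ℝ) : E') =
      (mfderiv I I' φ x : E →L[ℝ] E') (mfderiv 𝓘(ℝ, ℝ) I γ 0 (1 : ℝ) : E) :=
  mfderiv_comp_apply_of_eq (I := 𝓘(ℝ, ℝ)) (I' := I) (I'' := I') (f := γ) (g := φ) (x := (0 : ℝ))
    (y := x) (hφ.mdifferentiableAt (by simp)) (hγ.mdifferentiableAt (by simp)) hx (1 : ℝ)

theorem mem_tangentSet_of_mapsTo {φ : M → N} (hφ : ContMDiff I I' ∞ φ) {S : Set M} {T : Set N}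
    (h : MapsTo φ S T) {x : M} {v : TangentSpace I x} (hv : v ∈ tangentSet I S x) :
    mfderiv I I' φ x v ∈ tangentSet I' T (φ x) := by
  obtain ⟨γ, hγ, h0, hS, h1⟩ := hv
  exact ⟨φ ∘ γ, hφ.comp hγ, congrArg φ h0, fun t => h (hS t),
    (mfderiv_comp_curve hφ hγ h0).trans (congrArg (mfderiv I I' φ x : E →L[ℝ] E') h1)⟩

theorem mem_tangentSet_univ [IsManifold I ∞ M] [I.Boundaryless] (x : M) (v : TangentSpace I x) :
    v ∈ tangentSet I univ x := by
  obtain ⟨γ, hγ, h0, h1⟩ := exists_contMDiff_curve x v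
  exact ⟨γ, hγ, h0, fun _ => mem_univ _, h1⟩

/-- The tangent spaces of a weakly embedded submanifold. -/
theorem IsWeakEmbedding.tangentSet_range [IsManifold I ∞ M] [I.Boundaryless] {j : M → N}
    (hj : IsWeakEmbedding I' I j) (a : M) :
    tangentSet I' (range j) (j a) = range (mfderiv I I' j a) := by
  ext v
  constructor
  · rintro ⟨γ, hγ, h0, hS, h1⟩
    choose δ hδ using hS
    have hjδ : j ∘ δ = γ := funext hδ
    -- For a mere injective immersion the lifted curve might be discontinuous; the lifting property
    -- of weak embeddings makes it smooth.
    have hsm : ContMDiff 𝓘(ℝ, ℝ) I ∞ δ := by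
      rw [← contMDiffOn_univ]
      refine contMDiffOn_lift_of_euclidean hj.lift isOpen_univ ?_
      rw [hjδ]
      exact hγ.contMDiffOn
    have hδ0 : δ 0 = a := hj.injective (by rw [hδ, h0])
    refine ⟨(mfderiv 𝓘(ℝ, ℝ) I δ 0 (1 : ℝ) : E), ?_⟩
    subst hjδ
    exact (mfderiv_comp_curve hj.immersion.contMDiff hsm hδ0).symm.trans h1
  · rintro ⟨w, rfl⟩
    exact mem_tangentSet_of_mapsTo hj.immersion.contMDiff (fun x _ => mem_range_self x)
      (mem_tangentSet_univ a w)

theorem mem_tangentSet_prod {S : Set M} {T : Set N} {x : M} {y : N} {v : E} {w : E'}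
    (hv : v ∈ (tangentSet I S x : Set E)) (hw : w ∈ (tangentSet I' T y : Set E')) :
    ((v, w) : E × E') ∈ (tangentSet (I.prod I') (S ×ˢ T) (x, y) : Set (E × E')) := by
  obtain ⟨γ, hγ, h0, hS, h1⟩ := hv
  obtain ⟨δ, hδ, h0', hT, h1'⟩ := hw
  refine ⟨fun t => (γ t, δ t), hγ.prodMk hδ, Prod.ext h0 h0', fun t => ⟨hS t, hT t⟩, ?_⟩
  have := mfderiv_prodMk (I := 𝓘(ℝ, ℝ)) (I' := I) (I'' := I') (x := (0 : ℝ))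
    (hγ.mdifferentiableAt (by simp)) (hδ.mdifferentiableAt (by simp))
  refine (DFunLike.congr_fun this (1 : ℝ)).trans ?_
  exact Prod.ext h1 h1'

end Tangent

universe uG

/-- If the graph of `μ` and `K × M` intersect cleanly, the preimage of `K` under `μ` is a
submanifold with tangent spaces the preimages of those of `K`. -/
theorem IntersectCleanly.exists_weakEmbedding
    {EG : Type*} [NormedAddCommGroup EG] [NormedSpace ℝ EG] [FiniteDimensional ℝ EG]
    {G : Type uG} [TopologicalSpace G] [ChartedSpace EG G] [IsManifold 𝓘(ℝ, EG) ∞ G]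
    {EM : Type*} [NormedAddCommGroup EM] [NormedSpace ℝ EM] [FiniteDimensional ℝ EM]
    {M : Type uM} [TopologicalSpace M] [ChartedSpace EM M] [IsManifold 𝓘(ℝ, EM) ∞ M]
    {μ : M → G} (hμ : ContMDiff 𝓘(ℝ, EM) 𝓘(ℝ, EG) ∞ μ) {K : Set G}
    (h : IntersectCleanly (𝓘(ℝ, EG).prod 𝓘(ℝ, EM)) {p : G × M | p.1 = μ p.2}
      {p : G × M | p.1 ∈ K}) :
    ∃ (k : ℕ) (A : Type (max uG uM)) (_ : TopologicalSpace A)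
      (_ : ChartedSpace (EuclideanSpace ℝ (Fin k)) A) (i : A → M),
      IsManifold (𝓡 k) ∞ A ∧ T2Space A ∧ SecondCountableTopology A ∧
      IsWeakEmbedding 𝓘(ℝ, EM) (𝓡 k) i ∧ range i = μ ⁻¹' K ∧
      ∀ (a : A) (v : EM), mfderiv 𝓘(ℝ, EM) 𝓘(ℝ, EG) μ (i a) v ∈
        tangentSet 𝓘(ℝ, EG) K (μ (i a)) → v ∈ range (mfderiv (𝓡 k) 𝓘(ℝ, EM) i a) := by
  obtain ⟨k, A, _, _, j, hA, hT2, hSC, hj, hrange⟩ := h.isSubmanifold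
  let Φ : M → G × M := fun x => (μ x, x)
  have hΦ : ContMDiff 𝓘(ℝ, EM) (𝓘(ℝ, EG).prod 𝓘(ℝ, EM)) ∞ Φ := hμ.prodMk contMDiff_id
  -- The intersection is the graph of μ over μ⁻¹(K), so its second projection is injective with
  -- image μ⁻¹(K), and Φ recovers j from i.
  let i : A → M := fun a => (j a).2
  have hi : ContMDiff (𝓡 k) 𝓘(ℝ, EM) ∞ i := contMDiff_snd.comp hj.immersion.contMDiff
  have hmem : ∀ a, (j a).1 = μ (j a).2 ∧ (j a).1 ∈ K := fun a => by
    have : j a ∈ range j := mem_range_self a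
    rwa [hrange] at this
  have hji : j = Φ ∘ i := funext fun a => Prod.ext (hmem a).1 rfl
  have hwe : IsWeakEmbedding 𝓘(ℝ, EM) (𝓡 k) i := by
    refine ⟨fun a b hab => hj.injective ?_, ?_, fun n U f hU hf => ?_⟩
    · rw [hji]; exact congrArg Φ hab
    · refine Manifold.isImmersion_of_mfderiv_injective hi fun a v w hvw => ?_
      have hinj := (hj.immersion.isImmersionAt a).mfderiv_injective
      apply hinj
      rw [hji]
      have hc : ∀ v : EuclideanSpace ℝ (Fin k), (mfderiv (𝓡 k) (𝓘(ℝ, EG).prod 𝓘(ℝ, EM)) (Φ ∘ i) a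
          v : EG × EM) = _ := fun v => mfderiv_comp_apply (I := 𝓡 k) (I' := 𝓘(ℝ, EM))
        (I'' := 𝓘(ℝ, EG).prod 𝓘(ℝ, EM)) a
        (hΦ.mdifferentiableAt (by simp)) (hi.mdifferentiableAt (by simp)) v
      refine (hc v).trans (Eq.trans ?_ (hc w).symm)
      exact congrArg _ hvw
    · refine hj.lift n U f hU ?_
      have : j ∘ f = Φ ∘ (i ∘ f) := by rw [hji]; rfl
      rw [this]
      exact hΦ.comp_contMDiffOn hf
  have hri : range i = μ ⁻¹' K := by
    ext x
    constructor
    · rintro ⟨a, rfl⟩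
      change μ (j a).2 ∈ K
      rw [← (hmem a).1]
      exact (hmem a).2
    · intro hx
      have : Φ x ∈ range j := by rw [hrange]; exact ⟨rfl, hx⟩
      obtain ⟨a, ha⟩ := this
      exact ⟨a, congrArg Prod.snd ha⟩
  refine ⟨k, A, _, _, i, hA, hT2, hSC, hwe, hri, fun a v hv => ?_⟩
  have hdΦ : mfderiv 𝓘(ℝ, EM) (𝓘(ℝ, EG).prod 𝓘(ℝ, EM)) Φ (i a) v =
      ((mfderiv 𝓘(ℝ, EM) 𝓘(ℝ, EG) μ (i a) v, v) : EG × EM) := by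
    have := mfderiv_prodMk (I := 𝓘(ℝ, EM)) (I' := 𝓘(ℝ, EG)) (I'' := 𝓘(ℝ, EM)) (x := i a)
      (f := μ) (g := id) (hμ.mdifferentiableAt (by simp)) mdifferentiableAt_id
    refine (DFunLike.congr_fun this v).trans ?_
    exact Prod.ext rfl (DFunLike.congr_fun (mfderiv_id (I := 𝓘(ℝ, EM)) (x := i a)) v)
  have h1 : mfderiv 𝓘(ℝ, EM) (𝓘(ℝ, EG).prod 𝓘(ℝ, EM)) Φ (i a) v ∈
      tangentSet (𝓘(ℝ, EG).prod 𝓘(ℝ, EM)) {p : G × M | p.1 = μ p.2} (Φ (i a)) :=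
    mem_tangentSet_of_mapsTo hΦ (fun _ _ => rfl) (mem_tangentSet_univ (i a) v)
  have h2 : mfderiv 𝓘(ℝ, EM) (𝓘(ℝ, EG).prod 𝓘(ℝ, EM)) Φ (i a) v ∈
      tangentSet (𝓘(ℝ, EG).prod 𝓘(ℝ, EM)) {p : G × M | p.1 ∈ K} (Φ (i a)) := by
    have := mem_tangentSet_prod (I := 𝓘(ℝ, EG)) (I' := 𝓘(ℝ, EM)) (E := EG) (E' := EM)
      (v := mfderiv 𝓘(ℝ, EM) 𝓘(ℝ, EG) μ (i a) v) (w := v) hv (mem_tangentSet_univ (I := 𝓘(ℝ, EM)) (i a) v)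
    have hset : K ×ˢ (univ : Set M) = {p : G × M | p.1 ∈ K} := by ext p; simp
    rw [hset] at this
    exact hdΦ ▸ this
  have hmemK : μ (i a) ∈ K := by
    have : i a ∈ range i := mem_range_self a
    rwa [hri] at this
  have h3 : mfderiv 𝓘(ℝ, EM) (𝓘(ℝ, EG).prod 𝓘(ℝ, EM)) Φ (i a) v ∈
      tangentSet (𝓘(ℝ, EG).prod 𝓘(ℝ, EM)) ({p : G × M | p.1 = μ p.2} ∩ {p : G × M | p.1 ∈ K})
        (Φ (i a)) := by
    -- The vector (dμ v, v) is tangent to the graph and to K × M, hence, by cleanness, to the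
    -- intersection; projecting to M gives v back.
    rw [h.tangent _ ⟨rfl, hmemK⟩]
    exact ⟨h1, h2⟩
  have h4 := mem_tangentSet_of_mapsTo (contMDiff_snd (I := 𝓘(ℝ, EG)) (J := 𝓘(ℝ, EM)))
    (T := range i) (fun p hp => by
      rw [hri]
      change μ p.2 ∈ K
      rw [← (show p.1 = μ p.2 from hp.1)]
      exact hp.2) h3
  rw [← hwe.tangentSet_range a]
  have h5 : mfderiv (𝓘(ℝ, EG).prod 𝓘(ℝ, EM)) 𝓘(ℝ, EM) Prod.snd (Φ (i a))
      (mfderiv 𝓘(ℝ, EM) (𝓘(ℝ, EG).prod 𝓘(ℝ, EM)) Φ (i a) v) = (v : EM) := by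
    refine (DFunLike.congr_fun (mfderiv_snd (I := 𝓘(ℝ, EG)) (I' := 𝓘(ℝ, EM)) (x := Φ (i a)))
      _).trans ?_
    exact congrArg Prod.snd hdΦ
  exact h5 ▸ h4

/-! ### Quotients of saturated submanifolds -/

/-- J carries ker L isomorphically onto ker D, which lies in the range of J, so dim ker L = dim E -
dim E'. With L the derivative of s ∘ p, this gives its constant rank. -/
theorem finrank_ker_add_finrank_of_comp_eq {E₀ E E' : Type*}
    [NormedAddCommGroup E₀] [NormedSpace ℝ E₀] [FiniteDimensional ℝ E₀]
    [NormedAddCommGroup E] [NormedSpace ℝ E]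
    [FiniteDimensional ℝ E] [NormedAddCommGroup E'] [NormedSpace ℝ E']
    (L : E₀ →L[ℝ] E₀) (J : E₀ →L[ℝ] E) (D : E →L[ℝ] E') (hJ : Function.Injective J)
    (hD : Function.Surjective D) (h1 : ∀ w, L w = 0 ↔ D (J w) = 0)
    (h2 : ∀ v, D v = 0 → v ∈ range J) :
    Module.finrank ℝ (LinearMap.ker L.toLinearMap) +
      (Module.finrank ℝ E₀ - (Module.finrank ℝ E - Module.finrank ℝ E')) =
      Module.finrank ℝ E₀ := by
  have hmap : (LinearMap.ker L.toLinearMap).map J.toLinearMap = LinearMap.ker D.toLinearMap := by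
    ext v
    constructor
    · rintro ⟨w, hw, rfl⟩
      exact (h1 w).1 hw
    · intro hv
      obtain ⟨w, rfl⟩ := h2 v hv
      exact ⟨w, (h1 w).2 hv, rfl⟩
  have h3 := (Submodule.equivMapOfInjective J.toLinearMap hJ (LinearMap.ker L.toLinearMap)).finrank_eq
  have h4 := D.toLinearMap.finrank_range_add_finrank_ker
  have h5 := Submodule.finrank_le (LinearMap.ker L.toLinearMap)
  rw [hmap] at h3
  rw [LinearMap.range_eq_top.2 hD, finrank_top] at h4
  omega

/-- The image is given the quotient topology from Q and not the subspace topology from B, as it need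
not be embedded. -/
theorem exists_image_factorization {Q : Type*} [TopologicalSpace Q] {B : Type uM} (f : Q → B) :
    ∃ (A : Type uM) (_ : TopologicalSpace A) (p : Q → A) (j : A → B),
      Topology.IsQuotientMap p ∧ Function.Injective j ∧ ∀ a, j (p a) = f a := by
  let p : Q → range f := rangeFactorization f
  let _ : TopologicalSpace (range f) := TopologicalSpace.coinduced p inferInstance
  exact ⟨range f, inferInstance, p, Subtype.val, ⟨⟨rfl⟩, rangeFactorization_surjective⟩,
    Subtype.val_injective, fun _ => rfl⟩

section SubmanifoldQuotient

variable {Q : Type*}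
  {EM : Type*} [NormedAddCommGroup EM] [NormedSpace ℝ EM]
  {M : Type*} [TopologicalSpace M] [ChartedSpace EM M]
  {EB : Type*} [NormedAddCommGroup EB] [NormedSpace ℝ EB]
  {B : Type*} [TopologicalSpace B] [ChartedSpace EB B]
  {i : Q → M} {q : M → B} {A : Type*} {p : Q → A} {j : A → B}

/-- A local section σ of q through i a takes its values over the image of q ∘ i in the range of i,
by saturation, and so lifts to a section s of p. -/
theorem Manifold.IsSubmersion.exists_section_image
    (hq : Manifold.IsSubmersion 𝓘(ℝ, EM) 𝓘(ℝ, EB) ∞ q)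
    (hsat : ∀ a x, q x = q (i a) → x ∈ range i) (hi : Function.Injective i)
    (hj : Function.Injective j) (hjp : ∀ a, j (p a) = q (i a)) (hp : Function.Surjective p)
    (a : Q) : ∃ (σ : B → M) (U : Set B) (s : A → Q), IsOpen U ∧ q (i a) ∈ U ∧
      ContMDiffOn 𝓘(ℝ, EB) 𝓘(ℝ, EM) ∞ σ U ∧ s (p a) = a ∧
      ∀ b, j b ∈ U → i (s b) = σ (j b) ∧ p (s b) = b := by
  obtain ⟨σ, U, hU, haU, hσ, hσa, hqσ⟩ := (hq.isSubmersionAt (i a)).exists_section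
  -- Outside j⁻¹(U) the value is arbitrary; a is a default.
  have hex : ∀ b : A, ∃ c : Q, j b ∈ U → i c = σ (j b) := by
    intro b
    by_cases hb : j b ∈ U
    · obtain ⟨c, rfl⟩ := hp b
      obtain ⟨c', hc'⟩ := hsat c (σ (j (p c))) (by rw [hqσ _ hb, hjp])
      exact ⟨c', fun _ => hc'⟩
    · exact ⟨a, fun h => absurd h hb⟩
  choose s hs using hex
  refine ⟨σ, U, s, hU, haU, hσ, hi ?_, fun b hb => ⟨hs b hb, hj ?_⟩⟩
  · rw [hs (p a) (by rwa [hjp]), hjp, hσa]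
  · rw [hjp, hs b hb, hqσ _ hb]

variable {k₀ : ℕ} [TopologicalSpace Q] [ChartedSpace (EuclideanSpace ℝ (Fin k₀)) Q]
  [TopologicalSpace A]

open Filter Topology in
/-- The image of a saturated submanifold under a surjective submersion is a submanifold. -/
theorem Manifold.IsSubmersion.exists_manifold_image [IsManifold (𝓡 k₀) ∞ Q]
    [FiniteDimensional ℝ EM] [FiniteDimensional ℝ EB]
    [IsManifold 𝓘(ℝ, EB) ∞ B] [T2Space B] [SecondCountableTopology Q]
    (hq : Manifold.IsSubmersion 𝓘(ℝ, EM) 𝓘(ℝ, EB) ∞ q)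
    (hsat : ∀ a x, q x = q (i a) → x ∈ range i) (hi : IsWeakEmbedding 𝓘(ℝ, EM) (𝓡 k₀) i)
    (hp : IsQuotientMap p) (hj : Function.Injective j) (hjp : ∀ a, j (p a) = q (i a)) :
    ∃ (m : ℕ) (_ : ChartedSpace (EuclideanSpace ℝ (Fin m)) A), IsManifold (𝓡 m) ∞ A ∧
      T2Space A ∧ SecondCountableTopology A ∧ IsWeakEmbedding 𝓘(ℝ, EB) (𝓡 m) j ∧
      ContMDiff (𝓡 k₀) (𝓡 m) ∞ p ∧ ∀ a : Q, ∃ (s : A → Q) (V : Set A), IsOpen V ∧ p a ∈ V ∧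
        s (p a) = a ∧ ContMDiffOn (𝓡 m) (𝓡 k₀) ∞ s V ∧ ∀ b ∈ V, p (s b) = b := by
  have hism := hi.immersion.contMDiff
  have hqsm := hq.contMDiff
  have hqi := hqsm.comp hism
  have hjpf : j ∘ p = q ∘ i := funext hjp
  have hjc : Continuous j := hp.continuous_iff.2 (by rw [hjpf]; exact hqi.continuous)
  have hdata := hq.exists_section_image hsat hi.injective hj hjp hp.surjective
  -- As yet A has no smooth structure, so smoothness is asserted for s ∘ p: it holds because i ∘ s ∘
  -- p = σ ∘ q ∘ i is smooth and i is a weak embedding.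
  have hsp : ∀ {σ : B → M} {U : Set B} {s : A → Q}, IsOpen U →
      ContMDiffOn 𝓘(ℝ, EB) 𝓘(ℝ, EM) ∞ σ U → (∀ b, j b ∈ U → i (s b) = σ (j b)) →
      ContMDiffOn (𝓡 k₀) (𝓡 k₀) ∞ (s ∘ p) (p ⁻¹' (j ⁻¹' U)) := by
    intro σ U s hU hσ hs
    refine contMDiffOn_lift_of_euclidean hi.lift
      ((hU.preimage hjc).preimage hp.continuous) ?_
    refine (hσ.comp hqi.contMDiffOn (fun c hc => ?_)).congr (fun c hc => ?_)
    · change q (i c) ∈ U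
      rw [← hjp]
      exact hc
    · exact (hs (p c) hc).trans (congrArg σ (hjp c))
  obtain ⟨m, _, hA, hpsm, hsec⟩ : ∃ (m : ℕ) (_ : ChartedSpace (EuclideanSpace ℝ (Fin m)) A),
      IsManifold (𝓡 m) ∞ A ∧ ContMDiff (𝓡 k₀) (𝓡 m) ∞ p ∧
      ∀ a : Q, ∃ (s : A → Q) (V : Set A), IsOpen V ∧ p a ∈ V ∧ s (p a) = a ∧
        ContMDiffOn (𝓡 m) (𝓡 k₀) ∞ s V ∧ ∀ b ∈ V, p (s b) = b :=
    -- The submanifold contains whole fibres of q, of dimension dim M - dim B, so the quotient has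
    -- dimension k₀ - (dim M - dim B).
    ⟨_, exists_quotient_manifold (E := EuclideanSpace ℝ (Fin k₀))
    (m := Module.finrank ℝ (EuclideanSpace ℝ (Fin k₀)) -
      (Module.finrank ℝ EM - Module.finrank ℝ EB)) hp (by
      intro a
      obtain ⟨σ, U, s, hU, haU, hσ, hsa, hs⟩ := hdata a
      have hV := (hU.preimage hjc).preimage hp.continuous
      have haV : a ∈ p ⁻¹' (j ⁻¹' U) := by
        change j (p a) ∈ U
        rwa [hjp]
      have hspa := hsp hU hσ (fun b hb => (hs b hb).1)
      refine ⟨s, j ⁻¹' U, hV, fun b hb => (hs b hb).2, hspa, haV, hsa, ?_⟩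
      have hspd : MDifferentiableAt (𝓡 k₀) (𝓡 k₀) (s ∘ p) a :=
        (hspa.contMDiffAt (hV.mem_nhds haV)).mdifferentiableAt (by simp)
      have hσd : MDifferentiableAt 𝓘(ℝ, EB) 𝓘(ℝ, EM) σ (q (i a)) :=
        (hσ.contMDiffAt (hU.mem_nhds haU)).mdifferentiableAt (by simp)
      have hqid : MDifferentiableAt (𝓡 k₀) 𝓘(ℝ, EB) (q ∘ i) a := hqi.mdifferentiableAt (by simp)
      have hDJ : ∀ w : EuclideanSpace ℝ (Fin k₀), (mfderiv (𝓡 k₀) 𝓘(ℝ, EB) (q ∘ i) a w : EB) =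
          (mfderiv 𝓘(ℝ, EM) 𝓘(ℝ, EB) q (i a) : EM →L[ℝ] EB)
            (mfderiv (𝓡 k₀) 𝓘(ℝ, EM) i a w : EM) := fun w =>
        mfderiv_comp_apply (I := 𝓡 k₀) (I' := 𝓘(ℝ, EM)) (I'' := 𝓘(ℝ, EB)) a
          (hqsm.mdifferentiableAt (by simp)) (hism.mdifferentiableAt (by simp)) w
      -- Together e1 and e2 show that d(s ∘ p) and d(q ∘ i) have the same kernel at a: e1 gives one
      -- inclusion, e2 and injectivity of di the other.
      have e1 : (q ∘ i) ∘ (s ∘ p) =ᶠ[𝓝 a] q ∘ i := by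
        filter_upwards [hV.mem_nhds haV] with c hc
        change q (i (s (p c))) = q (i c)
        rw [← hjp, ← hjp, (hs (p c) hc).2]
      have e2 : i ∘ (s ∘ p) =ᶠ[𝓝 a] σ ∘ (q ∘ i) := by
        filter_upwards [hV.mem_nhds haV] with c hc
        exact ((hs (p c) hc).1).trans (congrArg σ (hjp c))
      exact finrank_ker_add_finrank_of_comp_eq
        (E₀ := EuclideanSpace ℝ (Fin k₀)) (E := EM) (E' := EB)
        (mfderiv (𝓡 k₀) (𝓡 k₀) (s ∘ p) a) (mfderiv (𝓡 k₀) 𝓘(ℝ, EM) i a)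
        (mfderiv 𝓘(ℝ, EM) 𝓘(ℝ, EB) q (i a))
        (hi.immersion.isImmersionAt a).mfderiv_injective
        (hq.isSubmersionAt (i a)).mfderiv_surjective
        (fun w => by
          refine Iff.trans ?_ (Eq.congr_left (hDJ w))
          constructor
          · intro hw
            have := mfderiv_comp_apply_of_eq (I := 𝓡 k₀) (I' := 𝓡 k₀) (I'' := 𝓘(ℝ, EB))
              (f := s ∘ p) (g := q ∘ i) (x := a) (y := a) hqid hspd hsa w
            refine ((DFunLike.congr_fun (e1.mfderiv_eq (I := 𝓡 k₀) (I' := 𝓘(ℝ, EB))) w).symm.trans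
              this).trans ?_
            exact (congrArg (mfderiv (𝓡 k₀) 𝓘(ℝ, EB) (q ∘ i) a) hw).trans (map_zero _)
          · intro hw
            have h1 := mfderiv_comp_apply_of_eq (I := 𝓡 k₀) (I' := 𝓡 k₀) (I'' := 𝓘(ℝ, EM))
              (f := s ∘ p) (g := i) (x := a) (y := a) (hism.mdifferentiableAt (by simp)) hspd hsa w
            have h2 := mfderiv_comp_apply (I := 𝓡 k₀) (I' := 𝓘(ℝ, EB)) (I'' := 𝓘(ℝ, EM))
              (f := q ∘ i) (g := σ) a hσd hqid w
            have h3 := DFunLike.congr_fun (e2.mfderiv_eq (I := 𝓡 k₀) (I' := 𝓘(ℝ, EM))) w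
            apply (hi.immersion.isImmersionAt a).mfderiv_injective
            refine (h1.symm.trans (h3.trans (h2.trans ?_))).trans (map_zero _).symm
            exact (congrArg (mfderiv 𝓘(ℝ, EB) 𝓘(ℝ, EM) σ (q (i a))) hw).trans (map_zero _))
        (fun v hv => by
          -- A vector in ker dq is the velocity of a curve in the fibre of q. By saturation this
          -- curve stays in the range of i, so the vector is in the image of di.
          have hv' := (hq.isSubmersionAt (i a)).mem_tangentSet_fiber (v := v) hv
          obtain ⟨γ, hγ, h0, hS, h1⟩ := hv'
          have : v ∈ tangentSet 𝓘(ℝ, EM) (range i) (i a) :=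
            ⟨γ, hγ, h0, fun t => hsat a _ (hS t), h1⟩
          rw [hi.tangentSet_range a] at this
          exact this))⟩
  have hjsm : ContMDiff (𝓡 m) 𝓘(ℝ, EB) ∞ j := by
    intro b
    obtain ⟨a, rfl⟩ := hp.surjective b
    obtain ⟨s, V, hV, haV, -, hs, hps⟩ := hsec a
    refine ((hqi.comp_contMDiffOn hs).contMDiffAt (hV.mem_nhds haV)).congr_of_eventuallyEq ?_
    filter_upwards [hV.mem_nhds haV] with b hb
    change j b = q (i (s b))
    rw [← hjp, hps b hb]
  -- Continuous local sections through every point make p open, which gives second countability of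
  -- A.
  have hopen : IsOpenMap p := by
    rw [isOpenMap_iff_nhds_le]
    intro a
    obtain ⟨s, V, hV, haV, hsa, hs, hps⟩ := hsec a
    have h1 : Tendsto s (𝓝 (p a)) (𝓝 a) := by
      have := (hs.contMDiffAt (hV.mem_nhds haV)).continuousAt.tendsto
      rwa [hsa] at this
    intro O hO
    filter_upwards [h1 hO, hV.mem_nhds haV] with b hb hbV
    exact hps b hbV ▸ hb
  have hweak : IsWeakEmbedding 𝓘(ℝ, EB) (𝓡 m) j := by
    refine ⟨hj, Manifold.isImmersion_of_mfderiv_injective hjsm fun b => ?_, fun n O f hO hf => ?_⟩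
    · obtain ⟨a, rfl⟩ := hp.surjective b
      obtain ⟨σ, U, s, hU, haU, hσ, hsa, hs⟩ := hdata a
      obtain ⟨s', V', hV', haV', hsa', hs', hps'⟩ := hsec a
      have hpaU : j (p a) ∈ U := by rwa [hjp]
      have hUn := (hU.preimage hjc).mem_nhds hpaU
      -- The section s lies over σ but only s ∘ p is known to be smooth; near p a it equals (s ∘ p)
      -- ∘ s' for the smooth section s'.
      have hssm : ContMDiffAt (𝓡 m) (𝓡 k₀) ∞ s (p a) := by
        have h1 : ContMDiffAt (𝓡 k₀) (𝓡 k₀) ∞ (s ∘ p) (s' (p a)) := by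
          rw [hsa']
          exact (hsp hU hσ (fun b hb => (hs b hb).1)).contMDiffAt
            (((hU.preimage hjc).preimage hp.continuous).mem_nhds hpaU)
        refine (h1.comp (p a) (hs'.contMDiffAt (hV'.mem_nhds haV'))).congr_of_eventuallyEq ?_
        filter_upwards [hV'.mem_nhds haV'] with b hb
        change s b = s (p (s' b))
        rw [hps' b hb]
      have hsd := hssm.mdifferentiableAt (by simp)
      have hσd : MDifferentiableAt 𝓘(ℝ, EB) 𝓘(ℝ, EM) σ (j (p a)) :=
        (hσ.contMDiffAt (hU.mem_nhds hpaU)).mdifferentiableAt (by simp)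
      have e1 : i ∘ s =ᶠ[𝓝 (p a)] σ ∘ j := by
        filter_upwards [hUn] with b hb using (hs b hb).1
      have e2 : p ∘ s =ᶠ[𝓝 (p a)] id := by
        filter_upwards [hUn] with b hb using (hs b hb).2
      -- If dj w = 0, then di(ds w) = dσ(dj w) = 0, so ds w = 0 and w = dp(ds w) = 0.
      rw [injective_iff_map_eq_zero]
      intro w hw
      have h1 := mfderiv_comp_apply_of_eq (I := 𝓡 m) (I' := 𝓡 k₀) (I'' := 𝓘(ℝ, EM))
        (f := s) (g := i) (x := p a) (y := a) (hism.mdifferentiableAt (by simp)) hsd hsa w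
      have h2 := mfderiv_comp_apply (I := 𝓡 m) (I' := 𝓘(ℝ, EB)) (I'' := 𝓘(ℝ, EM))
        (f := j) (g := σ) (p a) hσd (hjsm.mdifferentiableAt (by simp)) w
      have h3 := DFunLike.congr_fun (e1.mfderiv_eq (I := 𝓡 m) (I' := 𝓘(ℝ, EM))) w
      have h4 : (mfderiv (𝓡 m) (𝓡 k₀) s (p a) w : EuclideanSpace ℝ (Fin k₀)) = 0 := by
        apply (hi.immersion.isImmersionAt a).mfderiv_injective
        refine (h1.symm.trans (h3.trans (h2.trans ?_))).trans (map_zero _).symm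
        exact (congrArg (mfderiv 𝓘(ℝ, EB) 𝓘(ℝ, EM) σ (j (p a))) hw).trans (map_zero _)
      have h5 := mfderiv_comp_apply_of_eq (I := 𝓡 m) (I' := 𝓡 k₀) (I'' := 𝓡 m)
        (f := s) (g := p) (x := p a) (y := a) (hpsm.mdifferentiableAt (by simp)) hsd hsa w
      have h6 := DFunLike.congr_fun (e2.mfderiv_eq (I := 𝓡 m) (I' := 𝓡 m)) w
      have h7 := DFunLike.congr_fun (mfderiv_id (I := 𝓡 m) (x := p a)) w
      refine h7.symm.trans (h6.symm.trans (h5.trans ?_))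
      exact (congrArg (mfderiv (𝓡 k₀) (𝓡 m) p a) h4).trans (map_zero _)
    -- Lift locally to Q: i ∘ s ∘ f = σ ∘ j ∘ f is smooth, so s ∘ f is, and therefore so is f = p ∘
    -- (s ∘ f).
    · apply contMDiffOn_of_locally_contMDiffOn
      intro u hu
      obtain ⟨a, ha⟩ := hp.surjective (f u)
      obtain ⟨σ, U, s, hU, haU, hσ, hsa, hs⟩ := hdata a
      have hO' : IsOpen (O ∩ (j ∘ f) ⁻¹' U) := hf.continuousOn.isOpen_inter_preimage hO hU
      have huU : j (f u) ∈ U := by rwa [← ha, hjp]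
      refine ⟨O ∩ (j ∘ f) ⁻¹' U, hO', ⟨hu, huU⟩, ?_⟩
      have h1 : ContMDiffOn (𝓡 n) (𝓡 k₀) ∞ (s ∘ f) (O ∩ (j ∘ f) ⁻¹' U) := by
        refine hi.lift n _ _ hO' ?_
        refine (hσ.comp (hf.mono inter_subset_left) fun y hy => hy.2).congr fun y hy => ?_
        exact (hs _ hy.2).1
      refine ((hpsm.comp_contMDiffOn h1).mono inter_subset_right).congr fun y hy => ?_
      exact (hs _ hy.2.2).2.symm
  exact ⟨_, _, hA, T2Space.of_injective_continuous hj hjc, hp.secondCountableTopology hopen, hweak,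
    hpsm, hsec⟩

open Filter Topology in
/-- The image of a saturated embedded submanifold under a surjective submersion is embedded. -/
theorem Manifold.IsSubmersion.isEmbedding_image [IsManifold 𝓘(ℝ, EM) ∞ M]
    (hq : Manifold.IsSubmersion 𝓘(ℝ, EM) 𝓘(ℝ, EB) ∞ q)
    (hsat : ∀ a x, q x = q (i a) → x ∈ range i) (hi : IsWeakEmbedding 𝓘(ℝ, EM) (𝓡 k₀) i)
    (hp : IsQuotientMap p) (hj : Function.Injective j) (hjp : ∀ a, j (p a) = q (i a))
    (hS : IsEmbeddedSubmanifold 𝓘(ℝ, EM) (range i)) : IsEmbedding j := by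
  have hism := hi.immersion.contMDiff
  have hqi := hq.contMDiff.comp hism
  have hjc : Continuous j := hp.continuous_iff.2 (by
    rw [show j ∘ p = q ∘ i from funext hjp]; exact hqi.continuous)
  obtain ⟨k', A', _, _, j', hA', hj', hr⟩ := hS
  have hf : ∀ c : A', ∃ a : Q, i a = j' c := fun c => by
    have : j' c ∈ range j' := mem_range_self c
    rwa [hr] at this
  choose f hf using hf
  -- f identifies the embedded model A' with Q over M. Its continuity shows that the topology of Q
  -- is at least as coarse as the one induced from M.
  have hfc : Continuous f := by
    have : ContMDiffOn (𝓡 k') (𝓡 k₀) ∞ f univ := by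
      refine contMDiffOn_lift_of_euclidean hi.lift isOpen_univ ?_
      rw [show i ∘ f = j' from funext hf]
      exact hj'.isImmersion.contMDiff.contMDiffOn
    exact (contMDiffOn_univ.1 this).continuous
  have hfs : ∀ a : Q, ∃ c : A', j' c = i a := fun a => by
    have : i a ∈ range i := mem_range_self a
    rwa [← hr] at this
  have hind : ∀ (a : Q) (O : Set Q), O ∈ 𝓝 a → ∃ W ∈ 𝓝 (i a), i ⁻¹' W ⊆ O := by
    intro a O hO
    obtain ⟨c, hc⟩ := hfs a
    have hfa : f c = a := hi.injective ((hf c).trans hc)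
    have h1 : f ⁻¹' O ∈ 𝓝 c := hfc.continuousAt.preimage_mem_nhds (by rwa [hfa])
    rw [hj'.isEmbedding.isInducing.nhds_eq_comap c, hc] at h1
    obtain ⟨W, hW, hWO⟩ := h1
    refine ⟨W, hW, fun a' ha' => ?_⟩
    obtain ⟨c', hc'⟩ := hfs a'
    have hfa' : f c' = a' := hi.injective ((hf c').trans hc')
    rw [← hfa']
    refine hWO ?_
    change j' c' ∈ W
    rw [hc']
    exact ha'
  refine ⟨Topology.isInducing_iff_nhds.2 fun b => le_antisymm hjc.continuousAt.le_comap ?_, hj⟩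
  obtain ⟨a, rfl⟩ := hp.surjective b
  obtain ⟨σ, U, s, hU, haU, hσ, hsa, hs⟩ :=
    hq.exists_section_image hsat hi.injective hj hjp hp.surjective a
  have hpaU : j (p a) ∈ U := by rwa [hjp]
  intro O hO
  obtain ⟨W, hW, hWO⟩ := hind a (p ⁻¹' O) (hp.continuous.continuousAt.preimage_mem_nhds hO)
  have hσa : σ (j (p a)) = i a := by rw [← (hs _ hpaU).1, hsa]
  have hσW : σ ⁻¹' W ∈ 𝓝 (j (p a)) :=
    (hσ.contMDiffAt (hU.mem_nhds hpaU)).continuousAt.preimage_mem_nhds (by rwa [hσa])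
  -- If j b lies in this neighbourhood, then i (s b) = σ (j b) is in W, so s b lies over O, that is,
  -- b = p (s b) ∈ O.
  refine ⟨σ ⁻¹' W ∩ U, inter_mem hσW (hU.mem_nhds hpaU), ?_⟩
  rintro b ⟨hbW, hbU⟩
  have : s b ∈ p ⁻¹' O := hWO (by
    change i (s b) ∈ W
    rw [(hs b hbU).1]
    exact hbW)
  rw [← (hs b hbU).2]
  exact this

end SubmanifoldQuotient

/-! ### Restriction of bivector fields and moment maps to submanifolds -/

theorem ContinuousLinearMap.exists_leftInverse_of_injective {E E' : Type*} [NormedAddCommGroup E]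
    [NormedSpace ℝ E] [NormedAddCommGroup E'] [NormedSpace ℝ E'] [FiniteDimensional ℝ E']
    (J : E →L[ℝ] E') (hJ : Function.Injective J) : ∃ P : E' →L[ℝ] E, ∀ v, P (J v) = v := by
  obtain ⟨P, hP⟩ := J.toLinearMap.exists_leftInverse_of_injective (LinearMap.ker_eq_bot.2 hJ)
  exact ⟨LinearMap.toContinuousLinearMap P, fun v => DFunLike.congr_fun hP v⟩

section Restriction

variable {E : Type*} [NormedAddCommGroup E] [NormedSpace ℝ E] {X : Type*} [TopologicalSpace X]
  {I : ModelWithCorners ℝ E X} {A : Type*} [TopologicalSpace A] [ChartedSpace X A]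
  {E' : Type*} [NormedAddCommGroup E'] [NormedSpace ℝ E'] {X' : Type*} [TopologicalSpace X']
  {I' : ModelWithCorners ℝ E' X'} {B : Type*} [TopologicalSpace B] [ChartedSpace X' B]

theorem BivectorField.toFun_antisymm (π : BivectorField I A) (x : A) (α β : E →L[ℝ] ℝ) :
    π.toFun x α β = -π.toFun x β α :=
  (LinearMap.IsAlt.neg (B := π.toFun x) (fun γ => π.alternating x γ) β α).symm

variable {EH : Type*} [NormedAddCommGroup EH] [NormedSpace ℝ EH] {XH : Type*} [TopologicalSpace XH]
  {IH : ModelWithCorners ℝ EH XH} {H : Type*} [TopologicalSpace H] [ChartedSpace XH H] [Group H]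
  [MulAction H A] [MulAction H B]

theorem mfderiv_infinitesimalAction_self [hA : ContMDiffSMul IH I ∞ H A] {j : A → B}
    (hj : ContMDiff I I' ∞ j) (hequiv : ∀ (h : H) (a : A), j (h • a) = h • j a) (a : A)
    (η : GroupLieAlgebra IH H) :
    mfderiv I I' j a (infinitesimalAction I IH H a η) = infinitesimalAction I' IH H (j a) η := by
  have h := mfderiv_infinitesimalAction (IG := IH) (IH := IH) (MonoidHom.id H) contMDiff_id hj
    hequiv a η
  rwa [lieMap_id] at h

variable [FiniteDimensional ℝ E'] [I.Boundaryless]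

open Filter Topology in
-- Compose f with a local left inverse of j and cut off by a bump function. Agreement near a
-- suffices, because brackets depend only on germs.
theorem Manifold.IsImmersionAt.exists_extension [IsManifold I' ∞ B] [T2Space B] {j : A → B} {a : A}
    (hj : Manifold.IsImmersionAt I I' ∞ j a) {f : A → ℝ} (hf : ContMDiff I 𝓘(ℝ, ℝ) ∞ f) :
    ∃ F : B → ℝ, ContMDiff I' 𝓘(ℝ, ℝ) ∞ F ∧ F ∘ j =ᶠ[𝓝 a] f := by
  obtain ⟨g, U, hU, haU, hg, hgj⟩ := hj.exists_leftInverse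
  obtain ⟨F, hF, hFg⟩ := exists_contMDiff_eventuallyEq hU haU (hf.comp_contMDiffOn hg)
  refine ⟨F, hF, ?_⟩
  filter_upwards [hgj, hj.contMDiffAt.continuousAt.eventually hFg] with x hx hx'
  exact hx'.trans (congrArg f hx)

open Filter Topology in
/-- A bivector field which annihilates the conormal spaces of an immersed submanifold is
tangent to it. -/
theorem BivectorField.exists_restriction [IsManifold I' ∞ B] [T2Space B] {j : A → B}
    (hj : Manifold.IsImmersion I I' ∞ j) (π : BivectorField I' B)
    (hnull : ∀ (a : A) (α β : E' →L[ℝ] ℝ), α.comp (mfderiv I I' j a : E →L[ℝ] E') = 0 →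
      π.toFun (j a) α β = 0) :
    ∃ πA : BivectorField I A, BivectorRelated j πA π := by
  let D : ∀ a, E →L[ℝ] E' := fun a => mfderiv I I' j a
  -- These left inverses extend covectors from A to B, with no regularity in a. By `hnull` the
  -- resulting value does not depend on the extension.
  have hP : ∀ a, ∃ P : E' →L[ℝ] E, ∀ v, P (D a v) = v := fun a =>
    ContinuousLinearMap.exists_leftInverse_of_injective (E := E) (E' := E') (D a)
      (hj.isImmersionAt a).mfderiv_injective
  choose P hP using hP
  let T : ∀ a : A, CotangentSpace I a →ₗ[ℝ] CotangentSpace I a →ₗ[ℝ] ℝ := fun a =>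
    transferForm (E := E') (E' := E) (π.toFun (j a))
      (precompLinear (E := E') (E' := E) (P a))
  have h1 : ∀ a (α α' β : E' →L[ℝ] ℝ), α.comp (D a) = α'.comp (D a) →
      π.toFun (j a) α β = π.toFun (j a) α' β := by
    intro a α α' β h
    have h2 : (α - α').comp (D a) = 0 := by rw [ContinuousLinearMap.sub_comp, h, sub_self]
    have h3 := hnull a (α - α') β h2
    exact sub_eq_zero.1 ((LinearMap.map_sub₂ (π.toFun (j a)) α α' β).symm.trans h3)
  have hT : ∀ (a : A) (α β : E' →L[ℝ] ℝ), π.toFun (j a) α β =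
      T a (α.comp (D a)) (β.comp (D a)) := by
    intro a α β
    have hα : ∀ α : E' →L[ℝ] ℝ, α.comp (D a) = ((α.comp (D a)).comp (P a)).comp (D a) := by
      intro α
      ext v
      exact (congrArg (fun w => α (D a w)) (hP a v)).symm
    -- The independence h1 concerns the first argument only; antisymmetry transfers it to the
    -- second.
    refine (h1 a _ _ β (hα α)).trans ((π.toFun_antisymm _ _ _).trans ?_)
    refine (congrArg Neg.neg (h1 a _ _ _ (hα β))).trans ?_
    exact (π.toFun_antisymm _ _ _).symm
  refine ⟨⟨T, fun a α => π.alternating (j a) _, fun f g hf hg => ?_⟩, hT⟩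
  intro a
  obtain ⟨F, hF, hFf⟩ := (hj.isImmersionAt a).exists_extension hf
  obtain ⟨G, hG, hGg⟩ := (hj.isImmersionAt a).exists_extension hg
  refine ((π.contMDiff_bracket hF hG).comp hj.contMDiff a).congr_of_eventuallyEq ?_
  filter_upwards [hFf.eventuallyEq_nhds, hGg.eventuallyEq_nhds] with x hx hx'
  rw [← mvfderiv_congr_of_eventuallyEq hx, ← mvfderiv_congr_of_eventuallyEq hx',
    mvfderiv_comp_eq (hF.mdifferentiableAt (by simp)) (hj.contMDiff.mdifferentiableAt (by simp)),
    mvfderiv_comp_eq (hG.mdifferentiableAt (by simp)) (hj.contMDiff.mdifferentiableAt (by simp))]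
  exact (hT x _ _).symm

theorem Manifold.IsImmersion.exists_comp_mfderiv_eq {j : A → B}
    (hj : Manifold.IsImmersion I I' ∞ j) (a : A) (α : E →L[ℝ] ℝ) :
    ∃ β : E' →L[ℝ] ℝ, β.comp (mfderiv I I' j a : E →L[ℝ] E') = α := by
  obtain ⟨P, hP⟩ := ContinuousLinearMap.exists_leftInverse_of_injective (E := E) (E' := E')
    (mfderiv I I' j a) (hj.isImmersionAt a).mfderiv_injective
  exact ⟨α.comp P, ContinuousLinearMap.ext fun v => congrArg α (hP v)⟩

/-- An invariant submanifold to which the bivector field is tangent is quasi-Poisson. -/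
theorem IsQuasiPoisson.of_immersion [IsManifold I' ∞ B] [T2Space B] {s : TwoTensor IH H} {j : A → B}
    (hj : Manifold.IsImmersion I I' ∞ j) {πA : BivectorField I A} {π : BivectorField I' B}
    (hrel : BivectorRelated j πA π) (hπ : IsQuasiPoisson s π) (hA : ContMDiffSMul IH I ∞ H A)
    (hequiv : ∀ (h : H) (a : A), j (h • a) = h • j a) : IsQuasiPoisson s πA := by
  have := hπ.smooth_action
  have hjsm := hj.contMDiff
  refine ⟨hA, fun h a α β => ?_, fun f g k hf hg hk a => ?_⟩
  · obtain ⟨α, rfl⟩ := hj.exists_comp_mfderiv_eq (h • a) α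
    obtain ⟨β, rfl⟩ := hj.exists_comp_mfderiv_eq (h • a) β
    have key := comp_mfderiv_comp_eq (contMDiff_smul_right (IG := IH) (I := I) h)
      (contMDiff_smul_right (IG := IH) (I := I') h) hjsm (hequiv h) a
    refine (hrel (h • a) α β).symm.trans ((π.toFun_congr (hequiv h a) α β).trans ?_)
    refine (hπ.invariant h (j a) α β).trans ((hrel a _ _).trans ?_)
    exact (congrArg₂ (fun a' b' : E →L[ℝ] ℝ => πA.toFun a a' b') (key α) (key β)).symm
  · obtain ⟨F, hF, hFf⟩ := (hj.isImmersionAt a).exists_extension hf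
    obtain ⟨G, hG, hGg⟩ := (hj.isImmersionAt a).exists_extension hg
    obtain ⟨K, hK, hKk⟩ := (hj.isImmersionAt a).exists_extension hk
    rw [← schoutenBracket_congr πA hFf hGg hKk, hrel.schoutenBracket_comp hjsm hF hG hK,
      hπ.schouten F G K hF hG hK]
    have key : ∀ {F : B → ℝ} {f : A → ℝ}, ContMDiff I' 𝓘(ℝ, ℝ) ∞ F →
        F ∘ j =ᶠ[nhds a] f → (mvfderiv I' F (j a)).comp (infinitesimalAction I' IH H (j a)) =
        (mvfderiv I f a).comp (infinitesimalAction I IH H a) := by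
      intro F f hF hFf
      rw [← mvfderiv_congr_of_eventuallyEq hFf, mvfderiv_comp_eq (hF.mdifferentiableAt (by simp))
        (hjsm.mdifferentiableAt (by simp))]
      ext η
      exact congrArg (mvfderiv I' F (j a)) (mfderiv_infinitesimalAction_self hjsm hequiv a η).symm
    exact cartanTensor_congr s (key hF hFf) (key hG hGg) (key hK hKk)

/-- The restriction of a moment map to an invariant submanifold. -/
theorem IsTwistedMomentMap.comp_immersion {s : TwoTensor IH H} {j : A → B}
    (hj : Manifold.IsImmersion I I' ∞ j) {πA : BivectorField I A} {π : BivectorField I' B}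
    (hrel : BivectorRelated j πA π) (hA : ContMDiffSMul IH I ∞ H A)
    (hequiv : ∀ (h : H) (a : A), j (h • a) = h • j a) {τ : H ≃* H} {μ : B → H}
    (hμ : IsTwistedMomentMap s π τ μ) : IsTwistedMomentMap s πA τ (μ ∘ j) := by
  have hjsm := hj.contMDiff
  refine ⟨hμ.contMDiff.comp hjsm, fun h a => ?_, fun a θ η => ?_⟩
  · exact (congrArg μ (hequiv h a)).trans (hμ.equivariant h (j a))
  · obtain ⟨η, rfl⟩ := hj.exists_comp_mfderiv_eq a η
    have h1 : (θ.comp (mfderiv I IH (μ ∘ j) a) : E →L[ℝ] ℝ) =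
        (θ.comp (mfderiv I' IH μ (j a))).comp (mfderiv I I' j a) :=
      congrArg (fun L : E →L[ℝ] EH => (θ : EH →L[ℝ] ℝ).comp L) (mfderiv_comp a
        (hμ.contMDiff.mdifferentiableAt (by simp)) (hjsm.mdifferentiableAt (by simp)))
    have h2 : ((η.comp (mfderiv I I' j a : E →L[ℝ] E')).comp (infinitesimalAction I IH H a) :
        LieDual IH H) = (η.comp (infinitesimalAction I' IH H (j a)) : LieDual IH H) := by
      ext ξ
      exact congrArg η (mfderiv_infinitesimalAction_self hjsm hequiv a ξ)
    refine (congrArg (fun t : E →L[ℝ] ℝ => πA.toFun a t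
      (η.comp (mfderiv I I' j a : E →L[ℝ] E'))) h1).trans ?_
    refine (hrel a _ _).symm.trans ((hμ.bivector (j a) θ η).trans ?_)
    exact congrArg (fun t : LieDual IH H => -(1 / 2) * θ (mulInvariantVectorField (s t) (μ (j a)) +
      rightInvariantVectorField IH (lieMap IH IH τ.toMonoidHom (s t)) (μ (j a)))) h2.symm

end Restriction

/-! ### Velocities of two-sided actions and components of moment maps -/

section GroupDerivatives

variable {E : Type*} [NormedAddCommGroup E] [NormedSpace ℝ E] {X : Type*} [TopologicalSpace X]
  {I : ModelWithCorners ℝ E X} {G : Type*} [TopologicalSpace G] [ChartedSpace X G] [Group G]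
  {E' : Type*} [NormedAddCommGroup E'] [NormedSpace ℝ E'] {X' : Type*} [TopologicalSpace X']
  {I' : ModelWithCorners ℝ E' X'} {N : Type*} [TopologicalSpace N] [ChartedSpace X' N]

theorem mulInvariantVectorField_one (v : GroupLieAlgebra I G) :
    (mulInvariantVectorField v (1 : G) : E) = (v : E) := by
  have h : (fun h : G => 1 * h) = id := by ext h; simp
  have h2 : (mfderiv I I (fun h : G => 1 * h) (1 : G) v : E) = mfderiv I I id (1 : G) v := by
    rw [h]
    rfl
  exact h2.trans (DFunLike.congr_fun (mfderiv_id (I := I) (x := (1 : G))) v)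

theorem rightInvariantVectorField_one (v : GroupLieAlgebra I G) :
    (rightInvariantVectorField I v (1 : G) : E) = (v : E) := by
  have h : (fun h : G => h * 1) = id := by ext h; simp
  have h2 : (mfderiv I I (fun h : G => h * 1) (1 : G) v : E) = mfderiv I I id (1 : G) v := by
    rw [h]
    rfl
  exact h2.trans (DFunLike.congr_fun (mfderiv_id (I := I) (x := (1 : G))) v)

variable [LieGroup I ∞ G]

/-- The map (p, q) ↦ p g q has at (1, 1) the partial derivatives of right and left translation by g.
-/
theorem mfderiv_mul_const_mul (g : G) {u v : N → G} {x : N} (hu : MDifferentiableAt I' I u x)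
    (hv : MDifferentiableAt I' I v x) (hu1 : u x = 1) (hv1 : v x = 1) (w : TangentSpace I' x) :
    (mfderiv I' I (fun y => u y * g * v y) x w : E) =
      (rightInvariantVectorField I (mfderiv I' I u x w : E) g : E) +
        (mulInvariantVectorField (I := I) (mfderiv I' I v x w : E) g : E) := by
  let F : G × G → G := fun p => p.1 * g * p.2
  have hF : ContMDiff (I.prod I) I ∞ F := by
    have h1 : ContMDiff (I.prod I) I ∞ fun p : G × G => p.1 * g :=
      (contMDiff_mul_right (I := I) (a := g)).comp contMDiff_fst
    exact h1.mul contMDiff_snd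
  have hFd : MDifferentiableAt (I.prod I) I F (1, 1) := hF.mdifferentiableAt (by simp)
  have h1 := mfderiv_comp_apply_of_eq (I := I') (I' := I.prod I) (I'' := I)
    (f := fun y => (u y, v y)) (g := F) (x := x) (y := (1, 1)) hFd (hu.prodMk hv)
    (Prod.ext hu1 hv1) w
  have h2 := DFunLike.congr_fun (mfderiv_prodMk hu hv) w
  have h3 := mfderiv_prod_eq_add_apply (v := ((mfderiv I' I u x w, mfderiv I' I v x w) : E × E)) hFd
  have e1 : (fun z : G => F (z, 1)) = fun z => z * g := funext fun z => mul_one (z * g)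
  have e2 : (fun z : G => F (1, z)) = fun z => g * z :=
    funext fun z => congrArg (fun y => y * z) (one_mul g)
  refine h1.trans ((congrArg (mfderiv (I.prod I) I F (1, 1)) h2).trans (h3.trans ?_))
  exact congrArg₂ (fun v w : E => v + w)
    (congrArg (fun φ : G → G => (mfderiv I I φ 1 (mfderiv I' I u x w : E) : E)) e1)
    (congrArg (fun φ : G → G => (mfderiv I I φ 1 (mfderiv I' I v x w : E) : E)) e2)

variable {G' : Type*} [TopologicalSpace G'] [ChartedSpace X' G'] [Group G']

/-- The velocity of the two-sided action `d ↦ a d * g * (b d)⁻¹`. -/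
theorem mfderiv_hom_mul_mul_hom_inv {a b : G' →* G} (ha : ContMDiff I' I ∞ a)
    (hb : ContMDiff I' I ∞ b) (g : G) (ζ : GroupLieAlgebra I' G') :
    (mfderiv I' I (fun d => a d * g * (b d)⁻¹) 1 ζ : E) =
      (rightInvariantVectorField I (lieMap I' I a ζ) g : E) +
        (mulInvariantVectorField (-lieMap I' I b ζ) g : E) := by
  have hbi : ContMDiff I' I ∞ fun d => (b d)⁻¹ := hb.inv
  have had := ha.mdifferentiableAt (x := 1) (by simp)
  have hbd := hb.mdifferentiableAt (x := 1) (by simp)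
  have hbid := hbi.mdifferentiableAt (x := 1) (by simp)
  -- The velocity of (b d)⁻¹ comes from differentiating the constant b d · 1 · (b d)⁻¹ = 1, which
  -- makes it minus the velocity of b.
  have h1 := mfderiv_mul_const_mul (I := I) (1 : G) hbd hbid (map_one b) (by simp) ζ
  have h2 : (fun d => b d * 1 * (b d)⁻¹) = fun _ => (1 : G) := by ext d; simp
  let P : E := lieMap I' I b ζ
  let R : E := mfderiv I' I (fun d => (b d)⁻¹) 1 ζ
  have h4 : (mfderiv I' I (fun d => b d * 1 * (b d)⁻¹) 1 ζ : E) = 0 := by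
    rw [h2]
    exact DFunLike.congr_fun (mfderiv_const (I := I') (I' := I) (x := (1 : G'))) ζ
  have h3 : (0 : E) = P + R := by
    refine h4.symm.trans (h1.trans ?_)
    exact congrArg₂ (fun v w : E => v + w) (rightInvariantVectorField_one (I := I) (G := G) _)
      (mulInvariantVectorField_one (I := I) (G := G) _)
  have h5 : R = -P := (neg_eq_of_add_eq_zero_right h3.symm).symm
  refine (mfderiv_mul_const_mul (I := I) g had hbid (map_one a) (by simp) ζ).trans ?_
  exact congrArg (fun v : E => (rightInvariantVectorField I (lieMap I' I a ζ) g : E) +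
    (mulInvariantVectorField (I := I) v g : E)) h5

theorem mfderiv_rightInvariantVectorField [LieGroup I' ∞ G'] {f : G' →* G}
    (hf : ContMDiff I' I ∞ f) (v : GroupLieAlgebra I' G') (g : G') :
    mfderiv I' I f g (rightInvariantVectorField I' v g) =
      rightInvariantVectorField I (lieMap I' I f v) (f g) := by
  have h1 := mfderiv_comp_apply_of_eq (I := I') (I' := I') (I'' := I) (f := fun h : G' => h * g)
    (g := f) (x := (1 : G')) (y := g) (hf.mdifferentiableAt (by simp))
    ((contMDiff_mul_right (n := ∞)).mdifferentiableAt (by simp)) (one_mul g) v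
  have h2 := mfderiv_comp_apply_of_eq (I := I') (I' := I) (I'' := I) (f := f)
    (g := fun h : G => h * f g) (x := (1 : G')) (y := (1 : G))
    ((contMDiff_mul_right (n := ∞)).mdifferentiableAt (by simp)) (hf.mdifferentiableAt (by simp))
    (map_one f) v
  have h3 : (f ∘ fun h : G' => h * g) = (fun h : G => h * f g) ∘ f := by
    ext h; simp
  rw [h3] at h1
  exact h1.symm.trans h2

end GroupDerivatives

section MomentMap

variable {E : Type*} [NormedAddCommGroup E] [NormedSpace ℝ E] {X : Type*} [TopologicalSpace X]
  {I : ModelWithCorners ℝ E X} {M : Type*} [TopologicalSpace M] [ChartedSpace X M]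
  {EG : Type*} [NormedAddCommGroup EG] [NormedSpace ℝ EG] {XG : Type*} [TopologicalSpace XG]
  {IG : ModelWithCorners ℝ EG XG} {G : Type*} [TopologicalSpace G] [ChartedSpace XG G] [Group G]
  {EH : Type*} [NormedAddCommGroup EH] [NormedSpace ℝ EH] {XH : Type*} [TopologicalSpace XH]
  {IH : ModelWithCorners ℝ EH XH} {H : Type*} [TopologicalSpace H] [ChartedSpace XH H] [Group H]

theorem contMDiff_prodCongr {τG : G ≃* G} {τH : H ≃* H} (hτG : ContMDiff IG IG ∞ τG) (hτH : ContMDiff IH IH ∞ τH) :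
    ContMDiff (IG.prod IH) (IG.prod IH) ∞ (MulEquiv.prodCongr τG τH) :=
  hτG.prodMap hτH

variable [LieGroup IG ∞ G] [LieGroup IH ∞ H]

/-- The image of a moment map under a homomorphism. -/
theorem IsTwistedMomentMap.bivector_comp_hom [MulAction G M] {s : TwoTensor IG G}
    {π : BivectorField I M} {τ : G ≃* G} {μ : M → G} (hμ : IsTwistedMomentMap s π τ μ)
    (hτ : ContMDiff IG IG ∞ τ) {f : G →* H} (hf : ContMDiff IG IH ∞ f) {τ' : H ≃* H}
    (hτ' : ContMDiff IH IH ∞ τ') (hfτ : ∀ g, f (τ g) = τ' (f g)) (x : M)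
    (θ : EH →L[ℝ] ℝ) (η : E →L[ℝ] ℝ) :
    π.toFun x (θ.comp (mfderiv I IH (f ∘ μ) x : E →L[ℝ] EH)) η =
      -(1 / 2) * θ (mulInvariantVectorField (lieMap IG IH f
          (s (η.comp (infinitesimalAction I IG G x)))) (f (μ x)) +
        rightInvariantVectorField IH (lieMap IH IH τ'.toMonoidHom (lieMap IG IH f
          (s (η.comp (infinitesimalAction I IG G x))))) (f (μ x))) := by
  have h1 : (θ.comp (mfderiv I IH (f ∘ μ) x : E →L[ℝ] EH)) =
      (θ.comp (mfderiv IG IH f (μ x) : EG →L[ℝ] EH)).comp (mfderiv I IG μ x : E →L[ℝ] EG) :=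
    congrArg (fun L : E →L[ℝ] EH => θ.comp L) (mfderiv_comp x
      (hf.mdifferentiableAt (by simp)) (hμ.contMDiff.mdifferentiableAt (by simp)))
  refine (congrArg (fun t : E →L[ℝ] ℝ => π.toFun x t η) h1).trans ?_
  refine (hμ.bivector x _ η).trans ?_
  refine congrArg (fun t : EH => -(1 / 2) * θ t) ?_
  refine (map_add (mfderiv IG IH f (μ x)) _ _).trans ?_
  refine congrArg₂ (fun v w : EH => v + w) (mfderiv_mulInvariantVectorField f hf _ _) ?_
  refine (mfderiv_rightInvariantVectorField hf _ _).trans ?_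
  refine congrArg (fun v : GroupLieAlgebra IH H =>
    (rightInvariantVectorField IH v (f (μ x)) : EH)) ?_
  have h2 : f.comp τ.toMonoidHom = τ'.toMonoidHom.comp f := MonoidHom.ext hfτ
  rw [← lieMap_comp (f := f) (g := τ.toMonoidHom) hf hτ,
    ← lieMap_comp (f := τ'.toMonoidHom) (g := f) hτ' hf, h2]
  rfl

variable [MulAction (G × H) M] {sG : TwoTensor IG G} {sH : TwoTensor IH H}
  {π : BivectorField I M} {τG : G ≃* G} {τH : H ≃* H} {μG : M → G} {μH : M → H}

/-- Project the moment map condition to G. The 𝔤-component of (s_G + s_H)♯ sees only the 𝔤-part of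
the functional. -/
theorem IsTwistedMomentMap.bivector_fst
    (hμ : IsTwistedMomentMap (sumTensor sG sH) π (MulEquiv.prodCongr τG τH)
      (fun x => (μG x, μH x)))
    (hτG : ContMDiff IG IG ∞ τG) (hτH : ContMDiff IH IH ∞ τH) (x : M)
    (θ : EG →L[ℝ] ℝ) (η : E →L[ℝ] ℝ) :
    π.toFun x (θ.comp (mfderiv I IG μG x : E →L[ℝ] EG)) η =
      -(1 / 2) * θ (mulInvariantVectorField
          (sG ((η.comp (infinitesimalAction I (IG.prod IH) (G × H) x)).comp
            (lieMap IG (IG.prod IH) (MonoidHom.inl G H)))) (μG x) +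
        rightInvariantVectorField IG (lieMap IG IG τG.toMonoidHom
          (sG ((η.comp (infinitesimalAction I (IG.prod IH) (G × H) x)).comp
            (lieMap IG (IG.prod IH) (MonoidHom.inl G H))))) (μG x)) := by
  have h := hμ.bivector_comp_hom (contMDiff_prodCongr hτG hτH) (f := MonoidHom.fst G H)
    (contMDiff_fst (I := IG) (J := IH)) hτG (fun _ => rfl) x θ η
  have h2 := lieMap_fst_inl_add_inr (I := IG) (I' := IH) (G := G) (G' := H)
    (sG ((η.comp (infinitesimalAction I (IG.prod IH) (G × H) x)).comp
            (lieMap IG (IG.prod IH) (MonoidHom.inl G H))))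
    (sH ((η.comp (infinitesimalAction I (IG.prod IH) (G × H) x)).comp
            (lieMap IH (IG.prod IH) (MonoidHom.inr G H))))
  refine h.trans ?_
  exact congrArg (fun t : GroupLieAlgebra IG G => -(1 / 2) * θ (mulInvariantVectorField t (μG x) +
    rightInvariantVectorField IG (lieMap IG IG τG.toMonoidHom t) (μG x))) h2

theorem IsTwistedMomentMap.bivector_snd
    (hμ : IsTwistedMomentMap (sumTensor sG sH) π (MulEquiv.prodCongr τG τH)
      (fun x => (μG x, μH x)))
    (hτG : ContMDiff IG IG ∞ τG) (hτH : ContMDiff IH IH ∞ τH) (x : M)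
    (θ : EH →L[ℝ] ℝ) (η : E →L[ℝ] ℝ) :
    π.toFun x (θ.comp (mfderiv I IH μH x : E →L[ℝ] EH)) η =
      -(1 / 2) * θ (mulInvariantVectorField
          (sH ((η.comp (infinitesimalAction I (IG.prod IH) (G × H) x)).comp
            (lieMap IH (IG.prod IH) (MonoidHom.inr G H)))) (μH x) +
        rightInvariantVectorField IH (lieMap IH IH τH.toMonoidHom
          (sH ((η.comp (infinitesimalAction I (IG.prod IH) (G × H) x)).comp
            (lieMap IH (IG.prod IH) (MonoidHom.inr G H))))) (μH x)) := by
  have h := hμ.bivector_comp_hom (contMDiff_prodCongr hτG hτH) (f := MonoidHom.snd G H)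
    (contMDiff_snd (I := IG) (J := IH)) hτH (fun _ => rfl) x θ η
  have h2 := lieMap_snd_inl_add_inr (I := IG) (I' := IH) (G := G) (G' := H)
    (sG ((η.comp (infinitesimalAction I (IG.prod IH) (G × H) x)).comp
            (lieMap IG (IG.prod IH) (MonoidHom.inl G H))))
    (sH ((η.comp (infinitesimalAction I (IG.prod IH) (G × H) x)).comp
            (lieMap IH (IG.prod IH) (MonoidHom.inr G H))))
  refine h.trans ?_
  exact congrArg (fun t : GroupLieAlgebra IH H => -(1 / 2) * θ (mulInvariantVectorField t (μH x) +
    rightInvariantVectorField IH (lieMap IH IH τH.toMonoidHom t) (μH x))) h2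

end MomentMap

/-- α kills the kernel of E → F/T, and the annihilator of a kernel is the range of the dual map; so
α comes from a functional on F/T. It converts conormality to μ⁻¹(K) into pullback of a conormal to
K. -/
theorem ContinuousLinearMap.exists_comp_eq_of_forall_mem {E F : Type*} [NormedAddCommGroup E]
    [NormedSpace ℝ E] [NormedAddCommGroup F] [NormedSpace ℝ F] [FiniteDimensional ℝ F]
    (L : E →L[ℝ] F) (T : Submodule ℝ F) (α : E →L[ℝ] ℝ) (h : ∀ v, L v ∈ T → α v = 0) :
    ∃ θ : F →L[ℝ] ℝ, (∀ t ∈ T, θ t = 0) ∧ θ.comp L = α := by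
  have hmem : α.toLinearMap ∈
      (LinearMap.ker (T.mkQ ∘ₗ L.toLinearMap)).dualAnnihilator := by
    rw [Submodule.mem_dualAnnihilator]
    intro v hv
    exact h v ((Submodule.Quotient.mk_eq_zero T).1 hv)
  rw [← LinearMap.range_dualMap_eq_dualAnnihilator_ker] at hmem
  obtain ⟨φ, hφ⟩ := hmem
  refine ⟨LinearMap.toContinuousLinearMap (φ ∘ₗ T.mkQ), fun t ht => ?_, ?_⟩
  · change φ (T.mkQ t) = 0
    rw [show T.mkQ t = 0 from (Submodule.Quotient.mk_eq_zero T).2 ht, map_zero]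
  · ext v
    exact DFunLike.congr_fun hφ v

section Equivariance

variable {E : Type*} [NormedAddCommGroup E] [NormedSpace ℝ E] {X : Type*} [TopologicalSpace X]
  {I : ModelWithCorners ℝ E X} {B : Type*} [TopologicalSpace B] [ChartedSpace X B]
  {E' : Type*} [NormedAddCommGroup E'] [NormedSpace ℝ E'] {X' : Type*} [TopologicalSpace X']
  {I' : ModelWithCorners ℝ E' X'} [I'.Boundaryless] {A : Type*} [TopologicalSpace A]
  [ChartedSpace X' A] [IsManifold I' ∞ A] [FiniteDimensional ℝ E']
  {EH : Type*} [NormedAddCommGroup EH] [NormedSpace ℝ EH] {XH : Type*} [TopologicalSpace XH]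
  {IH : ModelWithCorners ℝ EH XH} {H : Type*} [TopologicalSpace H] [ChartedSpace XH H] [Group H]
  [IH.Boundaryless] [IsManifold IH ∞ H] [FiniteDimensional ℝ EH]

/-- A smooth action restricts to an invariant submanifold. -/
theorem IsWeakEmbedding.exists_mulAction [MulAction H B] [ContMDiffSMul IH I ∞ H B] {j : A → B}
    (hj : IsWeakEmbedding I I' j) (hinv : ∀ (h : H) (a : A), h • j a ∈ range j) :
    ∃ _ : MulAction H A, (∀ (h : H) (a : A), j (h • a) = h • j a) ∧ ContMDiffSMul IH I' ∞ H A := by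
  choose m hm using hinv
  let act : MulAction H A :=
    { smul := m
      one_smul := fun a => hj.injective ((hm 1 a).trans (one_smul H (j a)))
      mul_smul := fun h h' a => hj.injective (by
        change j (m (h * h') a) = j (m h (m h' a))
        rw [hm, hm, hm, mul_smul]) }
  refine ⟨act, hm, ⟨?_⟩⟩
  rw [← contMDiffOn_univ]
  refine contMDiffOn_lift_of_euclidean hj.lift isOpen_univ ?_
  have h1 : (j ∘ fun p : H × A => p.1 • p.2) = fun p : H × A => p.1 • j p.2 :=
    funext fun p => hm p.1 p.2
  rw [h1]
  refine ContMDiff.contMDiffOn ?_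
  exact (contMDiff_smul (I := IH) (I' := I) (n := ∞)).comp
    (contMDiff_fst.prodMk (hj.immersion.contMDiff.comp contMDiff_snd))

end Equivariance

theorem mem_tangentSet_congr {E : Type*} [NormedAddCommGroup E] [NormedSpace ℝ E] {X : Type*}
    [TopologicalSpace X] {I : ModelWithCorners ℝ E X} {M : Type*} [TopologicalSpace M]
    [ChartedSpace X M] {S : Set M} {x y : M} (h : x = y) {v : E}
    (hv : v ∈ (tangentSet I S x : Set E)) : v ∈ (tangentSet I S y : Set E) := by
  subst h; exact hv

/-! ### Descent of the moment map and tangency of the reduced bivector -/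

section ReducedMomentMap

variable {EG : Type*} [NormedAddCommGroup EG] [NormedSpace ℝ EG]
  {G : Type*} [TopologicalSpace G] [ChartedSpace EG G] [Group G] [LieGroup 𝓘(ℝ, EG) ∞ G]
  {EH : Type*} [NormedAddCommGroup EH] [NormedSpace ℝ EH]
  {H : Type*} [TopologicalSpace H] [ChartedSpace EH H] [Group H] [LieGroup 𝓘(ℝ, EH) ∞ H]
  {EM : Type*} [NormedAddCommGroup EM] [NormedSpace ℝ EM]
  {M : Type*} [TopologicalSpace M] [ChartedSpace EM M] [MulAction (G × H) M]
  {sG : TwoTensor 𝓘(ℝ, EG) G} {sH : TwoTensor 𝓘(ℝ, EH) H} {π : BivectorField 𝓘(ℝ, EM) M}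
  {C : Type*} [Group C] {ι : C →* G}
  {EB : Type*} [NormedAddCommGroup EB] [NormedSpace ℝ EB]
  {B : Type*} [TopologicalSpace B] [ChartedSpace EB B] {q : M → B}
  {τG : G ≃* G} {τH : H ≃* H} {μG : M → G} {μH : M → H}

open Filter Topology in
/-- The second component of a moment map descends to the reduced space. -/
theorem IsTwistedMomentMap.exists_descent [MulAction H B] {πB : BivectorField 𝓘(ℝ, EB) B}
    [ContMDiffSMul (𝓘(ℝ, EG).prod 𝓘(ℝ, EH)) 𝓘(ℝ, EM) ∞ (G × H) M]
    (hμ : IsTwistedMomentMap (sumTensor sG sH) π (MulEquiv.prodCongr τG τH)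
      (fun x => (μG x, μH x)))
    (hτG : ContMDiff 𝓘(ℝ, EG) 𝓘(ℝ, EG) ∞ τG) (hτH : ContMDiff 𝓘(ℝ, EH) 𝓘(ℝ, EH) ∞ τH)
    (hrel : BivectorRelated q π πB) (hq : ContMDiff 𝓘(ℝ, EM) 𝓘(ℝ, EB) ∞ q)
    (hsec : ∀ x, ∃ (σ : B → M) (U : Set B), IsOpen U ∧ q x ∈ U ∧
      ContMDiffOn 𝓘(ℝ, EB) 𝓘(ℝ, EM) ∞ σ U ∧ ∀ y ∈ U, q (σ y) = y)
    (hsurj : Function.Surjective q)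
    (horb : ∀ x x' : M, q x = q x' → ∃ c : C, x' = (ι c, (1 : H)) • x)
    (hequiv : ∀ (h : H) (x : M), q (((1 : G), h) • x) = h • q x) :
    ∃ μB : B → H, (∀ x, μB (q x) = μH x) ∧ IsTwistedMomentMap sH πB τH μB := by
  have hμHsm : ContMDiff 𝓘(ℝ, EM) 𝓘(ℝ, EH) ∞ μH := contMDiff_snd.comp hμ.contMDiff
  have hμHe : ∀ (g : G) (h : H) (x : M), μH ((g, h) • x) = τH h * μH x * h⁻¹ := fun g h x =>
    congrArg Prod.snd (hμ.equivariant (g, h) x)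
  let μB : B → H := μH ∘ Function.surjInv hsurj
  -- Points with the same image differ by some (ι c, 1), whose H-component acts trivially on μH.
  have hμB : ∀ x, μB (q x) = μH x := by
    intro x
    obtain ⟨c, hc⟩ := horb x (Function.surjInv hsurj (q x)) (Function.surjInv_eq hsurj _).symm
    change μH (Function.surjInv hsurj (q x)) = μH x
    rw [hc, hμHe]
    simp
  have hcomp : μB ∘ q = μH := funext hμB
  have hμBsm : ContMDiff 𝓘(ℝ, EB) 𝓘(ℝ, EH) ∞ μB := by
    intro b
    obtain ⟨x, rfl⟩ := hsurj b
    obtain ⟨σ, U, hU, hxU, hσ, hqσ⟩ := hsec x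
    refine ((hμHsm.comp_contMDiffOn hσ).contMDiffAt (hU.mem_nhds hxU)).congr_of_eventuallyEq ?_
    filter_upwards [hU.mem_nhds hxU] with y hy
    change μB y = μH (σ y)
    rw [← hμB, hqσ y hy]
  refine ⟨μB, hμB, hμBsm, fun h b => ?_, fun b => ?_⟩
  · obtain ⟨x, rfl⟩ := hsurj b
    rw [← hequiv, hμB, hμB, hμHe]
  · obtain ⟨x, rfl⟩ := hsurj b
    intro θ η
    have h1 : ((θ.comp (mfderiv 𝓘(ℝ, EB) 𝓘(ℝ, EH) μB (q x)) : EB →L[ℝ] ℝ)).comp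
        (mfderiv 𝓘(ℝ, EM) 𝓘(ℝ, EB) q x : EM →L[ℝ] EB) =
        (θ : EH →L[ℝ] ℝ).comp (mfderiv 𝓘(ℝ, EM) 𝓘(ℝ, EH) μH x : EM →L[ℝ] EH) := by
      have h2 : (mfderiv 𝓘(ℝ, EM) 𝓘(ℝ, EH) (μB ∘ q) x : EM →L[ℝ] EH) = _ := mfderiv_comp x
        (hμBsm.mdifferentiableAt (by simp)) (hq.mdifferentiableAt (by simp))
      rw [hcomp] at h2
      exact congrArg (fun L : EM →L[ℝ] EH => (θ : EH →L[ℝ] ℝ).comp L) h2.symm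
    refine (hrel x _ _).trans ?_
    refine (congrArg (fun t : EM →L[ℝ] ℝ => π.toFun x t
      (η.comp (mfderiv 𝓘(ℝ, EM) 𝓘(ℝ, EB) q x))) h1).trans ?_
    refine (hμ.bivector_snd hτG hτH x θ _).trans ?_
    have h3 := mfderiv_comp_infinitesimalAction_inr (EG := EG) (EH := EH) hq hequiv x η
    have h4 : ∀ (g : H), g = μH x → ∀ t t' : LieDual 𝓘(ℝ, EH) H, t = t' →
        -(1 / 2) * (θ : EH →L[ℝ] ℝ) (mulInvariantVectorField (sH t) (μH x) +
          rightInvariantVectorField 𝓘(ℝ, EH) (lieMap 𝓘(ℝ, EH) 𝓘(ℝ, EH) τH.toMonoidHom (sH t))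
            (μH x)) =
        -(1 / 2) * (θ : EH →L[ℝ] ℝ) (mulInvariantVectorField (sH t') g +
          rightInvariantVectorField 𝓘(ℝ, EH) (lieMap 𝓘(ℝ, EH) 𝓘(ℝ, EH) τH.toMonoidHom (sH t'))
            g) := by
      rintro g rfl t t' rfl
      rfl
    exact h4 _ (hμB x) _ _ h3

variable {ED : Type*} [NormedAddCommGroup ED] [NormedSpace ℝ ED]
  {D : Type*} [TopologicalSpace D] [ChartedSpace ED D] [Group D] [LieGroup 𝓘(ℝ, ED) ∞ D]
  {EC : Type*} [NormedAddCommGroup EC] [NormedSpace ℝ EC] [TopologicalSpace C] [ChartedSpace EC C]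

/-- The moment map of the doubled subgroup is tangent to its orbits. -/
theorem mulInvariantVectorField_add_rightInvariantVectorField_mem_tangentSet
    {κ : D →* G × G} (hκ : ContMDiff 𝓘(ℝ, ED) (𝓘(ℝ, EG).prod 𝓘(ℝ, EG)) ∞ κ)
    {c : Set (GroupLieAlgebra 𝓘(ℝ, EG) G)} (hc : (0 : GroupLieAlgebra 𝓘(ℝ, EG) G) ∈ c)
    (hκc : doubledLieAlgebra sG c ⊆ subgroupLieAlgebra 𝓘(ℝ, ED) (𝓘(ℝ, EG).prod 𝓘(ℝ, EG)) κ)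
    (hτG : ContMDiff 𝓘(ℝ, EG) 𝓘(ℝ, EG) ∞ τG) {K : Set G}
    (hK : ∀ d : D, ∀ g ∈ K, τG (κ d).1 * g * (κ d).2⁻¹ ∈ K) {g : G} (hg : g ∈ K)
    {γ : LieDual 𝓘(ℝ, EG) G} (hγ : γ ∈ lieAnnihilator c) :
    (mulInvariantVectorField (sG γ) g + rightInvariantVectorField 𝓘(ℝ, EG)
      (lieMap 𝓘(ℝ, EG) 𝓘(ℝ, EG) τG.toMonoidHom (sG γ)) g : EG) ∈
      (tangentSet 𝓘(ℝ, EG) K g : Set EG) := by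
  -- With ξ = 0 the doubled Lie algebra contains (s♯γ, -s♯γ). The minus sign cancels the one from
  -- the inverse in g₁ g g₂⁻¹, so its velocity at g is the vector of the moment map condition.
  obtain ⟨ζ, hζ⟩ := hκc ⟨0, hc, γ, hγ, rfl⟩
  rw [zero_add, zero_sub] at hζ
  let κ₁ : D →* G := (MonoidHom.fst G G).comp κ
  let κ₂ : D →* G := (MonoidHom.snd G G).comp κ
  have hfst : ContMDiff (𝓘(ℝ, EG).prod 𝓘(ℝ, EG)) 𝓘(ℝ, EG) ∞ (MonoidHom.fst G G) := contMDiff_fst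
  have hsnd : ContMDiff (𝓘(ℝ, EG).prod 𝓘(ℝ, EG)) 𝓘(ℝ, EG) ∞ (MonoidHom.snd G G) := contMDiff_snd
  have hκ₁ : ContMDiff 𝓘(ℝ, ED) 𝓘(ℝ, EG) ∞ κ₁ := hfst.comp hκ
  have hκ₂ : ContMDiff 𝓘(ℝ, ED) 𝓘(ℝ, EG) ∞ κ₂ := hsnd.comp hκ
  have ha : ContMDiff 𝓘(ℝ, ED) 𝓘(ℝ, EG) ∞ (τG.toMonoidHom.comp κ₁) := hτG.comp hκ₁
  have h1 : lieMap 𝓘(ℝ, ED) 𝓘(ℝ, EG) (τG.toMonoidHom.comp κ₁) ζ =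
      lieMap 𝓘(ℝ, EG) 𝓘(ℝ, EG) τG.toMonoidHom (sG γ) := by
    rw [lieMap_comp hτG hκ₁, lieMap_comp hfst hκ, hζ, lieMap_fst_inl_add_inr]
  have h2 : lieMap 𝓘(ℝ, ED) 𝓘(ℝ, EG) κ₂ ζ = -sG γ := by
    rw [lieMap_comp hsnd hκ, hζ, lieMap_snd_inl_add_inr]
  let Ψ : D → G := fun d => τG.toMonoidHom.comp κ₁ d * g * (κ₂ d)⁻¹
  have hΨ : ContMDiff 𝓘(ℝ, ED) 𝓘(ℝ, EG) ∞ Ψ :=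
    ((contMDiff_mul_right (I := 𝓘(ℝ, EG)) (a := g)).comp ha).mul hκ₂.inv
  have h3 := mfderiv_hom_mul_mul_hom_inv (I := 𝓘(ℝ, EG)) ha hκ₂ g ζ
  rw [h1, h2, neg_neg] at h3
  have h4 := mem_tangentSet_of_mapsTo (T := K) hΨ (fun d _ => hK d g hg)
    (mem_tangentSet_univ (I := 𝓘(ℝ, ED)) (1 : D) ζ)
  have h5 : Ψ 1 = g := by simp [Ψ]
  have h6 := mem_tangentSet_congr (E := EG) (v := mfderiv 𝓘(ℝ, ED) 𝓘(ℝ, EG) Ψ (1 : D) ζ) h5 h4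
  rw [add_comm]
  exact h3 ▸ h6

/-- The reduced bivector field is tangent to the reduction of `μ⁻¹(K)`. -/
theorem IsTwistedMomentMap.bivector_eq_zero [FiniteDimensional ℝ EG]
    {πB : BivectorField 𝓘(ℝ, EB) B}
    [ContMDiffSMul (𝓘(ℝ, EG).prod 𝓘(ℝ, EH)) 𝓘(ℝ, EM) ∞ (G × H) M]
    (hμ : IsTwistedMomentMap (sumTensor sG sH) π (MulEquiv.prodCongr τG τH)
      (fun x => (μG x, μH x)))
    (hτG : ContMDiff 𝓘(ℝ, EG) 𝓘(ℝ, EG) ∞ τG) (hτH : ContMDiff 𝓘(ℝ, EH) 𝓘(ℝ, EH) ∞ τH)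
    (hrel : BivectorRelated q π πB) (hq : ContMDiff 𝓘(ℝ, EM) 𝓘(ℝ, EB) ∞ q)
    (hι : ContMDiff 𝓘(ℝ, EC) 𝓘(ℝ, EG) ∞ ι)
    (hinv : ∀ (c : C) (x : M), q ((ι c, (1 : H)) • x) = q x)
    {κ : D →* G × G} (hκ : ContMDiff 𝓘(ℝ, ED) (𝓘(ℝ, EG).prod 𝓘(ℝ, EG)) ∞ κ)
    (hκc : doubledLieAlgebra sG (subgroupLieAlgebra 𝓘(ℝ, EC) 𝓘(ℝ, EG) ι) ⊆
      subgroupLieAlgebra 𝓘(ℝ, ED) (𝓘(ℝ, EG).prod 𝓘(ℝ, EG)) κ) {K : Set G}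
    (hKsub : IsSubmanifold 𝓘(ℝ, EG) K)
    (hK : ∀ d : D, ∀ g ∈ K, τG (κ d).1 * g * (κ d).2⁻¹ ∈ K) {x : M} (hx : μG x ∈ K)
    {α : EB →L[ℝ] ℝ} (hα : ∀ v : EM, mfderiv 𝓘(ℝ, EM) 𝓘(ℝ, EG) μG x v ∈
      tangentSet 𝓘(ℝ, EG) K (μG x) → α (mfderiv 𝓘(ℝ, EM) 𝓘(ℝ, EB) q x v) = 0)
    (β : EB →L[ℝ] ℝ) : πB.toFun (q x) α β = 0 := by
  -- The set of velocities of curves in K is a linear subspace because it is the range of the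
  -- derivative of a weak embedding.
  obtain ⟨T, hT⟩ : ∃ T : Submodule ℝ EG, (T : Set EG) = tangentSet 𝓘(ℝ, EG) K (μG x) := by
    obtain ⟨k, A, _, _, j, hA, -, -, hj, rfl⟩ := hKsub
    obtain ⟨a, ha⟩ := hx
    let J : EuclideanSpace ℝ (Fin k) →L[ℝ] EG := mfderiv (𝓡 k) 𝓘(ℝ, EG) j a
    refine ⟨LinearMap.range J.toLinearMap, ?_⟩
    rw [← ha]
    exact (hj.tangentSet_range a).symm
  -- q*α = μ_G*θ with θ conormal to K, so the moment map condition applies to the first argument of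
  -- π.
  obtain ⟨θ, hθT, hθ⟩ := ContinuousLinearMap.exists_comp_eq_of_forall_mem (E := EM) (F := EG)
    (mfderiv 𝓘(ℝ, EM) 𝓘(ℝ, EG) μG x) T
    (α.comp (mfderiv 𝓘(ℝ, EM) 𝓘(ℝ, EB) q x : EM →L[ℝ] EB)) (fun v hv => hα v (by
      rw [← hT]
      exact hv))
  refine (hrel x α β).trans ?_
  refine (congrArg (fun t : EM →L[ℝ] ℝ => π.toFun x t
    (β.comp (mfderiv 𝓘(ℝ, EM) 𝓘(ℝ, EB) q x : EM →L[ℝ] EB))) hθ.symm).trans ?_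
  refine (hμ.bivector_fst hτG hτH x θ _).trans ?_
  have hγ := mfderiv_comp_infinitesimalAction_mem_lieAnnihilator (H := H) (EH := EH)
    hι hq hinv x β
  have hmem := mulInvariantVectorField_add_rightInvariantVectorField_mem_tangentSet hκ
    (c := subgroupLieAlgebra 𝓘(ℝ, EC) 𝓘(ℝ, EG) ι) ⟨0, map_zero _⟩ hκc hτG hK hx hγ
  rw [← hT] at hmem
  exact (congrArg (fun t : ℝ => -(1 / 2) * t) (hθT _ hmem)).trans (mul_zero _)

end ReducedMomentMap

end

/-! ### The reduction theorem -/

theorem mainTheorem7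
    {EG : Type*} [NormedAddCommGroup EG] [NormedSpace ℝ EG] [FiniteDimensional ℝ EG]
    {G : Type*} [TopologicalSpace G] [ChartedSpace EG G] [Group G] [LieGroup 𝓘(ℝ, EG) ∞ G]
    {EH : Type*} [NormedAddCommGroup EH] [NormedSpace ℝ EH] [FiniteDimensional ℝ EH]
    {H : Type*} [TopologicalSpace H] [ChartedSpace EH H] [Group H] [LieGroup 𝓘(ℝ, EH) ∞ H]
    {EC : Type*} [NormedAddCommGroup EC] [NormedSpace ℝ EC] [FiniteDimensional ℝ EC]
    {C : Type*} [TopologicalSpace C] [ChartedSpace EC C] [Group C] [LieGroup 𝓘(ℝ, EC) ∞ C]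
    {EM : Type*} [NormedAddCommGroup EM] [NormedSpace ℝ EM] [FiniteDimensional ℝ EM]
    {M : Type uM} [TopologicalSpace M] [ChartedSpace EM M] [IsManifold 𝓘(ℝ, EM) ∞ M] [T2Space M]
    [MulAction (G × H) M]
    (sG : TwoTensor 𝓘(ℝ, EG) G) (hsG : IsInvariantSymmetric sG)
    (sH : TwoTensor 𝓘(ℝ, EH) H) (hsH : IsInvariantSymmetric sH)
    (π : BivectorField 𝓘(ℝ, EM) M) (hπ : IsQuasiPoisson (sumTensor sG sH) π)
    -- the reducing subgroup `C`
    (ι : C →* G) (hι : IsLieSubgroup 𝓘(ℝ, EC) 𝓘(ℝ, EG) ι) (hC : IsReducing 𝓘(ℝ, EC) sG ι)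
    -- the `C`-orbits form a regular foliation
    {EB : Type*} [NormedAddCommGroup EB] [NormedSpace ℝ EB] [FiniteDimensional ℝ EB]
    [ChartedSpace EB (ReducedSpace ι H M)] [IsManifold 𝓘(ℝ, EB) ∞ (ReducedSpace ι H M)]
    [T2Space (ReducedSpace ι H M)]
    (hq : Manifold.IsSubmersion 𝓘(ℝ, EM) 𝓘(ℝ, EB) ∞
      (ReducedSpace.mk ι H : M → ReducedSpace ι H M)) :
    ∃ πB : BivectorField 𝓘(ℝ, EB) (ReducedSpace ι H M),
      BivectorRelated (ReducedSpace.mk ι H : M → ReducedSpace ι H M) π πB ∧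
      IsQuasiPoisson sH πB ∧
      ∀ (τG : G ≃* G) (τH : H ≃* H) (μG : M → G) (μH : M → H),
        IsTensorAutomorphism sG τG → IsTensorAutomorphism sH τH →
        IsTwistedMomentMap (sumTensor sG sH) π (MulEquiv.prodCongr τG τH)
          (fun x => (μG x, μH x)) →
        -- a Lie subgroup of `G × G` with Lie algebra `ĉ` and containing the diagonal of `C`
        ∀ {ED : Type*} [NormedAddCommGroup ED] [NormedSpace ℝ ED] [FiniteDimensional ℝ ED]
          {D : Type*} [TopologicalSpace D] [ChartedSpace ED D] [Group D] [LieGroup 𝓘(ℝ, ED) ∞ D]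
          (κ : D →* G × G),
          IsLieSubgroup 𝓘(ℝ, ED) (𝓘(ℝ, EG).prod 𝓘(ℝ, EG)) κ →
          subgroupLieAlgebra 𝓘(ℝ, ED) (𝓘(ℝ, EG).prod 𝓘(ℝ, EG)) κ =
            doubledLieAlgebra sG (subgroupLieAlgebra 𝓘(ℝ, EC) 𝓘(ℝ, EG) ι) →
          (∀ c : C, (ι c, ι c) ∈ κ.range) →
          ∀ K : Set G, IsSubmanifold 𝓘(ℝ, EG) K →
            (∀ d : D, ∀ g ∈ K, τG (κ d).1 * g * (κ d).2⁻¹ ∈ K) →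
            IntersectCleanly (𝓘(ℝ, EG).prod 𝓘(ℝ, EM))
              {p : G × M | p.1 = μG p.2} {p : G × M | p.1 ∈ K} →
            -- `μG⁻¹(K) / C` as a submanifold `j : A → M / C`
            ∃ (k : ℕ) (A : Type uM) (_ : TopologicalSpace A)
              (_ : ChartedSpace (EuclideanSpace ℝ (Fin k)) A)
              (j : A → ReducedSpace ι H M) (_ : MulAction H A) (πA : BivectorField (𝓡 k) A)
              (μA : A → H),
              IsManifold (𝓡 k) ∞ A ∧ T2Space A ∧ SecondCountableTopology A ∧
              IsWeakEmbedding 𝓘(ℝ, EB) (𝓡 k) j ∧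
              range j = ReducedSpace.mk ι H '' (μG ⁻¹' K) ∧
              (IsEmbeddedSubmanifold 𝓘(ℝ, EM) (μG ⁻¹' K) →
                Manifold.IsSmoothEmbedding (𝓡 k) 𝓘(ℝ, EB) ∞ j) ∧
              (∀ (h : H) (a : A), j (h • a) = h • j a) ∧
              BivectorRelated j πA πB ∧
              IsQuasiPoisson sH πA ∧
              (∀ (a : A) (x : M), j a = ReducedSpace.mk ι H x → μA a = μH x) ∧
              IsTwistedMomentMap sH πA τH μA := by
  have hqsm := hq.contMDiff
  have hιsm := hι.immersion.contMDiff
  have := hπ.smooth_action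
  have hsec : ∀ x, ∃ (σ : ReducedSpace ι H M → M) (U : Set (ReducedSpace ι H M)), IsOpen U ∧
      ReducedSpace.mk ι H x ∈ U ∧ ContMDiffOn 𝓘(ℝ, EB) 𝓘(ℝ, EM) ∞ σ U ∧
      ∀ y ∈ U, ReducedSpace.mk ι H (σ y) = y := fun x => by
    obtain ⟨σ, U, hU, hxU, hσ, -, hqσ⟩ := (hq.isSubmersionAt x).exists_section
    exact ⟨σ, U, hU, hxU, hσ, hqσ⟩
  have horb : ∀ x x' : M, ReducedSpace.mk ι H x = ReducedSpace.mk ι H x' →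
      ∃ c : C, x' = (ι c, (1 : H)) • x := fun x x' => ReducedSpace.mk_eq_iff.1
  obtain ⟨πB, hrel, hπB⟩ := hπ.exists_reduction hιsm hC hqsm hsec ReducedSpace.mk_surjective
    ReducedSpace.mk_smul_subgroup horb ReducedSpace.mk_smul
  refine ⟨πB, hrel, hπB, ?_⟩
  intro τG τH μG μH hτG hτH hμ ED _ _ _ D _ _ _ _ κ hκ hκc hdiag K hKsub hK hclean
  have hsmB := hπB.smooth_action
  have hμG : ContMDiff 𝓘(ℝ, EM) 𝓘(ℝ, EG) ∞ μG := contMDiff_fst.comp hμ.contMDiff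
  have hμGe : ∀ (g : G) (h : H) (x : M), μG ((g, h) • x) = τG g * μG x * g⁻¹ := fun g h x =>
    congrArg Prod.fst (hμ.equivariant (g, h) x)
  have hGM : IsManifold 𝓘(ℝ, EG) ∞ G := inferInstance
  obtain ⟨k₀, Q, _, _, i, hQ, -, hQ2, hi, hri, htan⟩ := hclean.exists_weakEmbedding hμG
  have hiK : ∀ a, μG (i a) ∈ K := fun a => by
    have : i a ∈ range i := mem_range_self a
    rwa [hri] at this
  -- C acts on μG by τG(c) g c⁻¹, which is the action of (c, c) ∈ Ĉ and preserves K; so μG⁻¹(K) is a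
  -- union of C-orbits.
  have hsat : ∀ a x, ReducedSpace.mk ι H x = ReducedSpace.mk ι H (i a) → x ∈ range i := by
    intro a x hx
    obtain ⟨c, rfl⟩ := horb _ _ hx.symm
    obtain ⟨d, hd⟩ := hdiag c
    rw [hri]
    change μG ((ι c, (1 : H)) • i a) ∈ K
    rw [hμGe]
    have := hK d _ (hiK a)
    rwa [hd] at this
  obtain ⟨A, _, p, j, hp, hj, hjp⟩ := exists_image_factorization fun a => ReducedSpace.mk ι H (i a)
  obtain ⟨m, _, hA, hA2, hAc, hweak, hpsm, -⟩ := hq.exists_manifold_image hsat hi hp hj hjp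
  have hrange : range j = ReducedSpace.mk ι H '' (μG ⁻¹' K) := by
    rw [← hri, ← range_comp, ← hp.surjective.range_comp]
    exact congrArg range (funext hjp)
  have hsmA : ∀ (h : H) (a : A), h • j a ∈ range j := by
    intro h a
    obtain ⟨c, rfl⟩ := hp.surjective a
    rw [hrange, hjp, ← ReducedSpace.mk_smul]
    refine ⟨_, ?_, rfl⟩
    change μG (((1 : G), h) • i c) ∈ K
    rw [hμGe, map_one, one_mul, inv_one, mul_one]
    exact hiK c
  have hHM : IsManifold 𝓘(ℝ, EH) ∞ H := inferInstance
  obtain ⟨_, hequiv, hact⟩ := hweak.exists_mulAction (IH := 𝓘(ℝ, EH)) hsmA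
  have hjsm := hweak.immersion.contMDiff
  -- Each v with dμG v ∈ TK has the form di w by cleanness, and dq(di w) = dj(dp w), so a covector
  -- that kills the image of dj kills dq v. This is the hypothesis of
  -- `IsTwistedMomentMap.bivector_eq_zero`.
  have hnull : ∀ (a : A) (α β : EB →L[ℝ] ℝ),
      α.comp (mfderiv (𝓡 m) 𝓘(ℝ, EB) j a : EuclideanSpace ℝ (Fin m) →L[ℝ] EB) = 0 →
      πB.toFun (j a) α β = 0 := by
    intro a α β hα
    obtain ⟨c, rfl⟩ := hp.surjective a
    refine (πB.toFun_congr (hjp c) α β).trans ?_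
    refine hμ.bivector_eq_zero hτG.contMDiff hτH.contMDiff hrel hqsm hιsm
      ReducedSpace.mk_smul_subgroup hκ.immersion.contMDiff hκc.ge hKsub hK (hiK c) ?_ β
    intro v hv
    obtain ⟨w, rfl⟩ := htan c v hv
    have h1 := mfderiv_comp_apply (I := 𝓡 k₀) (I' := 𝓘(ℝ, EM)) (I'' := 𝓘(ℝ, EB))
      (f := i) (g := (ReducedSpace.mk ι H : M → ReducedSpace ι H M)) c
      (hqsm.mdifferentiableAt (by simp)) (hi.immersion.contMDiff.mdifferentiableAt (by simp)) w
    have h2 := mfderiv_comp_apply (I := 𝓡 k₀) (I' := 𝓡 m) (I'' := 𝓘(ℝ, EB)) (f := p) (g := j) c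
      (hjsm.mdifferentiableAt (by simp)) (hpsm.mdifferentiableAt (by simp)) w
    have h3 : j ∘ p = (ReducedSpace.mk ι H : M → ReducedSpace ι H M) ∘ i := funext hjp
    rw [h3] at h2
    exact (congrArg α (h1.symm.trans h2)).trans (DFunLike.congr_fun hα _)
  obtain ⟨πA, hrelA⟩ := BivectorField.exists_restriction hweak.immersion πB hnull
  obtain ⟨μB, hμB, hmomB⟩ := hμ.exists_descent hτG.contMDiff hτH.contMDiff hrel hqsm hsec
    ReducedSpace.mk_surjective horb ReducedSpace.mk_smul
  refine ⟨m, A, inferInstance, inferInstance, j, inferInstance, πA, μB ∘ j, hA, hA2, hAc, hweak,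
    hrange, fun hS => ⟨hweak.immersion, ?_⟩, hequiv, hrelA,
    hπB.of_immersion hweak.immersion hrelA hact hequiv, fun a x hx => ?_,
    hmomB.comp_immersion hweak.immersion hrelA hact hequiv⟩
  · rw [← hri] at hS
    exact hq.isEmbedding_image hsat hi hp hj hjp hS
  · exact (congrArg μB hx).trans (hμB x)
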